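/- **Setting.** Let $n\ge 1$ and $p,q\ge 0$, let $f_i,g_i:\mathbb R^p\times\mathbb R^q\to\mathbb R$ ($1\le i\le n$), put $g=\frac1n\sum_i g_i$, $y^*(x)=\operatorname{argmin}_{y} g(x,y)$ and $\Phi(x)=\frac1n\sum_i f_i(x,y^*(x))$. Assume: (A1) $f_i$ is differentiable and $g_i$ twice differentiable; $f_i,\nabla f_i,\nabla g_i,\nabla^2 g_i$ are Lipschitz with constants $L_{f,0},L_{f,1},L_{g,1},L_{g,2}>0$, and $g_i$ is $\mu_g$-strongly convex in $y$, $\mu_g>0$ (Hessians carry the operator norm). (A2) $W=(w_{ij})\in\mathbb R^{n\times n}$ is symmetric with $w_{ij}\ge 0$, $W\mathbf 1=\mathbf 1$, and its eigenvalues satisfy $1=\lambda_1>\lambda_2\ge\dots\ge\lambda_n$ and $\max_{j\ge 2}|\lambda_j|\le\rho<1$. (A3) $\|\nabla_y g_i(x,y)-\frac1n\sum_l\nabla_y g_l(x,y)\|\le\delta$ for all $i,x,y$. (A4) The stochastic derivatives $\nabla f_i(x,y;\phi)$ with $\phi\sim\mathcal D_{f_i}$, and $\nabla g_i(x,y;\xi)$,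 $\nabla^2 g_i(x,y;\xi)$ with $\xi\sim\mathcal D_{g_i}$, are unbiased estimators of $\nabla f_i,\nabla g_i,\nabla^2g_i$ with variances at most $\sigma_f^2,\sigma_{g,1}^2,\sigma_{g,2}^2$. All samples drawn below are independent, those of agent $i$ having law $\mathcal D_{f_i}$ or $\mathcal D_{g_i}$. (A5) $\inf_x\Phi(x)>-\infty$. **Algorithm (MA-DSBO).** Inputs: step sizes $\alpha,\beta,\gamma$, iteration numbers $K,T,N$. Start with $x_{i,0}=r_{i,0}=0$ and $y_{i,0}^{(0)}=0$. For $k=0,1,\dots,K-1$: 1. If $k\ge1$ set $y_{i,k}^{(0)}=y_{i,k-1}^{(T)}$. For $t=0,\dots,T-1$ put $y_{i,k}^{(t+1)}=\sum_j w_{ij}y_{j,k}^{(t)}-\beta\,\nabla_y g_i(x_{i,k},y_{i,k}^{(t)};\tilde\xi_{i,k}^{(t)})$. 2. (HIGP oracle.) Draw fresh samples $\phi_{i,t},\xi_{i,t}$, $0\le t\le N$, and put $H_{i,t}=\nabla_y^2g_i(x_{i,k},y_{i,k}^{(T)};\xi_{i,t})$, $b_{i,t}=\nabla_yf_i(x_{i,k},y_{i,k}^{(T)};\phi_{i,t})$.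 Start with $z_{i,0}=0$, $d_{i,0}=s_{i,0}=-b_{i,0}$; for $t=0,\dots,N-1$ put $z_{i,t+1}=\sum_jw_{ij}z_{j,t}-\gamma d_{i,t}$, $s_{i,t+1}=H_{i,t+1}z_{i,t+1}-b_{i,t+1}$, $d_{i,t+1}=\sum_jw_{ij}d_{j,t}+s_{i,t+1}-s_{i,t}$. Set $u_{i,k}=\nabla_xf_i(x_{i,k},y_{i,k}^{(T)};\phi_{i,0})-\nabla_{xy}^2g_i(x_{i,k},y_{i,k}^{(T)};\xi_{i,0})\,z_{i,N}$. 3. $x_{i,k+1}=\sum_jw_{ij}x_{j,k}-\alpha r_{i,k}$ and $r_{i,k+1}=(1-\alpha)r_{i,k}+\alpha u_{i,k}$. Write $\bar x_k=\frac1n\sum_ix_{i,k}$ and $X_k=(x_{1,k},\dots,x_{n,k})$. **Theorem.** There are constants $0<c_1<c_2$, depending only on $n$ and on $\mu_g,L_{f,0},L_{f,1},L_{g,1},L_{g,2},\rho,\delta,\sigma_f,\sigma_{g,1},\sigma_{g,2}$, such that for every $\gamma\in(c_1,c_2)$ there are constants $\kappa,\nu>0$, depending only on these quantities and $\gamma$,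 with the following property. Assume (A1)–(A5), let $T\ge1$, and for each $K$ let the step sizes $\alpha=\alpha(K)>0$, $\beta=\beta(K)>0$ (constant in $k$) and $N=N(K)$ satisfy, as $K\to\infty$, $$\alpha=\Theta\big(1/\sqrt K\big),\qquad \beta=\Theta\big(1/\sqrt K\big),\qquad N=\Theta(\log K),$$ where the constants in $\Theta$ are such that $\alpha\le\kappa\beta$ and $N\ge\nu\log K$ for all large $K$. Then $\Phi$ is differentiable, the random variables below are integrable, and as $K\to\infty$ $$\min_{0\le k\le K}\mathbb E\big[\|\nabla\Phi(\bar x_k)\|^2\big]=\mathcal O\Big(\frac1{\sqrt K}\Big),\qquad \min_{0\le k\le K}\frac{\mathbb E\big[\|X_k-\bar x_k\mathbf 1^\top\|^2\big]}{n}=\mathcal O\Big(\frac1K\Big).$$ Moreover both bounds also hold with the minimum over $0\le k\le K$ replaced by the average $\frac1{K+1}\sum_{k=0}^K$. -/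

import Mathlib

open Filter MeasureTheory ProbabilityTheory Asymptotics
open scoped NNReal ENNReal Topology

noncomputable section

/-- The joint variable `(x, y)` in `ℝ^p × ℝ^q`, with the Euclidean norm. -/
abbrev JointSpace (p q : ℕ) : Type :=
  WithLp 2 (EuclideanSpace ℝ (Fin p) × EuclideanSpace ℝ (Fin q))

/-- The point `(x, y)`. -/
def joint {p q : ℕ} (x : EuclideanSpace ℝ (Fin p)) (y : EuclideanSpace ℝ (Fin q)) :
    JointSpace p q :=
  WithLp.toLp 2 (x, y)

/-- The average `(1/n) ∑ i, v i` over the agents. -/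
def agentAvg {n : ℕ} {E : Type*} [AddCommGroup E] [Module ℝ E] (v : Fin n → E) : E :=
  (n : ℝ)⁻¹ • ∑ i, v i

/-- The `yy`-block of a Hessian applied to a vector: `(∇²_y g) v`. -/
def hessYY {p q : ℕ} (A : JointSpace p q →L[ℝ] JointSpace p q) (v : EuclideanSpace ℝ (Fin q)) :
    EuclideanSpace ℝ (Fin q) :=
  (A (joint 0 v)).snd

/-- The `xy`-block of a Hessian applied to a vector: `(∇²_{xy} g) v`, where `∇²_{xy} g` is
`p × q`. -/
def jacXY {p q : ℕ} (A : JointSpace p q →L[ℝ] JointSpace p q) (v : EuclideanSpace ℝ (Fin q)) :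
    EuclideanSpace ℝ (Fin p) :=
  (A (joint 0 v)).fst

/-- The constants of the problem class. -/
structure DSBOConstants where
  /-- strong convexity modulus of the lower level functions -/
  μg : ℝ
  /-- Lipschitz constant of `f_i` -/
  Lf0 : ℝ≥0
  /-- Lipschitz constant of `∇ f_i` -/
  Lf1 : ℝ≥0
  /-- Lipschitz constant of `∇ g_i` -/
  Lg1 : ℝ≥0
  /-- Lipschitz constant of `∇² g_i` -/
  Lg2 : ℝ≥0
  /-- bound on the second largest modulus of an eigenvalue of the mixing matrix -/
  ρ : ℝ
  /-- heterogeneity of the lower level gradients -/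
  δ : ℝ
  /-- standard deviation of the oracle for `∇ f_i` -/
  σf : ℝ
  /-- standard deviation of the oracle for `∇ g_i` -/
  σg1 : ℝ
  /-- standard deviation of the oracle for `∇² g_i` -/
  σg2 : ℝ
  μg_pos : 0 < μg
  Lf0_pos : 0 < Lf0
  Lf1_pos : 0 < Lf1
  Lg1_pos : 0 < Lg1
  Lg2_pos : 0 < Lg2
  ρ_lt_one : ρ < 1
  δ_nonneg : 0 ≤ δ

/-- The data of a decentralized stochastic bilevel problem with `n` agents: local objectives,
mixing matrix, data distributions on the sample spaces `Ψ` (for `f`) and `Ξ` (for `g`), and the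
stochastic first and second derivatives. -/
structure DSBOProblem (n p q : ℕ) (Ξ Ψ : Type*) [MeasurableSpace Ξ] [MeasurableSpace Ψ] where
  /-- upper level local objectives `f_i` -/
  f : Fin n → JointSpace p q → ℝ
  /-- lower level local objectives `g_i` -/
  g : Fin n → JointSpace p q → ℝ
  /-- mixing matrix -/
  W : Matrix (Fin n) (Fin n) ℝ
  /-- distribution of the upper level samples of agent `i` -/
  distF : Fin n → Measure Ψ
  /-- distribution of the lower level samples of agent `i` -/
  distG : Fin n → Measure Ξ
  /-- stochastic gradient `∇ f_i(x, y; φ)` -/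
  gradF : Fin n → JointSpace p q → Ψ → JointSpace p q
  /-- stochastic gradient `∇ g_i(x, y; ξ)` -/
  gradG : Fin n → JointSpace p q → Ξ → JointSpace p q
  /-- stochastic Hessian `∇² g_i(x, y; ξ)` -/
  hessG : Fin n → JointSpace p q → Ξ → (JointSpace p q →L[ℝ] JointSpace p q)

/-- `G z s`, with `s` drawn from `D`, is an unbiased estimator of `m z` with variance at most
`σ ^ 2`, for every `z`. -/
structure IsUnbiasedOracle {Z S V : Type*} [MeasurableSpace Z] [MeasurableSpace S]
    [NormedAddCommGroup V] [NormedSpace ℝ V] [MeasurableSpace V]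
    (G : Z → S → V) (m : Z → V) (D : Measure S) (σ : ℝ) : Prop where
  measurable : Measurable (Function.uncurry G)
  memLp : ∀ z, MemLp (G z) 2 D
  unbiased : ∀ z, ∫ s, G z s ∂D = m z
  variance_le : ∀ z, ∫ s, ‖G z s - m z‖ ^ 2 ∂D ≤ σ ^ 2

namespace DSBOProblem

variable {n p q : ℕ} {Ξ Ψ : Type*} [MeasurableSpace Ξ] [MeasurableSpace Ψ]

/-- The global lower level objective `g = (1/n) ∑ i, g_i`. -/
def gAvg (D : DSBOProblem n p q Ξ Ψ) (z : JointSpace p q) : ℝ :=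
  agentAvg fun i => D.g i z

/-- `y*(x)`, a minimizer of `g(x, ·)` (the only one, when `g(x, ·)` is strongly convex). -/
def yStar (D : DSBOProblem n p q Ξ Ψ) (x : EuclideanSpace ℝ (Fin p)) :
    EuclideanSpace ℝ (Fin q) :=
  Classical.epsilon fun y => IsMinOn (fun y' => D.gAvg (joint x y')) Set.univ y

/-- The bilevel objective `Φ(x) = (1/n) ∑ i, f_i(x, y*(x))`. -/
def Phi (D : DSBOProblem n p q Ξ Ψ) (x : EuclideanSpace ℝ (Fin p)) : ℝ :=
  agentAvg fun i => D.f i (joint x (D.yStar x))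

/-- Smoothness of the objectives and strong convexity of the `g_i` in `y`. Hessians carry the
operator norm. -/
structure IsSmooth (D : DSBOProblem n p q Ξ Ψ) (c : DSBOConstants) : Prop where
  differentiable_f : ∀ i, Differentiable ℝ (D.f i)
  differentiable_g : ∀ i, Differentiable ℝ (D.g i)
  differentiable_gradient_g : ∀ i, Differentiable ℝ (gradient (D.g i))
  lipschitz_f : ∀ i, LipschitzWith c.Lf0 (D.f i)
  lipschitz_gradient_f : ∀ i, LipschitzWith c.Lf1 (gradient (D.f i))
  lipschitz_gradient_g : ∀ i, LipschitzWith c.Lg1 (gradient (D.g i))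
  lipschitz_hessian_g : ∀ i, LipschitzWith c.Lg2 (fun z => fderiv ℝ (gradient (D.g i)) z)
  strongConvex_g : ∀ i x, StrongConvexOn Set.univ c.μg fun y => D.g i (joint x y)

/-- The mixing matrix is symmetric and doubly stochastic, its eigenvalues
`λ₁ ≥ λ₂ ≥ ... ≥ λₙ` satisfy `λ₁ = 1`, and the other ones have modulus at most `ρ` (`ρ < 1` is
part of `DSBOConstants`). `eigenvalues₀` is the antitone list of the eigenvalues. -/
structure IsMixing (D : DSBOProblem n p q Ξ Ψ) (c : DSBOConstants) : Prop where
  symm : D.W.IsHermitian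
  row_sum : ∀ i, ∑ j, D.W i j = 1
  nonneg : ∀ i j, 0 ≤ D.W i j
  eigenvalue_first : ∀ j, j.val = 0 → symm.eigenvalues₀ j = 1
  spectral_gap : ∀ j, 0 < j.val → |symm.eigenvalues₀ j| ≤ c.ρ

/-- Bounded heterogeneity of the lower level gradients in `y`. -/
def HasBoundedHeterogeneity (D : DSBOProblem n p q Ξ Ψ) (c : DSBOConstants) : Prop :=
  ∀ i z, ‖(gradient (D.g i) z).snd - agentAvg fun l => (gradient (D.g l) z).snd‖ ≤ c.δ

/-- The stochastic derivatives are unbiased with bounded variance. -/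
structure HasOracles (D : DSBOProblem n p q Ξ Ψ) (c : DSBOConstants) : Prop where
  gradF : ∀ i, IsUnbiasedOracle (D.gradF i) (gradient (D.f i)) (D.distF i) c.σf
  gradG : ∀ i, IsUnbiasedOracle (D.gradG i) (gradient (D.g i)) (D.distG i) c.σg1
  hessG : ∀ i, IsUnbiasedOracle (D.hessG i) (fun z => fderiv ℝ (gradient (D.g i)) z)
    (D.distG i) c.σg2

end DSBOProblem

/-- The random samples used by the algorithm. All of them are indexed by the outer iteration `k`,
the inner index `t` and the agent `i`: `lower k t i` is the sample of the `t`-th inner step on `y`,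
`hess k t i` and `grad k t i` are the samples `ξ_{i,t}`, `φ_{i,t}` of the hypergradient
estimation. -/
structure DSBOSamples (n : ℕ) (Ξ Ψ Ω : Type*) where
  /-- samples of the inner loop -/
  lower : ℕ → ℕ → Fin n → Ω → Ξ
  /-- lower level samples of the hypergradient estimation -/
  hess : ℕ → ℕ → Fin n → Ω → Ξ
  /-- upper level samples of the hypergradient estimation -/
  grad : ℕ → ℕ → Fin n → Ω → Ψ

/-- Names of the individual samples. -/
inductive SampleIndex (n : ℕ) : Type
  | lower (k t : ℕ) (i : Fin n)
  | hess (k t : ℕ) (i : Fin n)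
  | grad (k t : ℕ) (i : Fin n)

namespace DSBOSamples

variable {n p q : ℕ} {Ξ Ψ Ω : Type*} [MeasurableSpace Ξ] [MeasurableSpace Ψ]

/-- The σ-algebra generated by one sample. -/
@[reducible] def sigmaAlgebra (S : DSBOSamples n Ξ Ψ Ω) : SampleIndex n → MeasurableSpace Ω
  | .lower k t i => MeasurableSpace.comap (S.lower k t i) inferInstance
  | .hess k t i => MeasurableSpace.comap (S.hess k t i) inferInstance
  | .grad k t i => MeasurableSpace.comap (S.grad k t i) inferInstance

/-- All samples are drawn independently, each from the distribution of its agent. -/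
structure IsIndependentSampling [MeasurableSpace Ω] (S : DSBOSamples n Ξ Ψ Ω)
    (D : DSBOProblem n p q Ξ Ψ) (P : Measure Ω) : Prop where
  lower : ∀ k t i, MeasurePreserving (S.lower k t i) P (D.distG i)
  hess : ∀ k t i, MeasurePreserving (S.hess k t i) P (D.distG i)
  grad : ∀ k t i, MeasurePreserving (S.grad k t i) P (D.distF i)
  indep : iIndep S.sigmaAlgebra P

end DSBOSamples

/-- One step of gossip averaging, `i ↦ ∑ j, w_{ij} v_j`. -/
def mix {n : ℕ} {E : Type*} [AddCommGroup E] [Module ℝ E] (W : Matrix (Fin n) (Fin n) ℝ)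
    (v : Fin n → E) : Fin n → E :=
  fun i => ∑ j, W i j • v j

/-- State of the Hessian-inverse-gradient-product oracle: `z_{i,t}`, `d_{i,t}`, `s_{i,t}`. -/
structure HIGPState (n q : ℕ) where
  /-- current estimate -/
  z : Fin n → EuclideanSpace ℝ (Fin q)
  /-- gradient tracking variable -/
  d : Fin n → EuclideanSpace ℝ (Fin q)
  /-- local stochastic gradient -/
  s : Fin n → EuclideanSpace ℝ (Fin q)

/-- The Hessian-inverse-gradient-product oracle, run with matrices `H t i` (given through their
action on vectors), vectors `b t i` and step size `γ`. -/
def higp {n q : ℕ} (W : Matrix (Fin n) (Fin n) ℝ) (γ : ℝ)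
    (H : ℕ → Fin n → EuclideanSpace ℝ (Fin q) → EuclideanSpace ℝ (Fin q))
    (b : ℕ → Fin n → EuclideanSpace ℝ (Fin q)) : ℕ → HIGPState n q
  | 0 => { z := 0, d := fun i => -b 0 i, s := fun i => -b 0 i }
  | t + 1 =>
    let A := higp W γ H b t
    let z' : Fin n → EuclideanSpace ℝ (Fin q) := fun i => mix W A.z i - γ • A.d i
    let s' : Fin n → EuclideanSpace ℝ (Fin q) := fun i => H (t + 1) i (z' i) - b (t + 1) i
    { z := z', d := fun i => mix W A.d i + s' i - A.s i, s := s' }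

/-- The inner loop `y_i^{(t+1)} = ∑ j, w_{ij} y_j^{(t)} - β v_i^{(t)}`, where
`v_i^{(t)} = v t i (y_i^{(t)})`, started at `y0`. -/
def innerLoop {n q : ℕ} (W : Matrix (Fin n) (Fin n) ℝ) (β : ℝ)
    (v : ℕ → Fin n → EuclideanSpace ℝ (Fin q) → EuclideanSpace ℝ (Fin q))
    (y0 : Fin n → EuclideanSpace ℝ (Fin q)) : ℕ → Fin n → EuclideanSpace ℝ (Fin q)
  | 0 => y0
  | t + 1 => fun i =>
    mix W (innerLoop W β v y0 t) i - β • v t i (innerLoop W β v y0 t i)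

/-- State at the beginning of outer iteration `k`: `x_{i,k}`, `r_{i,k}` and the starting point
`y_{i,k}^{(0)}` of the inner loop. -/
structure MADSBOState (n p q : ℕ) where
  /-- upper level iterate -/
  x : Fin n → EuclideanSpace ℝ (Fin p)
  /-- moving average of the hypergradient estimates -/
  r : Fin n → EuclideanSpace ℝ (Fin p)
  /-- warm start of the inner loop -/
  y : Fin n → EuclideanSpace ℝ (Fin q)

namespace DSBOProblem

variable {n p q : ℕ} {Ξ Ψ Ω : Type*} [MeasurableSpace Ξ] [MeasurableSpace Ψ]

/-- The output `y_{i,k}^{(T)}` of the inner loop of outer iteration `k`. -/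
def innerOutput (D : DSBOProblem n p q Ξ Ψ) (S : DSBOSamples n Ξ Ψ Ω) (β : ℝ) (T : ℕ) (ω : Ω)
    (k : ℕ) (x : Fin n → EuclideanSpace ℝ (Fin p)) (y0 : Fin n → EuclideanSpace ℝ (Fin q)) :
    Fin n → EuclideanSpace ℝ (Fin q) :=
  innerLoop D.W β (fun t i y => (D.gradG i (joint (x i) y) (S.lower k t i ω)).snd) y0 T

/-- The hypergradient estimates `u_{i,k}` computed at the points `(x_i, y_i)` from the samples of
outer iteration `k`, with `N` steps of the Hessian-inverse-gradient-product oracle. -/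
def hypergradEstimate (D : DSBOProblem n p q Ξ Ψ) (S : DSBOSamples n Ξ Ψ Ω) (γ : ℝ) (N : ℕ)
    (ω : Ω) (k : ℕ) (x : Fin n → EuclideanSpace ℝ (Fin p))
    (y : Fin n → EuclideanSpace ℝ (Fin q)) : Fin n → EuclideanSpace ℝ (Fin p) :=
  let z := (higp D.W γ
    (fun t i v => hessYY (D.hessG i (joint (x i) (y i)) (S.hess k t i ω)) v)
    (fun t i => (D.gradF i (joint (x i) (y i)) (S.grad k t i ω)).snd) N).z
  fun i => (D.gradF i (joint (x i) (y i)) (S.grad k 0 i ω)).fst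
    - jacXY (D.hessG i (joint (x i) (y i)) (S.hess k 0 i ω)) (z i)

/-- The MA-DSBO algorithm with step sizes `α k`, `β k`, `γ`, and `T`, `N` inner steps. -/
def maDSBO (D : DSBOProblem n p q Ξ Ψ) (S : DSBOSamples n Ξ Ψ Ω) (α β : ℕ → ℝ) (γ : ℝ)
    (T N : ℕ) (ω : Ω) : ℕ → MADSBOState n p q
  | 0 => { x := 0, r := 0, y := 0 }
  | k + 1 =>
    let A := D.maDSBO S α β γ T N ω k
    let yT := D.innerOutput S (β k) T ω k A.x A.y
    let u := D.hypergradEstimate S γ N ω k A.x yT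
    { x := fun i => mix D.W A.x i - α k • A.r i
      r := fun i => (1 - α k) • A.r i + α k • u i
      y := yT }

/-- The squared norm `‖∇Φ(x̄_k)‖²` along a run of MA-DSBO. -/
def stationarity (D : DSBOProblem n p q Ξ Ψ) (S : DSBOSamples n Ξ Ψ Ω) (α β : ℕ → ℝ) (γ : ℝ)
    (T N k : ℕ) (ω : Ω) : ℝ :=
  ‖gradient D.Phi (agentAvg (D.maDSBO S α β γ T N ω k).x)‖ ^ 2

/-- The consensus error `‖X_k - x̄_k 1ᵀ‖² / n` (Frobenius norm) along a run of MA-DSBO. -/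
def consensusError (D : DSBOProblem n p q Ξ Ψ) (S : DSBOSamples n Ξ Ψ Ω) (α β : ℕ → ℝ) (γ : ℝ)
    (T N k : ℕ) (ω : Ω) : ℝ :=
  (∑ i, ‖(D.maDSBO S α β γ T N ω k).x i - agentAvg (D.maDSBO S α β γ T N ω k).x‖ ^ 2) / n

end DSBOProblem

/-- The minimum of `a 0, ..., a K`. -/
def minUpTo (a : ℕ → ℝ) (K : ℕ) : ℝ :=
  (Finset.range (K + 1)).inf' Finset.nonempty_range_add_one a

/-- The average of `a 0, ..., a K`. -/
def avgUpTo (a : ℕ → ℝ) (K : ℕ) : ℝ :=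
  (∑ k ∈ Finset.range (K + 1), a k) / ((K : ℝ) + 1)

end

/-!
# Convergence of MA-DSBO

Everything is measured by a handful of expected errors along the run (`DSBOProblem.consX`,
`consY`, `lowerErr`, `momAvgR`, `gradErr`, `meanErr`, `expPhi`), which satisfy coupled one-step
recursions. The samples of each step are independent of the iterates they are applied to, so that
centered noise only enters through its variance (`integral_norm_add_fresh_sq_le`,
`integral_inner_fresh_eq_zero`).

*The bilevel objective.* Strong convexity makes `y*` Lipschitz, the implicit gradient of `Φ` at `x`
is the hypergradient `D.hyp` with all agents at `(x, y*(x))`, and both are Lipschitz, so `Φ` has a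
Lipschitz gradient (`IsSmooth.hasGradientAt_Phi`, `IsSmooth.norm_gradient_Phi_sub_le`).

*The Hessian-inverse-gradient-product oracle.* For fixed `(x_i, y_i)` it is gradient tracking for a
strongly convex quadratic with noisy matrices. The error to the solution, the consensus error of
`z` and the tracking error of `d` contract jointly, in second moment, for `γ` below a threshold
that depends only on the constants (`exists_higp_bound`). Since each step uses fresh matrices, the
mean of the iterates follows the same recursion with the mean matrices and without noise. Hence the
hypergradient estimates have bounded second moment and a bias of order `θ ^ N`
(`DSBOProblem.exists_estimator_bound`), and `N` of order `log K` makes this bias `O(1 / K)`.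

*Consensus.* The moving averages `r_{i,k}` have bounded second moment because the estimates do, so
mixing keeps the disagreement of the `x_{i,k}` of order `α ^ 2` and, by bounded heterogeneity, that
of the inner iterates of order `β ^ 2` (`consX_le`, `consY_le`).

*Tracking.* The distance of the average inner iterate to `y*(x̄_k)` contracts at rate `β μ / 4` per
outer iteration and is disturbed by `(α ^ 2 / β) E‖r̄_k‖²` and `O(β ^ 2)` (`lowerErr_outer_le`).

*Descent.* `Φ(x̄_k) + ‖r̄_k‖² / 2` is a Lyapunov function: the inner products of `r̄_k` with the mean
estimate cancel, and it decreases by `(α / 2) E‖r̄_k‖²` up to the bias, which is controlled by the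
tracking error (`expPhi_succ_add_le`, `meanErr_le`). If `α / β` is small, the part of the tracking
error that is fed by `E‖r̄_k‖²` is absorbed by the decrease, so `α ∑ E‖r̄_k‖²` is bounded; the error
recursion of the moving average (`gradErr_succ_le`) then bounds `α ∑ E‖∇Φ(x̄_k)‖²`
(`sum_le_of_recursions`). Dividing by `α K` gives the rate for the averages, which dominate the
minima.
-/

noncomputable section

/-! ### Averages, deviations from the average, and gossip -/

lemma norm_add_sq_le_young {E : Type*} [NormedAddCommGroup E] {s : ℝ} (hs : 0 < s)
    (a b : E) : ‖a + b‖ ^ 2 ≤ (1 + s) * ‖a‖ ^ 2 + (1 + 1 / s) * ‖b‖ ^ 2 := by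
  have h := norm_add_le a b
  have h1 : ‖a + b‖ ^ 2 ≤ (‖a‖ + ‖b‖) ^ 2 := by gcongr
  have h2 : 2 * ‖a‖ * ‖b‖ ≤ s * ‖a‖ ^ 2 + 1 / s * ‖b‖ ^ 2 := by
    have := sq_nonneg (s * ‖a‖ - ‖b‖)
    have h3 : s * ‖a‖ ^ 2 + 1 / s * ‖b‖ ^ 2 - 2 * ‖a‖ * ‖b‖ = (s * ‖a‖ - ‖b‖) ^ 2 / s := by
      field_simp
      ring
    have : 0 ≤ (s * ‖a‖ - ‖b‖) ^ 2 / s := by positivity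
    linarith
  nlinarith

lemma norm_add_sq_le_two {E : Type*} [NormedAddCommGroup E] (a b : E) :
    ‖a + b‖ ^ 2 ≤ 2 * ‖a‖ ^ 2 + 2 * ‖b‖ ^ 2 := by
  have := norm_add_sq_le_young one_pos a b
  norm_num at this
  linarith

lemma norm_sub_sq_le_two {E : Type*} [NormedAddCommGroup E] (a b : E) :
    ‖a - b‖ ^ 2 ≤ 2 * ‖a‖ ^ 2 + 2 * ‖b‖ ^ 2 := by
  simpa [sub_eq_add_neg] using norm_add_sq_le_two a (-b)

/-- Convexity of the squared norm, with the weights absorbed into the vectors. -/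
lemma norm_add_sq_le_div {E : Type*} [NormedAddCommGroup E] {r : ℝ} (h0 : 0 < r) (h1 : r < 1)
    (a b : E) : ‖a + b‖ ^ 2 ≤ ‖a‖ ^ 2 / r + ‖b‖ ^ 2 / (1 - r) := by
  have h2 : 0 < 1 - r := by linarith
  have := norm_add_sq_le_young (s := (1 - r) / r) (by positivity) a b
  have e1 : 1 + (1 - r) / r = 1 / r := by field_simp; ring
  have e2 : 1 + 1 / ((1 - r) / r) = 1 / (1 - r) := by field_simp; ring
  rw [e1, e2] at this
  calc _ ≤ _ := this
    _ = _ := by ring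

/-- Convexity of the squared norm. -/
lemma norm_convex_comb_sq_le {E : Type*} [NormedAddCommGroup E] [NormedSpace ℝ E] {α : ℝ}
    (h0 : 0 ≤ α) (h1 : α ≤ 1) (a b : E) :
    ‖(1 - α) • a + α • b‖ ^ 2 ≤ (1 - α) * ‖a‖ ^ 2 + α * ‖b‖ ^ 2 := by
  have h : ‖(1 - α) • a + α • b‖ ≤ (1 - α) * ‖a‖ + α * ‖b‖ := by
    refine (norm_add_le _ _).trans ?_
    rw [norm_smul, norm_smul, Real.norm_of_nonneg h0, Real.norm_of_nonneg (by linarith)]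
  have h2 : ‖(1 - α) • a + α • b‖ ^ 2 ≤ ((1 - α) * ‖a‖ + α * ‖b‖) ^ 2 := by gcongr
  have h3 : 0 ≤ α * (1 - α) := mul_nonneg h0 (by linarith)
  nlinarith [mul_nonneg h3 (sq_nonneg (‖a‖ - ‖b‖))]

section Agents

variable {n : ℕ} {E : Type*} [NormedAddCommGroup E] [InnerProductSpace ℝ E]

/-- The squared Frobenius norm `∑ i, ‖v i‖²` of a family of vectors held by the agents. -/
def sqNorm {n : ℕ} {E : Type*} [NormedAddCommGroup E] (v : Fin n → E) : ℝ :=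
  ∑ i, ‖v i‖ ^ 2

/-- The deviation of each agent's vector from the average. -/
def dev {n : ℕ} {E : Type*} [AddCommGroup E] [Module ℝ E] (v : Fin n → E) : Fin n → E :=
  fun i => v i - agentAvg v

lemma sqNorm_nonneg {E : Type*} [NormedAddCommGroup E] (v : Fin n → E) : 0 ≤ sqNorm v :=
  Finset.sum_nonneg fun _ _ => by positivity

lemma norm_sq_le_sqNorm {E : Type*} [NormedAddCommGroup E] (v : Fin n → E) (i : Fin n) :
    ‖v i‖ ^ 2 ≤ sqNorm v :=
  Finset.single_le_sum (f := fun i => ‖v i‖ ^ 2) (fun _ _ => by positivity) (Finset.mem_univ i)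

lemma agentAvg_add (v w : Fin n → E) :
    agentAvg (fun i => v i + w i) = agentAvg v + agentAvg w := by
  simp [agentAvg, Finset.sum_add_distrib]

lemma agentAvg_sub (v w : Fin n → E) :
    agentAvg (fun i => v i - w i) = agentAvg v - agentAvg w := by
  simp [agentAvg, smul_sub]

lemma agentAvg_smul (a : ℝ) (v : Fin n → E) :
    agentAvg (fun i => a • v i) = a • agentAvg v := by
  simp [agentAvg, ← Finset.smul_sum, smul_comm a]

lemma agentAvg_const (hn : 0 < n) (v : E) : agentAvg (fun _ : Fin n => v) = v := by
  simp only [agentAvg, Finset.sum_const, Finset.card_univ, Fintype.card_fin]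
  rw [← Nat.cast_smul_eq_nsmul ℝ, smul_smul, inv_mul_cancel₀ (by positivity), one_smul]

lemma sum_eq_smul_agentAvg (hn : 0 < n) (v : Fin n → E) : ∑ i, v i = (n : ℝ) • agentAvg v := by
  rw [agentAvg, smul_smul, mul_inv_cancel₀ (by positivity), one_smul]

lemma agentAvg_map {F : Type*} [NormedAddCommGroup F] [InnerProductSpace ℝ F] (A : E →L[ℝ] F)
    (v : Fin n → E) : agentAvg (fun i => A (v i)) = A (agentAvg v) := by
  simp [agentAvg]

lemma sum_dev (hn : 0 < n) (v : Fin n → E) : ∑ i, dev v i = 0 := by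
  simp only [dev, Finset.sum_sub_distrib, Finset.sum_const, Finset.card_univ, Fintype.card_fin]
  rw [sum_eq_smul_agentAvg hn, ← Nat.cast_smul_eq_nsmul ℝ, sub_self]

lemma dev_add (v w : Fin n → E) : dev (fun i => v i + w i) = fun i => dev v i + dev w i := by
  funext i; simp only [dev, agentAvg_add]; abel

lemma dev_smul (a : ℝ) (v : Fin n → E) : dev (fun i => a • v i) = fun i => a • dev v i := by
  funext i; simp only [dev, agentAvg_smul, smul_sub]

/-- Pythagoras for the decomposition of a family into its average and its deviation. -/
lemma sqNorm_sub_const (hn : 0 < n) (v : Fin n → E) (a : E) :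
    sqNorm (fun i => v i - a) = n * ‖agentAvg v - a‖ ^ 2 + sqNorm (dev v) := by
  have h : ∀ i, ‖v i - a‖ ^ 2 =
      ‖agentAvg v - a‖ ^ 2 + ‖dev v i‖ ^ 2 + 2 * inner ℝ (dev v i) (agentAvg v - a) := by
    intro i
    have : v i - a = dev v i + (agentAvg v - a) := by simp [dev]
    rw [this, norm_add_sq_real]; ring
  simp only [sqNorm, h, Finset.sum_add_distrib, ← Finset.mul_sum, ← sum_inner, sum_dev hn]
  simp

lemma sqNorm_dev_le (hn : 0 < n) (v : Fin n → E) : sqNorm (dev v) ≤ sqNorm v := by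
  have := sqNorm_sub_const hn v 0
  simp only [sub_zero] at this
  rw [this]
  have : 0 ≤ (n : ℝ) * ‖agentAvg v‖ ^ 2 := by positivity
  linarith

lemma norm_agentAvg_sq_le (hn : 0 < n) (v : Fin n → E) : n * ‖agentAvg v‖ ^ 2 ≤ sqNorm v := by
  have := sqNorm_sub_const hn v 0
  simp only [sub_zero] at this
  rw [this]
  linarith [sqNorm_nonneg (dev v)]

lemma norm_agentAvg_sq_le' (hn : 0 < n) (v : Fin n → E) : ‖agentAvg v‖ ^ 2 ≤ sqNorm v := by
  refine le_trans ?_ (norm_agentAvg_sq_le hn v)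
  have : (1 : ℝ) ≤ n := by exact_mod_cast hn
  nlinarith [sq_nonneg ‖agentAvg v‖]

lemma norm_agentAvg_le_of_forall (hn : 0 < n) {v : Fin n → E} {C : ℝ} (h : ∀ i, ‖v i‖ ≤ C) :
    ‖agentAvg v‖ ≤ C := by
  rw [agentAvg, norm_smul, norm_inv, Real.norm_natCast]
  have : ‖∑ i, v i‖ ≤ n * C := by
    refine (norm_sum_le_of_le _ fun i _ => h i).trans ?_
    simp
  have hn' : (0 : ℝ) < n := by exact_mod_cast hn
  rw [inv_mul_le_iff₀ hn']; exact this

lemma sqNorm_add_le_two {E : Type*} [NormedAddCommGroup E] (v w : Fin n → E) :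
    sqNorm (fun i => v i + w i) ≤ 2 * sqNorm v + 2 * sqNorm w := by
  simp only [sqNorm, Finset.mul_sum, ← Finset.sum_add_distrib]
  exact Finset.sum_le_sum fun i _ => norm_add_sq_le_two _ _

lemma sqNorm_sub_le_two {E : Type*} [NormedAddCommGroup E] (v w : Fin n → E) :
    sqNorm (fun i => v i - w i) ≤ 2 * sqNorm v + 2 * sqNorm w := by
  simp only [sqNorm, Finset.mul_sum, ← Finset.sum_add_distrib]
  exact Finset.sum_le_sum fun i _ => norm_sub_sq_le_two _ _

lemma sqNorm_add_le_div {E : Type*} [NormedAddCommGroup E] {r : ℝ} (h0 : 0 < r) (h1 : r < 1) (v w : Fin n → E) :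
    sqNorm (fun i => v i + w i) ≤ sqNorm v / r + sqNorm w / (1 - r) := by
  simp only [sqNorm, Finset.sum_div, ← Finset.sum_add_distrib]
  exact Finset.sum_le_sum fun i _ => norm_add_sq_le_div h0 h1 _ _

lemma sqNorm_smul (a : ℝ) (v : Fin n → E) : sqNorm (fun i => a • v i) = a ^ 2 * sqNorm v := by
  simp [sqNorm, norm_smul, mul_pow, Finset.mul_sum]

lemma sqNorm_le_mul_of_forall {E F : Type*} [NormedAddCommGroup E] [NormedAddCommGroup F]
    {v : Fin n → E} {w : Fin n → F} {L : ℝ} (h : ∀ i, ‖v i‖ ≤ L * ‖w i‖) : sqNorm v ≤ L ^ 2 * sqNorm w := by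
  simp only [sqNorm, Finset.mul_sum]
  refine Finset.sum_le_sum fun i _ => ?_
  rw [← mul_pow]
  exact pow_le_pow_left₀ (norm_nonneg _) (h i) 2

/-- The rows and columns of `W` sum to one, and `W` contracts by the factor `ρ ∈ (0, 1)` the vectors
with zero sum. -/
structure IsGossip (W : Matrix (Fin n) (Fin n) ℝ) (ρ : ℝ) : Prop where
  pos : 0 < ρ
  lt_one : ρ < 1
  row_sum : ∀ i, ∑ j, W i j = 1
  col_sum : ∀ j, ∑ i, W i j = 1
  contract : ∀ v : Fin n → ℝ, ∑ i, v i = 0 →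
    ∑ i, (∑ j, W i j * v j) ^ 2 ≤ ρ ^ 2 * ∑ i, v i ^ 2

variable {W : Matrix (Fin n) (Fin n) ℝ} {ρ : ℝ}

lemma IsGossip.agentAvg_mix (hW : IsGossip W ρ) (v : Fin n → E) :
    agentAvg (mix W v) = agentAvg v := by
  simp only [agentAvg, mix]
  rw [Finset.sum_comm]
  simp [← Finset.sum_smul, hW.col_sum]

lemma IsGossip.dev_mix (hW : IsGossip W ρ) (v : Fin n → E) :
    dev (mix W v) = mix W (dev v) := by
  funext i
  rw [dev, hW.agentAvg_mix]
  simp [mix, dev, smul_sub, Finset.sum_sub_distrib, ← Finset.sum_smul, hW.row_sum]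

lemma IsGossip.sqNorm_mix_le {d : ℕ} (hW : IsGossip W ρ)
    (v : Fin n → EuclideanSpace ℝ (Fin d)) (hv : ∑ i, v i = 0) :
    sqNorm (mix W v) ≤ ρ ^ 2 * sqNorm v := by
  simp only [sqNorm, EuclideanSpace.real_norm_sq_eq]
  rw [Finset.sum_comm, Finset.sum_comm (f := fun i j => (v i) j ^ 2), Finset.mul_sum]
  refine Finset.sum_le_sum fun l _ => ?_
  have := hW.contract (fun i => v i l) (by simpa using congrArg (fun w => w l) hv)
  simpa [mix] using this

/-- One gossip step followed by a perturbation: the consensus error contracts. -/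
lemma IsGossip.sqNorm_dev_step_le {d : ℕ} (hn : 0 < n) (hW : IsGossip W ρ)
    (v w : Fin n → EuclideanSpace ℝ (Fin d)) :
    sqNorm (dev fun i => mix W v i + w i) ≤ ρ * sqNorm (dev v) + sqNorm (dev w) / (1 - ρ) := by
  rw [dev_add]
  refine (sqNorm_add_le_div hW.pos hW.lt_one _ _).trans ?_
  have h := hW.sqNorm_mix_le (dev v) (sum_dev hn v)
  rw [hW.dev_mix]
  have : sqNorm (mix W (dev v)) / ρ ≤ ρ * sqNorm (dev v) := by
    rw [div_le_iff₀ hW.pos]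
    calc _ ≤ _ := h
      _ = _ := by ring
  linarith

end Agents

/-- A symmetric doubly stochastic matrix with spectral gap is a contraction on zero-sum vectors:
the constant vector spans the eigenspace of the eigenvalue `1`, so zero-sum vectors are combinations
of the other eigenvectors. -/
lemma DSBOProblem.IsMixing.isGossip {n p q : ℕ} {Ξ Ψ : Type*} [MeasurableSpace Ξ]
    [MeasurableSpace Ψ] {D : DSBOProblem n p q Ξ Ψ} {c : DSBOConstants} (hn : 0 < n)
    (h : D.IsMixing c) : IsGossip D.W (max c.ρ (1 / 2)) := by
  have hsymm : ∀ i j, D.W i j = D.W j i := fun i j => by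
    have := congrFun (congrFun h.symm j) i
    simpa [Matrix.conjTranspose] using this
  refine ⟨by positivity, max_lt c.ρ_lt_one (by norm_num), h.row_sum, fun j => ?_, fun v hv => ?_⟩
  · simpa only [hsymm _ j] using h.row_sum j
  set r := max c.ρ (1 / 2) with hr
  have hr0 : 0 ≤ r := le_trans (by norm_num) (le_max_right _ _)
  set b := h.symm.eigenvectorBasis with hb
  have hinner : ∀ (u w : EuclideanSpace ℝ (Fin n)), inner ℝ u w = ∑ i, u i * w i := by
    intro u w
    simp [PiLp.inner_apply, mul_comm]
  have key : ∀ (u : EuclideanSpace ℝ (Fin n)) (j : Fin n),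
      inner ℝ (b j) (WithLp.toLp 2 (D.W.mulVec u.ofLp)) = h.symm.eigenvalues j * inner ℝ (b j) u := by
    intro u j
    have h1 := h.symm.mulVec_eigenvectorBasis j
    rw [hinner, hinner, Finset.mul_sum]
    calc ∑ i, b j i * (D.W.mulVec u.ofLp) i
        = (b j).ofLp ⬝ᵥ D.W.mulVec u.ofLp := rfl
      _ = Matrix.vecMul (b j).ofLp D.W ⬝ᵥ u.ofLp := Matrix.dotProduct_mulVec _ _ _
      _ = D.W.mulVec (b j).ofLp ⬝ᵥ u.ofLp := by
          congr 1
          rw [← Matrix.mulVec_transpose]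
          congr 1
          ext i k; exact hsymm k i
      _ = _ := by
          rw [h1]; simp [dotProduct, mul_assoc, hb]
  -- the eigenvalue attached to `j` is either the first one or at most `r` in modulus
  have hone : D.W.mulVec (fun _ => (1 : ℝ)) = fun _ => 1 := by
    funext i; simpa [Matrix.mulVec, dotProduct] using h.row_sum i
  let e : Fin n ≃ Fin (Fintype.card (Fin n)) :=
    (Fintype.equivOfCardEq (Fintype.card_fin (Fintype.card (Fin n)))).symm
  have heig : ∀ j, h.symm.eigenvalues j = h.symm.eigenvalues₀ (e j) := fun j => rfl
  have hgap : ∀ j, 0 < (e j).val → |h.symm.eigenvalues j| ≤ r := fun j hj => by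
    rw [heig]; exact (h.spectral_gap _ hj).trans (le_max_left _ _)
  set one : EuclideanSpace ℝ (Fin n) := WithLp.toLp 2 fun _ => 1 with hone'
  have hzero : ∀ j, 0 < (e j).val → inner ℝ (b j) one = 0 := by
    intro j hj
    have := key one j
    simp only [hone', hone] at this
    have h2 : h.symm.eigenvalues j < 1 := by
      rw [heig]
      exact ((le_abs_self _).trans (h.spectral_gap _ hj)).trans_lt c.ρ_lt_one
    have h3 : (1 - h.symm.eigenvalues j) * inner ℝ (b j) one = 0 := by
      rw [hone']; linarith
    rcases mul_eq_zero.1 h3 with h4 | h4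
    · linarith
    · exact h4
  set j0 : Fin n := e.symm ⟨0, by simpa using hn⟩ with hj0
  have hother : ∀ j, j ≠ j0 → 0 < (e j).val := by
    intro j hj
    by_contra hc
    apply hj
    rw [hj0, Equiv.eq_symm_apply]
    ext; simpa using hc
  set vv : EuclideanSpace ℝ (Fin n) := WithLp.toLp 2 v with hvv
  have hv1 : inner ℝ one vv = 0 := by
    rw [hinner]; simpa [hone', hvv] using hv
  have hone_ne : one ≠ 0 := by
    intro h0
    have := congrArg (fun w : EuclideanSpace ℝ (Fin n) => w ⟨0, hn⟩) h0
    simp [hone'] at this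
  have hexp : one = inner ℝ (b j0) one • b j0 := by
    conv_lhs => rw [← b.sum_repr' one]
    refine Finset.sum_eq_single j0 (fun j _ hj => ?_) (by simp)
    rw [hzero j (hother j hj), zero_smul]
  have hc0 : inner ℝ (b j0) one ≠ 0 := by
    intro h0; rw [h0, zero_smul] at hexp; exact hone_ne hexp
  have hvj0 : inner ℝ (b j0) vv = 0 := by
    rw [hexp, inner_smul_left] at hv1
    simpa [hc0] using hv1
  have hnorm : ∀ w : EuclideanSpace ℝ (Fin n), ∑ i, w i ^ 2 = ∑ j, (inner ℝ (b j) w) ^ 2 := by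
    intro w
    rw [← EuclideanSpace.real_norm_sq_eq, ← b.sum_sq_norm_inner_right w]
    simp
  have e1 := hnorm (WithLp.toLp 2 (D.W.mulVec v))
  have e2 := hnorm vv
  simp only [hvv] at e2
  have : ∑ i, (∑ j, D.W i j * v j) ^ 2 = ∑ j, (inner ℝ (b j) (WithLp.toLp 2 (D.W.mulVec v))) ^ 2 :=
    e1
  rw [this, e2, Finset.mul_sum]
  refine Finset.sum_le_sum fun j _ => ?_
  have hk := key vv j
  simp only [hvv] at hk
  rw [hk, mul_pow]
  by_cases hj : j = j0
  · subst hj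
    simp only [hvv] at hvj0
    rw [hvj0]; simp
  · have := hgap j (hother j hj)
    exact mul_le_mul_of_nonneg_right (sq_le_sq' (abs_le.1 this).1 (abs_le.1 this).2) (sq_nonneg _)

/-! ### Fresh samples -/

lemma memLp_two_of_integrable_norm_sq {Ω V : Type*} [MeasurableSpace Ω] {P : Measure Ω}
    [NormedAddCommGroup V] {f : Ω → V} (hf : AEStronglyMeasurable f P)
    (h : Integrable (fun ω => ‖f ω‖ ^ 2) P) : MemLp f 2 P :=
  (memLp_two_iff_integrable_sq_norm hf).2 h

lemma MeasureTheory.MemLp.integrable_inner_two {Ω V : Type*} [MeasurableSpace Ω] {P : Measure Ω}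
    [NormedAddCommGroup V] [InnerProductSpace ℝ V] {f g : Ω → V} (hf : MemLp f 2 P)
    (hg : MemLp g 2 P) : Integrable (fun ω => inner ℝ (f ω) (g ω)) P := by
  refine ((hf.integrable_norm_pow two_ne_zero).add (hg.integrable_norm_pow two_ne_zero)).mono'
    (hf.aestronglyMeasurable.inner hg.aestronglyMeasurable) (ae_of_all _ fun ω => ?_)
  refine (norm_inner_le_norm _ _).trans ?_
  simp only [Pi.add_apply]
  nlinarith [sq_nonneg (‖f ω‖ - ‖g ω‖), sq_nonneg ‖f ω‖, sq_nonneg ‖g ω‖]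

section Fresh

variable {Ω 𝒳 S V : Type*} [MeasurableSpace Ω] [MeasurableSpace 𝒳] [MeasurableSpace S]
  {P : Measure Ω} [IsProbabilityMeasure P] {X : Ω → 𝒳} {ξ : Ω → S}

/-- Decoupling of a fresh sample `ξ` from the past `X`. -/
lemma integral_fresh [NormedAddCommGroup V] [NormedSpace ℝ V]
    (hX : Measurable X) (hξ : Measurable ξ) (hind : IndepFun X ξ P) {φ : 𝒳 → S → V}
    (hφ : StronglyMeasurable (Function.uncurry φ)) (hint : Integrable (fun ω => φ (X ω) (ξ ω)) P) :
    ∫ ω, φ (X ω) (ξ ω) ∂P = ∫ ω, ∫ ω', φ (X ω) (ξ ω') ∂P ∂P := by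
  have hmap := (indepFun_iff_map_prod_eq_prod_map_map hX.aemeasurable hξ.aemeasurable).1 hind
  have hXξ : Measurable fun ω => (X ω, ξ ω) := hX.prodMk hξ
  have hint' : Integrable (Function.uncurry φ) ((P.map X).prod (P.map ξ)) := by
    rw [← hmap, integrable_map_measure hφ.aestronglyMeasurable hXξ.aemeasurable]
    exact hint
  have : IsProbabilityMeasure (P.map X) := Measure.isProbabilityMeasure_map hX.aemeasurable
  have : IsProbabilityMeasure (P.map ξ) := Measure.isProbabilityMeasure_map hξ.aemeasurable
  calc ∫ ω, φ (X ω) (ξ ω) ∂P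
      = ∫ z, Function.uncurry φ z ∂(P.map fun ω => (X ω, ξ ω)) := by
        rw [integral_map hXξ.aemeasurable hφ.aestronglyMeasurable]; rfl
    _ = ∫ x, ∫ s, φ x s ∂(P.map ξ) ∂(P.map X) := by
        rw [hmap, integral_prod _ hint']; rfl
    _ = ∫ x, ∫ ω', φ x (ξ ω') ∂P ∂(P.map X) := by
        refine integral_congr_ae (ae_of_all _ fun x => ?_)
        exact integral_map hξ.aemeasurable
          (hφ.comp_measurable measurable_prodMk_left).aestronglyMeasurable
    _ = _ := by
        refine integral_map hX.aemeasurable (f := fun x => ∫ ω', φ x (ξ ω') ∂P) ?_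
        have h2 : StronglyMeasurable fun z : 𝒳 × Ω => φ z.1 (ξ z.2) :=
          hφ.comp_measurable (measurable_fst.prodMk (hξ.comp measurable_snd))
        exact h2.integral_prod_right.aestronglyMeasurable

/-- A conditional second moment bound for a function of the past and of a fresh sample yields
integrability and the corresponding bound in mean. -/
lemma integrable_fresh_of_nonneg (hX : Measurable X) (hξ : Measurable ξ)
    (hind : IndepFun X ξ P) {φ : 𝒳 → S → ℝ} (hφ : Measurable (Function.uncurry φ))
    (h0 : ∀ x s, 0 ≤ φ x s) {v : 𝒳 → ℝ} (hφi : ∀ x, Integrable (fun ω => φ x (ξ ω)) P)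
    (hv : ∀ x, ∫ ω, φ x (ξ ω) ∂P ≤ v x) (hvi : Integrable (fun ω => v (X ω)) P) :
    Integrable (fun ω => φ (X ω) (ξ ω)) P ∧
      ∫ ω, φ (X ω) (ξ ω) ∂P ≤ ∫ ω, v (X ω) ∂P := by
  have hmap := (indepFun_iff_map_prod_eq_prod_map_map hX.aemeasurable hξ.aemeasurable).1 hind
  have hXξ : Measurable fun ω => (X ω, ξ ω) := hX.prodMk hξ
  have : IsProbabilityMeasure (P.map X) := Measure.isProbabilityMeasure_map hX.aemeasurable
  have : IsProbabilityMeasure (P.map ξ) := Measure.isProbabilityMeasure_map hξ.aemeasurable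
  have hin : StronglyMeasurable fun x => ∫ ω', φ x (ξ ω') ∂P := by
    have h2 : StronglyMeasurable fun z : 𝒳 × Ω => φ z.1 (ξ z.2) :=
      (hφ.comp (measurable_fst.prodMk (hξ.comp measurable_snd))).stronglyMeasurable
    exact h2.integral_prod_right
  have hin0 : ∀ x, 0 ≤ ∫ ω', φ x (ξ ω') ∂P := fun x => integral_nonneg fun ω => h0 _ _
  have hini : Integrable (fun ω => ∫ ω', φ (X ω) (ξ ω') ∂P) P := by
    refine hvi.mono' (hin.comp_measurable hX).aestronglyMeasurable (ae_of_all _ fun ω => ?_)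
    rw [Real.norm_of_nonneg (hin0 _)]
    exact hv _
  have hint : Integrable (fun ω => φ (X ω) (ξ ω)) P := by
    have : Integrable (Function.uncurry φ) ((P.map X).prod (P.map ξ)) := by
      rw [integrable_prod_iff hφ.aestronglyMeasurable]
      constructor
      · refine ae_of_all _ fun x => ?_
        exact (integrable_map_measure (hφ.comp (measurable_prodMk_left (x := x))).aestronglyMeasurable
          hξ.aemeasurable).2 (hφi x)
      · have e : (fun x => ∫ s, ‖Function.uncurry φ (x, s)‖ ∂(P.map ξ)) =
            fun x => ∫ ω', φ x (ξ ω') ∂P := by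
          funext x
          refine (integral_map hξ.aemeasurable
            (hφ.comp (measurable_prodMk_left (x := x))).norm.aestronglyMeasurable).trans ?_
          exact integral_congr_ae (ae_of_all _ fun ω => Real.norm_of_nonneg (h0 _ _))
        rw [e, integrable_map_measure hin.aestronglyMeasurable hX.aemeasurable]
        exact hini
    rw [← hmap, integrable_map_measure hφ.aestronglyMeasurable hXξ.aemeasurable] at this
    exact this
  refine ⟨hint, ?_⟩
  rw [integral_fresh hX hξ hind hφ.stronglyMeasurable hint]
  exact integral_mono hini hvi fun ω => hv _

variable [NormedAddCommGroup V] [MeasurableSpace V] [BorelSpace V] [SecondCountableTopology V]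

lemma memLp_fresh (hX : Measurable X) (hξ : Measurable ξ)
    (hind : IndepFun X ξ P) {G : 𝒳 → S → V} (hG : Measurable (Function.uncurry G))
    {v : 𝒳 → ℝ} (hGi : ∀ x, MemLp (fun ω => G x (ξ ω)) 2 P)
    (hv : ∀ x, ∫ ω, ‖G x (ξ ω)‖ ^ 2 ∂P ≤ v x) (hvi : Integrable (fun ω => v (X ω)) P) :
    MemLp (fun ω => G (X ω) (ξ ω)) 2 P ∧
      ∫ ω, ‖G (X ω) (ξ ω)‖ ^ 2 ∂P ≤ ∫ ω, v (X ω) ∂P := by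
  have h := integrable_fresh_of_nonneg hX hξ hind (φ := fun x s => ‖G x s‖ ^ 2)
    (by exact (hG.norm.pow_const 2)) (fun _ _ => by positivity)
    (fun x => (hGi x).integrable_norm_pow two_ne_zero) hv hvi
  exact ⟨memLp_two_of_integrable_norm_sq
    (hG.comp (hX.prodMk hξ)).aestronglyMeasurable h.1, h.2⟩

variable [InnerProductSpace ℝ V]

/-- A centered function of a fresh sample is orthogonal to every function of the past. -/
lemma integral_inner_fresh_eq_zero [CompleteSpace V] (hX : Measurable X) (hξ : Measurable ξ)
    (hind : IndepFun X ξ P) {G : 𝒳 → S → V} (hG : Measurable (Function.uncurry G))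
    {a : 𝒳 → V} (ha : Measurable a) (hai : MemLp (fun ω => a (X ω)) 2 P)
    (hGL : MemLp (fun ω => G (X ω) (ξ ω)) 2 P) (hGi : ∀ x, Integrable (fun ω => G x (ξ ω)) P)
    (hG0 : ∀ x, ∫ ω, G x (ξ ω) ∂P = 0) :
    ∫ ω, inner ℝ (a (X ω)) (G (X ω) (ξ ω)) ∂P = 0 := by
  have hint : Integrable (fun ω => inner ℝ (a (X ω)) (G (X ω) (ξ ω))) P := hai.integrable_inner_two hGL
  have hm : Measurable (Function.uncurry fun x s => inner ℝ (a x) (G x s)) :=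
    Measurable.inner (ha.comp measurable_fst) hG
  rw [integral_fresh hX hξ hind (φ := fun x s => inner ℝ (a x) (G x s))
    hm.stronglyMeasurable hint]
  have : ∀ ω, ∫ ω', inner ℝ (a (X ω)) (G (X ω) (ξ ω')) ∂P = 0 := fun ω => by
    rw [integral_inner (hGi _), hG0, inner_zero_right]
  simp [this]

/-- Adding centered noise to a function of the past adds at most the variance of the noise. -/
lemma integral_norm_add_fresh_sq_le [CompleteSpace V] (hX : Measurable X) (hξ : Measurable ξ)
    (hind : IndepFun X ξ P) {G : 𝒳 → S → V} (hG : Measurable (Function.uncurry G))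
    {a : 𝒳 → V} (ha : Measurable a) (hai : MemLp (fun ω => a (X ω)) 2 P)
    (hGi : ∀ x, MemLp (fun ω => G x (ξ ω)) 2 P) (hG0 : ∀ x, ∫ ω, G x (ξ ω) ∂P = 0)
    {v : 𝒳 → ℝ} (hv : ∀ x, ∫ ω, ‖G x (ξ ω)‖ ^ 2 ∂P ≤ v x)
    (hvi : Integrable (fun ω => v (X ω)) P) :
    ∫ ω, ‖a (X ω) + G (X ω) (ξ ω)‖ ^ 2 ∂P
      ≤ ∫ ω, ‖a (X ω)‖ ^ 2 ∂P + ∫ ω, v (X ω) ∂P := by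
  obtain ⟨hL, hle⟩ := memLp_fresh hX hξ hind hG hGi hv hvi
  have h0 := integral_inner_fresh_eq_zero hX hξ hind hG ha hai hL
    (fun x => (hGi x).integrable one_le_two) hG0
  have h1 := hai.integrable_norm_pow two_ne_zero
  have h2 := hL.integrable_norm_pow two_ne_zero
  have h3 : Integrable (fun ω => inner ℝ (a (X ω)) (G (X ω) (ξ ω))) P := hai.integrable_inner_two hL
  simp_rw [norm_add_sq_real]
  rw [integral_add (f := fun ω => ‖a (X ω)‖ ^ 2 + 2 * inner ℝ (a (X ω)) (G (X ω) (ξ ω)))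
    (h1.add (h3.const_mul 2)) h2, integral_add h1 (h3.const_mul 2),
    integral_const_mul, h0]
  linarith

end Fresh

/-! ### Strong convexity -/

lemma StrongConvexOn.add_inner_add_le {F : Type*} [NormedAddCommGroup F] [InnerProductSpace ℝ F]
    [CompleteSpace F] {f : F → ℝ} {m : ℝ} (hf : StrongConvexOn Set.univ m f) {x G : F}
    (hG : HasGradientAt f G x) (y : F) :
    f x + inner ℝ G (y - x) + m / 2 * ‖y - x‖ ^ 2 ≤ f y := by
  set h := y - x with hh
  have hline : HasDerivAt (fun t : ℝ => f (x + t • h)) (inner ℝ G h) 0 := by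
    have h1 : HasDerivAt (fun t : ℝ => x + t • h) h 0 := by
      simpa using ((hasDerivAt_id (0 : ℝ)).smul_const h).const_add x
    have h2 : HasFDerivAt f (InnerProductSpace.toDual ℝ F G) (x + (0 : ℝ) • h) := by
      simpa using hG.hasFDerivAt
    exact h2.comp_hasDerivAt (0 : ℝ) h1
  have hlim := hline.tendsto_slope_zero_right
  have hlim2 : Tendsto (fun t : ℝ => f y - f x - (1 - t) * (m / 2 * ‖h‖ ^ 2)) (𝓝[>] 0)
      (𝓝 (f y - f x - (1 - 0) * (m / 2 * ‖h‖ ^ 2))) := by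
    apply Tendsto.mono_left _ nhdsWithin_le_nhds
    exact Continuous.tendsto (by fun_prop) 0
  have hle := le_of_tendsto_of_tendsto hlim hlim2 (by
    have : Set.Ioo (0 : ℝ) 1 ∈ 𝓝[>] (0 : ℝ) := Ioo_mem_nhdsGT one_pos
    filter_upwards [this] with t ht
    have hc := hf.2 (Set.mem_univ x) (Set.mem_univ y)
      (show (0 : ℝ) ≤ 1 - t by linarith [ht.2]) ht.1.le (by ring)
    have e : (1 - t) • x + t • y = x + t • h := by
      rw [hh, smul_sub, sub_smul, one_smul]; abel
    rw [e, norm_sub_rev x y, ← hh] at hc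
    simp only [smul_eq_mul] at hc
    simp only [zero_add, zero_smul, add_zero, smul_eq_mul]
    rw [inv_mul_le_iff₀ ht.1]
    nlinarith)
  linarith

lemma StrongConvexOn.inner_sub_ge {F : Type*} [NormedAddCommGroup F] [InnerProductSpace ℝ F]
    [CompleteSpace F] {f : F → ℝ} {m : ℝ} (hf : StrongConvexOn Set.univ m f) {x y G G' : F}
    (hG : HasGradientAt f G x) (hG' : HasGradientAt f G' y) :
    m * ‖x - y‖ ^ 2 ≤ inner ℝ (G - G') (x - y) := by
  have h1 := hf.add_inner_add_le hG y
  have h2 := hf.add_inner_add_le hG' x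
  have e : inner ℝ G (y - x) = - inner ℝ G (x - y) := by
    rw [← inner_neg_right, neg_sub]
  rw [norm_sub_rev y x, e] at h1
  rw [inner_sub_left]
  linarith

/-- A strongly convex differentiable function on a finite-dimensional space has a minimizer. -/
lemma StrongConvexOn.exists_isMinOn {F : Type*} [NormedAddCommGroup F] [InnerProductSpace ℝ F]
    [FiniteDimensional ℝ F] [CompleteSpace F] {f : F → ℝ} {m : ℝ} (hm : 0 < m)
    (hf : StrongConvexOn Set.univ m f) (hd : Differentiable ℝ f) :
    ∃ y, IsMinOn f Set.univ y := by
  have : ProperSpace F := FiniteDimensional.proper ℝ F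
  obtain ⟨y, hy⟩ := hd.continuous.exists_forall_le (by
    have h0 := fun y => hf.add_inner_add_le (hd 0).hasGradientAt y
    simp only [sub_zero] at h0
    set G := gradient f 0
    have h1 : ∀ y, f 0 + ‖y‖ * (m / 2 * ‖y‖ - ‖G‖) ≤ f y := fun y => by
      have h2 := (abs_le.1 (abs_real_inner_le_norm G y)).1
      nlinarith [h0 y]
    refine tendsto_atTop_mono h1 ?_
    apply tendsto_atTop_add_const_left
    have ht := tendsto_norm_cocompact_atTop (E := F)
    refine Tendsto.atTop_mul_atTop₀ ht ?_
    exact tendsto_atTop_add_const_right _ _ (ht.const_mul_atTop (by positivity)))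
  exact ⟨y, fun z _ => hy z⟩

lemma norm_le_div_of_coercive {F : Type*} [NormedAddCommGroup F] [InnerProductSpace ℝ F]
    {μ : ℝ} (hμ : 0 < μ) {v w : F} (h : μ * ‖v‖ ^ 2 ≤ inner ℝ w v) : ‖v‖ ≤ ‖w‖ / μ := by
  rw [le_div_iff₀ hμ]
  have h2 := real_inner_le_norm w v
  rcases (norm_nonneg v).eq_or_lt with h0 | h0
  · rw [← h0]; simp
  · nlinarith

/-- A coercive operator on a finite-dimensional space is onto. -/
lemma exists_eq_of_coercive {F : Type*} [NormedAddCommGroup F] [InnerProductSpace ℝ F]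
    [FiniteDimensional ℝ F] {μ : ℝ} (hμ : 0 < μ) {A : F →L[ℝ] F}
    (hA : ∀ v, μ * ‖v‖ ^ 2 ≤ inner ℝ (A v) v) (b : F) : ∃ v, A v = b := by
  have hinj : Function.Injective (A : F →ₗ[ℝ] F) := by
    rw [← LinearMap.ker_eq_bot, LinearMap.ker_eq_bot']
    intro v hv
    have hv' : A v = 0 := hv
    have := norm_le_div_of_coercive hμ (hA v)
    rw [hv'] at this
    simpa using this
  exact LinearMap.injective_iff_surjective.1 hinj b

/-- One gradient step contracts, for a strongly monotone Lipschitz difference of gradients `w`. -/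
lemma norm_sub_smul_sq_le {F : Type*} [NormedAddCommGroup F] [InnerProductSpace ℝ F]
    {μ L γ : ℝ} (hγ : 0 ≤ γ) (hγL : γ * L ^ 2 ≤ μ) {v w : F}
    (h : μ * ‖v‖ ^ 2 ≤ inner ℝ w v) (hL : ‖w‖ ≤ L * ‖v‖) :
    ‖v - γ • w‖ ^ 2 ≤ (1 - γ * μ) * ‖v‖ ^ 2 := by
  rw [norm_sub_sq_real, inner_smul_right, norm_smul, Real.norm_of_nonneg hγ, real_inner_comm]
  have h2 : ‖w‖ ^ 2 ≤ L ^ 2 * ‖v‖ ^ 2 := by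
    rw [← mul_pow]; exact pow_le_pow_left₀ (norm_nonneg _) hL 2
  have h3 : γ * ‖w‖ ^ 2 ≤ μ * ‖v‖ ^ 2 := by nlinarith [sq_nonneg ‖v‖]
  nlinarith

/-! ### The blocks of the joint variable -/

section Joint

variable {p q : ℕ}

/-- The embedding `v ↦ (0, v)`. -/
def inrJoint (p q : ℕ) : EuclideanSpace ℝ (Fin q) →L[ℝ] JointSpace p q :=
  (WithLp.prodContinuousLinearEquiv 2 ℝ (EuclideanSpace ℝ (Fin p))
    (EuclideanSpace ℝ (Fin q))).symm.toContinuousLinearMap ∘L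
      ContinuousLinearMap.inr ℝ (EuclideanSpace ℝ (Fin p)) (EuclideanSpace ℝ (Fin q))

lemma inrJoint_apply (v : EuclideanSpace ℝ (Fin q)) : inrJoint p q v = joint 0 v := rfl

lemma joint_sub (x x' : EuclideanSpace ℝ (Fin p)) (y y' : EuclideanSpace ℝ (Fin q)) :
    joint x y - joint x' y' = joint (x - x') (y - y') := rfl

lemma norm_joint_sq (x : EuclideanSpace ℝ (Fin p)) (y : EuclideanSpace ℝ (Fin q)) :
    ‖joint x y‖ ^ 2 = ‖x‖ ^ 2 + ‖y‖ ^ 2 :=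
  WithLp.prod_norm_sq_eq_of_L2 _

lemma norm_joint_zero_left (v : EuclideanSpace ℝ (Fin q)) :
    ‖(joint 0 v : JointSpace p q)‖ = ‖v‖ := by
  have := norm_joint_sq (p := p) 0 v
  simpa using this

lemma norm_joint_zero_right (v : EuclideanSpace ℝ (Fin p)) :
    ‖(joint v 0 : JointSpace p q)‖ = ‖v‖ := by
  have := norm_joint_sq (q := q) v 0
  simpa using this

lemma norm_joint_le (x : EuclideanSpace ℝ (Fin p)) (y : EuclideanSpace ℝ (Fin q)) :
    ‖joint x y‖ ≤ ‖x‖ + ‖y‖ := by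
  have h : (joint x y : JointSpace p q) = joint x 0 + joint 0 y := by
    have : joint x 0 + joint 0 y = (joint (x + 0) (0 + y) : JointSpace p q) := rfl
    rw [this, add_zero, zero_add]
  rw [h]
  refine (norm_add_le _ _).trans ?_
  rw [norm_joint_zero_left, norm_joint_zero_right]

lemma norm_joint_fst_le (z : JointSpace p q) : ‖z.fst‖ ≤ ‖z‖ := by
  have h := WithLp.prod_norm_sq_eq_of_L2 z
  refine abs_le_of_sq_le_sq' ?_ (norm_nonneg _) |>.2
  nlinarith [sq_nonneg ‖z.snd‖]

lemma norm_joint_snd_le (z : JointSpace p q) : ‖z.snd‖ ≤ ‖z‖ := by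
  have h := WithLp.prod_norm_sq_eq_of_L2 z
  refine abs_le_of_sq_le_sq' ?_ (norm_nonneg _) |>.2
  nlinarith [sq_nonneg ‖z.fst‖]

lemma inner_joint_right (z : JointSpace p q) (v : EuclideanSpace ℝ (Fin q)) :
    inner ℝ z (joint 0 v) = inner ℝ z.snd v := by
  rw [WithLp.prod_inner_apply]
  simp [joint]

lemma continuous_joint :
    Continuous fun z : EuclideanSpace ℝ (Fin p) × EuclideanSpace ℝ (Fin q) => joint z.1 z.2 :=
  (WithLp.prodContinuousLinearEquiv 2 ℝ (EuclideanSpace ℝ (Fin p))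
    (EuclideanSpace ℝ (Fin q))).symm.continuous

/-- First component as a continuous linear map. -/
def fstJoint (p q : ℕ) : JointSpace p q →L[ℝ] EuclideanSpace ℝ (Fin p) :=
  WithLp.fstL 2 ℝ _ _

/-- Second component as a continuous linear map. -/
def sndJoint (p q : ℕ) : JointSpace p q →L[ℝ] EuclideanSpace ℝ (Fin q) :=
  WithLp.sndL 2 ℝ _ _

lemma fstJoint_apply (z : JointSpace p q) : fstJoint p q z = z.fst := rfl

lemma sndJoint_apply (z : JointSpace p q) : sndJoint p q z = z.snd := rfl

/-- The `yy`-block of a Hessian as an operator. -/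
def hessYYL (A : JointSpace p q →L[ℝ] JointSpace p q) :
    EuclideanSpace ℝ (Fin q) →L[ℝ] EuclideanSpace ℝ (Fin q) :=
  sndJoint p q ∘L A ∘L inrJoint p q

/-- The `xy`-block of a Hessian as an operator. -/
def jacXYL (A : JointSpace p q →L[ℝ] JointSpace p q) :
    EuclideanSpace ℝ (Fin q) →L[ℝ] EuclideanSpace ℝ (Fin p) :=
  fstJoint p q ∘L A ∘L inrJoint p q

lemma hessYYL_apply (A : JointSpace p q →L[ℝ] JointSpace p q) (v : EuclideanSpace ℝ (Fin q)) :
    hessYYL A v = hessYY A v := rfl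

lemma norm_hessYY_le (A : JointSpace p q →L[ℝ] JointSpace p q) (v : EuclideanSpace ℝ (Fin q)) :
    ‖hessYY A v‖ ≤ ‖A‖ * ‖v‖ := by
  refine (norm_joint_snd_le _).trans ((A.le_opNorm _).trans_eq ?_)
  rw [norm_joint_zero_left]

lemma norm_jacXY_le (A : JointSpace p q →L[ℝ] JointSpace p q) (v : EuclideanSpace ℝ (Fin q)) :
    ‖jacXY A v‖ ≤ ‖A‖ * ‖v‖ := by
  refine (norm_joint_fst_le _).trans ((A.le_opNorm _).trans_eq ?_)
  rw [norm_joint_zero_left]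

lemma norm_hessYYL_le (A : JointSpace p q →L[ℝ] JointSpace p q) : ‖hessYYL A‖ ≤ ‖A‖ :=
  ContinuousLinearMap.opNorm_le_bound _ (norm_nonneg _) (norm_hessYY_le A)

lemma hessYY_sub (A B : JointSpace p q →L[ℝ] JointSpace p q) (v : EuclideanSpace ℝ (Fin q)) :
    hessYY (A - B) v = hessYY A v - hessYY B v := rfl

lemma jacXY_sub (A B : JointSpace p q →L[ℝ] JointSpace p q) (v : EuclideanSpace ℝ (Fin q)) :
    jacXY (A - B) v = jacXY A v - jacXY B v := rfl

lemma jacXY_vec_sub (A : JointSpace p q →L[ℝ] JointSpace p q) (v w : EuclideanSpace ℝ (Fin q)) :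
    jacXY A (v - w) = jacXY A v - jacXY A w := (jacXYL A).map_sub v w

lemma HasGradientAt.slice_snd {g : JointSpace p q → ℝ} {G : JointSpace p q}
    {x : EuclideanSpace ℝ (Fin p)} {y : EuclideanSpace ℝ (Fin q)}
    (h : HasGradientAt g G (joint x y)) : HasGradientAt (fun y' => g (joint x y')) G.snd y := by
  have h1 : HasFDerivAt (fun y' => (joint x y' : JointSpace p q)) (inrJoint p q) y := by
    have e : (fun y' => (joint x y' : JointSpace p q)) = fun y' => joint x 0 + inrJoint p q y' := by
      funext y'
      have : joint x 0 + joint 0 y' = (joint (x + 0) (0 + y') : JointSpace p q) := rfl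
      rw [inrJoint_apply, this, add_zero, zero_add]
    rw [e]
    exact (inrJoint p q).hasFDerivAt.const_add _
  have h2 := h.hasFDerivAt.comp y h1
  rw [hasGradientAt_iff_hasFDerivAt]
  refine h2.congr_fderiv (ContinuousLinearMap.ext fun v => ?_)
  exact inner_joint_right _ _

end Joint

/-- The derivative of the gradient is symmetric. -/
lemma inner_fderiv_gradient_symm {F : Type*} [NormedAddCommGroup F] [InnerProductSpace ℝ F]
    [CompleteSpace F] {g : F → ℝ} (hg : Differentiable ℝ g)
    (hg2 : Differentiable ℝ (gradient g)) (z u v : F) :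
    inner ℝ (fderiv ℝ (gradient g) z u) v = inner ℝ u (fderiv ℝ (gradient g) z v) := by
  have h1 : ∀ y, HasFDerivAt g (InnerProductSpace.toDual ℝ F (gradient g y)) y := fun y =>
    (hg y).hasGradientAt.hasFDerivAt
  have h2 : HasFDerivAt (fun y => InnerProductSpace.toDual ℝ F (gradient g y))
      ((InnerProductSpace.toDual ℝ F).toContinuousLinearEquiv.toContinuousLinearMap ∘L
        fderiv ℝ (gradient g) z) z :=
    ((InnerProductSpace.toDual ℝ F).toContinuousLinearEquiv.toContinuousLinearMap.hasFDerivAt).comp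
      z (hg2 z).hasFDerivAt
  have := second_derivative_symmetric h1 h2 u v
  simpa [real_inner_comm] using this

/-! ### The lower level solution and the hypergradient -/

lemma hasDerivAt_inner_line {F : Type*} [NormedAddCommGroup F] [InnerProductSpace ℝ F]
    {g : F → F} {A : F →L[ℝ] F} {z : F} (hg : HasFDerivAt g A z) (u v : F) :
    HasDerivAt (fun t : ℝ => inner ℝ u (g (z + t • v))) (inner ℝ u (A v)) 0 := by
  have h1 : HasDerivAt (fun t : ℝ => z + t • v) v 0 := by
    simpa using ((hasDerivAt_id (0 : ℝ)).smul_const v).const_add z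
  have h2 : HasFDerivAt g A (z + (0 : ℝ) • v) := by rwa [zero_smul, add_zero]
  have h3 : HasDerivAt (fun t : ℝ => g (z + t • v)) (A v) 0 := h2.comp_hasDerivAt (0 : ℝ) h1
  exact ((innerSL ℝ u).hasFDerivAt).comp_hasDerivAt (0 : ℝ) h3

namespace DSBOConstants

variable (c : DSBOConstants)

/-- Bound on the solution of the lower level linear system. -/
def zBound : ℝ := c.Lf0 / c.μg

/-- Lipschitz constant of the solution of the lower level linear system. -/
def zLip : ℝ := (c.Lf1 + c.Lg2 * c.zBound) / c.μg

/-- Bound on the hypergradient. -/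
def hypBound : ℝ := c.Lf0 + c.Lg1 * c.zBound

/-- Lipschitz constant of the hypergradient, as a function of the points of the agents. -/
def hypLip : ℝ := c.Lf1 + (c.Lg1 * c.zLip + c.Lg2 * c.zBound)

/-- Lipschitz constant of the lower level solution. -/
def yLip : ℝ := c.Lg1 / c.μg

/-- Lipschitz constant of the gradient of the bilevel objective. -/
def phiLip : ℝ := c.hypLip * (1 + c.yLip)

lemma zBound_nonneg : 0 ≤ c.zBound := div_nonneg c.Lf0.coe_nonneg c.μg_pos.le

lemma zLip_nonneg : 0 ≤ c.zLip :=
  div_nonneg (add_nonneg c.Lf1.coe_nonneg (mul_nonneg c.Lg2.coe_nonneg c.zBound_nonneg)) c.μg_pos.le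

lemma hypLip_nonneg : 0 ≤ c.hypLip :=
  add_nonneg c.Lf1.coe_nonneg (add_nonneg (mul_nonneg c.Lg1.coe_nonneg c.zLip_nonneg)
    (mul_nonneg c.Lg2.coe_nonneg c.zBound_nonneg))

lemma yLip_nonneg : 0 ≤ c.yLip := div_nonneg c.Lg1.coe_nonneg c.μg_pos.le

lemma phiLip_nonneg : 0 ≤ c.phiLip :=
  mul_nonneg c.hypLip_nonneg (add_nonneg zero_le_one c.yLip_nonneg)

end DSBOConstants

namespace DSBOProblem

variable {n p q : ℕ} {Ξ Ψ : Type*} [MeasurableSpace Ξ] [MeasurableSpace Ψ]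

/-- The Hessian `∇² g_i`. -/
def hessian (D : DSBOProblem n p q Ξ Ψ) (i : Fin n) (z : JointSpace p q) :
    JointSpace p q →L[ℝ] JointSpace p q :=
  fderiv ℝ (gradient (D.g i)) z

/-- The averaged operator `(1/n) ∑ i, ∇²_y g_i(w_i)`, at points `w_i` that may differ. -/
def hbar (D : DSBOProblem n p q Ξ Ψ) (w : Fin n → JointSpace p q) :
    EuclideanSpace ℝ (Fin q) →L[ℝ] EuclideanSpace ℝ (Fin q) :=
  agentAvg fun i => hessYYL (D.hessian i (w i))

/-- The averaged vector `(1/n) ∑ i, ∇_y f_i(w_i)`. -/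
def bbar (D : DSBOProblem n p q Ξ Ψ) (w : Fin n → JointSpace p q) : EuclideanSpace ℝ (Fin q) :=
  agentAvg fun i => (gradient (D.f i) (w i)).snd

/-- A solution `z` of `hbar w z = bbar w`. -/
def zsol (D : DSBOProblem n p q Ξ Ψ) (w : Fin n → JointSpace p q) : EuclideanSpace ℝ (Fin q) :=
  Classical.epsilon fun z => D.hbar w z = D.bbar w

/-- The hypergradient formula evaluated at the points `w_i` of the agents. When `w_i = (x, y*(x))`
for all `i`, this is `∇Φ(x)`. -/
def hyp (D : DSBOProblem n p q Ξ Ψ) (w : Fin n → JointSpace p q) : EuclideanSpace ℝ (Fin p) :=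
  agentAvg fun i => (gradient (D.f i) (w i)).fst - jacXY (D.hessian i (w i)) (D.zsol w)

variable {D : DSBOProblem n p q Ξ Ψ} {c : DSBOConstants}

lemma hbar_apply (w : Fin n → JointSpace p q) (v : EuclideanSpace ℝ (Fin q)) :
    D.hbar w v = agentAvg fun i => hessYY (D.hessian i (w i)) v := by
  simp [hbar, agentAvg, hessYYL_apply]

namespace IsSmooth

lemma norm_gradient_f_le (h : D.IsSmooth c) (i : Fin n) (z : JointSpace p q) :
    ‖gradient (D.f i) z‖ ≤ c.Lf0 := by
  rw [gradient, LinearIsometryEquiv.norm_map]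
  exact norm_fderiv_le_of_lipschitz ℝ (h.lipschitz_f i)

lemma norm_hessian_le (h : D.IsSmooth c) (i : Fin n) (z : JointSpace p q) :
    ‖D.hessian i z‖ ≤ c.Lg1 :=
  norm_fderiv_le_of_lipschitz ℝ (h.lipschitz_gradient_g i)

lemma norm_hessian_sub_le (h : D.IsSmooth c) (i : Fin n) (z z' : JointSpace p q) :
    ‖D.hessian i z - D.hessian i z'‖ ≤ c.Lg2 * ‖z - z'‖ := by
  have := (h.lipschitz_hessian_g i).dist_le_mul z z'
  rwa [dist_eq_norm, dist_eq_norm] at this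

lemma norm_gradient_f_sub_le (h : D.IsSmooth c) (i : Fin n) (z z' : JointSpace p q) :
    ‖gradient (D.f i) z - gradient (D.f i) z'‖ ≤ c.Lf1 * ‖z - z'‖ := by
  have := (h.lipschitz_gradient_f i).dist_le_mul z z'
  rwa [dist_eq_norm, dist_eq_norm] at this

lemma norm_gradient_g_sub_le (h : D.IsSmooth c) (i : Fin n) (z z' : JointSpace p q) :
    ‖gradient (D.g i) z - gradient (D.g i) z'‖ ≤ c.Lg1 * ‖z - z'‖ := by
  have := (h.lipschitz_gradient_g i).dist_le_mul z z'
  rwa [dist_eq_norm, dist_eq_norm] at this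

lemma hasGradientAt_g_slice (h : D.IsSmooth c) (i : Fin n) (x : EuclideanSpace ℝ (Fin p))
    (y : EuclideanSpace ℝ (Fin q)) :
    HasGradientAt (fun y' => D.g i (joint x y')) (gradient (D.g i) (joint x y)).snd y :=
  ((h.differentiable_g i) _).hasGradientAt.slice_snd

lemma inner_gradient_g_sub_ge (h : D.IsSmooth c) (i : Fin n) (x : EuclideanSpace ℝ (Fin p))
    (y y' : EuclideanSpace ℝ (Fin q)) :
    c.μg * ‖y - y'‖ ^ 2 ≤ inner ℝ ((gradient (D.g i) (joint x y)).snd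
      - (gradient (D.g i) (joint x y')).snd) (y - y') :=
  (h.strongConvex_g i x).inner_sub_ge (h.hasGradientAt_g_slice i x y)
    (h.hasGradientAt_g_slice i x y')

lemma hessYY_coercive (h : D.IsSmooth c) (i : Fin n) (z : JointSpace p q)
    (v : EuclideanSpace ℝ (Fin q)) :
    c.μg * ‖v‖ ^ 2 ≤ inner ℝ (hessYY (D.hessian i z) v) v := by
  have h4 : HasDerivAt (fun t : ℝ =>
      inner ℝ (joint 0 v : JointSpace p q) (gradient (D.g i) (z + t • (joint 0 v))))
      (inner ℝ (joint 0 v : JointSpace p q) (D.hessian i z (joint 0 v))) 0 :=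
    hasDerivAt_inner_line (h.differentiable_gradient_g i z).hasFDerivAt _ _
  have h5 := h4.tendsto_slope_zero_right
  have h6 : inner ℝ (joint 0 v : JointSpace p q) (D.hessian i z (joint 0 v)) =
      inner ℝ (hessYY (D.hessian i z) v) v := by
    rw [real_inner_comm, inner_joint_right]; rfl
  rw [h6] at h5
  refine ge_of_tendsto h5 ?_
  filter_upwards [self_mem_nhdsWithin] with t ht
  have ht : 0 < t := ht
  rw [zero_add, zero_smul, add_zero, smul_eq_mul, ← inner_sub_right, le_inv_mul_iff₀ ht]
  have h7 := h.inner_gradient_g_sub_ge i z.fst (z.snd + t • v) z.snd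
  have e1 : (joint z.fst (z.snd + t • v) : JointSpace p q) = z + t • joint 0 v := by
    have : z + t • (joint 0 v : JointSpace p q) = joint (z.fst + t • 0) (z.snd + t • v) := rfl
    rw [this, smul_zero, add_zero]
  have e2 : (joint z.fst z.snd : JointSpace p q) = z := rfl
  rw [e1, e2, add_sub_cancel_left, norm_smul, mul_pow, Real.norm_eq_abs, sq_abs,
    inner_smul_right] at h7
  rw [real_inner_comm, inner_joint_right]
  have h8 : t * (t * (c.μg * ‖v‖ ^ 2)) ≤ t * inner ℝ
      ((gradient (D.g i) (z + t • joint 0 v)).snd - (gradient (D.g i) z).snd) v := by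
    calc _ = c.μg * (t ^ 2 * ‖v‖ ^ 2) := by ring
      _ ≤ _ := h7
  exact le_of_mul_le_mul_left h8 ht

lemma inner_agentAvg_ge {E : Type*} [NormedAddCommGroup E] [InnerProductSpace ℝ E] (hn : 0 < n)
    {v : Fin n → E} {u : E} {a : ℝ} (h : ∀ i, a ≤ inner ℝ (v i) u) :
    a ≤ inner ℝ (agentAvg v) u := by
  rw [agentAvg, real_inner_smul_left, sum_inner]
  have hn' : (0 : ℝ) < n := by exact_mod_cast hn
  rw [le_inv_mul_iff₀ hn']
  have := Finset.sum_le_sum fun i (_ : i ∈ Finset.univ) => h i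
  simpa using this

lemma hbar_coercive (hn : 0 < n) (h : D.IsSmooth c) (w : Fin n → JointSpace p q)
    (v : EuclideanSpace ℝ (Fin q)) : c.μg * ‖v‖ ^ 2 ≤ inner ℝ (D.hbar w v) v := by
  rw [hbar_apply]
  exact inner_agentAvg_ge hn fun i => h.hessYY_coercive i (w i) v

lemma hbar_zsol (hn : 0 < n) (h : D.IsSmooth c) (w : Fin n → JointSpace p q) :
    D.hbar w (D.zsol w) = D.bbar w :=
  Classical.epsilon_spec (exists_eq_of_coercive c.μg_pos (h.hbar_coercive hn w) (D.bbar w))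

lemma norm_bbar_le (hn : 0 < n) (h : D.IsSmooth c) (w : Fin n → JointSpace p q) :
    ‖D.bbar w‖ ≤ c.Lf0 :=
  norm_agentAvg_le_of_forall hn fun i =>
    (norm_joint_snd_le _).trans (h.norm_gradient_f_le i _)

lemma norm_zsol_le (hn : 0 < n) (h : D.IsSmooth c) (w : Fin n → JointSpace p q) :
    ‖D.zsol w‖ ≤ c.zBound := by
  have h1 := h.hbar_coercive hn w (D.zsol w)
  rw [h.hbar_zsol hn] at h1
  refine (norm_le_div_of_coercive c.μg_pos h1).trans ?_
  exact div_le_div_of_nonneg_right (h.norm_bbar_le hn w) c.μg_pos.le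

lemma norm_jacXY_hessian_le (h : D.IsSmooth c) (i : Fin n) (z : JointSpace p q)
    (v : EuclideanSpace ℝ (Fin q)) : ‖jacXY (D.hessian i z) v‖ ≤ c.Lg1 * ‖v‖ :=
  (norm_jacXY_le _ _).trans (mul_le_mul_of_nonneg_right (h.norm_hessian_le i z) (norm_nonneg _))

lemma norm_hyp_le (hn : 0 < n) (h : D.IsSmooth c) (w : Fin n → JointSpace p q) :
    ‖D.hyp w‖ ≤ c.hypBound := by
  refine norm_agentAvg_le_of_forall hn fun i => (norm_sub_le _ _).trans (add_le_add ?_ ?_)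
  · exact (norm_joint_fst_le _).trans (h.norm_gradient_f_le i _)
  · exact (h.norm_jacXY_hessian_le i _ _).trans
      (mul_le_mul_of_nonneg_left (h.norm_zsol_le hn w) c.Lg1.coe_nonneg)

lemma norm_zsol_sub_le (hn : 0 < n) (h : D.IsSmooth c) {w w' : Fin n → JointSpace p q} {r : ℝ}
    (hr : ∀ i, ‖w i - w' i‖ ≤ r) : ‖D.zsol w - D.zsol w'‖ ≤ c.zLip * r := by
  have h1 := h.hbar_coercive hn w (D.zsol w - D.zsol w')
  have h2 : D.hbar w (D.zsol w - D.zsol w') =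
      (D.bbar w - D.bbar w') - (D.hbar w (D.zsol w') - D.hbar w' (D.zsol w')) := by
    rw [map_sub, h.hbar_zsol hn, h.hbar_zsol hn]; abel
  have h3 : ‖D.bbar w - D.bbar w'‖ ≤ c.Lf1 * r := by
    rw [bbar, bbar, ← agentAvg_sub]
    refine norm_agentAvg_le_of_forall hn fun i => (norm_joint_snd_le
      (gradient (D.f i) (w i) - gradient (D.f i) (w' i))).trans ?_
    exact (h.norm_gradient_f_sub_le i _ _).trans
      (mul_le_mul_of_nonneg_left (hr i) c.Lf1.coe_nonneg)
  have hr0 : 0 ≤ r := (norm_nonneg _).trans (hr ⟨0, hn⟩)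
  have h4 : ‖D.hbar w (D.zsol w') - D.hbar w' (D.zsol w')‖ ≤ c.Lg2 * r * c.zBound := by
    rw [hbar_apply, hbar_apply, ← agentAvg_sub]
    refine norm_agentAvg_le_of_forall hn fun i => ?_
    rw [← hessYY_sub]
    refine (norm_hessYY_le _ _).trans (mul_le_mul ?_ (h.norm_zsol_le hn w') (norm_nonneg _)
      (mul_nonneg c.Lg2.coe_nonneg hr0))
    exact (h.norm_hessian_sub_le i _ _).trans
      (mul_le_mul_of_nonneg_left (hr i) c.Lg2.coe_nonneg)
  refine (norm_le_div_of_coercive c.μg_pos h1).trans ?_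
  rw [h2, DSBOConstants.zLip, div_mul_eq_mul_div]
  refine div_le_div_of_nonneg_right ((norm_sub_le _ _).trans ?_) c.μg_pos.le
  nlinarith

lemma norm_hyp_sub_le (hn : 0 < n) (h : D.IsSmooth c) {w w' : Fin n → JointSpace p q} {r : ℝ}
    (hr : ∀ i, ‖w i - w' i‖ ≤ r) : ‖D.hyp w - D.hyp w'‖ ≤ c.hypLip * r := by
  have hr0 : 0 ≤ r := (norm_nonneg _).trans (hr ⟨0, hn⟩)
  rw [hyp, hyp, ← agentAvg_sub]
  refine norm_agentAvg_le_of_forall hn fun i => ?_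
  have e : (gradient (D.f i) (w i)).fst - jacXY (D.hessian i (w i)) (D.zsol w)
      - ((gradient (D.f i) (w' i)).fst - jacXY (D.hessian i (w' i)) (D.zsol w')) =
      (gradient (D.f i) (w i) - gradient (D.f i) (w' i)).fst
      - (jacXY (D.hessian i (w i)) (D.zsol w - D.zsol w')
        + jacXY (D.hessian i (w i) - D.hessian i (w' i)) (D.zsol w')) := by
    rw [jacXY_vec_sub, jacXY_sub, WithLp.sub_fst]; abel
  rw [e, DSBOConstants.hypLip, add_mul]
  refine (norm_sub_le _ _).trans (add_le_add ?_ ((norm_add_le _ _).trans ?_))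
  · exact (norm_joint_fst_le _).trans ((h.norm_gradient_f_sub_le i _ _).trans
      (mul_le_mul_of_nonneg_left (hr i) c.Lf1.coe_nonneg))
  · rw [add_mul]
    refine add_le_add ?_ ?_
    · refine (h.norm_jacXY_hessian_le i _ _).trans ?_
      rw [mul_assoc]
      exact mul_le_mul_of_nonneg_left (h.norm_zsol_sub_le hn hr) c.Lg1.coe_nonneg
    · refine (norm_jacXY_le _ _).trans ?_
      have h5 : ‖D.hessian i (w i) - D.hessian i (w' i)‖ ≤ c.Lg2 * r :=
        (h.norm_hessian_sub_le i _ _).trans (mul_le_mul_of_nonneg_left (hr i) c.Lg2.coe_nonneg)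
      calc _ ≤ c.Lg2 * r * c.zBound :=
            mul_le_mul h5 (h.norm_zsol_le hn w') (norm_nonneg _)
              (mul_nonneg c.Lg2.coe_nonneg hr0)
        _ = _ := by ring

lemma hasGradientAt_agentAvg {E : Type*} [NormedAddCommGroup E] [InnerProductSpace ℝ E]
    [CompleteSpace E] {f : Fin n → E → ℝ} {G : Fin n → E} {z : E}
    (h : ∀ i, HasGradientAt (f i) (G i) z) :
    HasGradientAt (fun z => agentAvg fun i => f i z) (agentAvg G) z := by
  rw [hasGradientAt_iff_hasFDerivAt]
  have h1 := (HasFDerivAt.fun_sum (u := Finset.univ)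
    fun i _ => (h i).hasFDerivAt).const_smul ((n : ℝ)⁻¹)
  refine h1.congr_fderiv ?_
  rw [agentAvg, map_smulₛₗ, map_sum]; rfl

lemma exists_isMinOn (hn : 0 < n) (h : D.IsSmooth c) (x : EuclideanSpace ℝ (Fin p)) :
    ∃ y, IsMinOn (fun y' => D.gAvg (joint x y')) Set.univ y := by
  refine StrongConvexOn.exists_isMinOn c.μg_pos ?_ fun y =>
    (hasGradientAt_agentAvg fun i => h.hasGradientAt_g_slice i x y).hasFDerivAt.differentiableAt
  refine ⟨convex_univ, fun y _ y' _ a b ha hb hab => ?_⟩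
  have hn' : (0 : ℝ) < n := by exact_mod_cast hn
  have h1 := Finset.sum_le_sum fun i (_ : i ∈ Finset.univ) =>
    (h.strongConvex_g i x).2 (Set.mem_univ y) (Set.mem_univ y') ha hb hab
  simp only [gAvg, agentAvg, smul_eq_mul, Finset.sum_sub_distrib, Finset.sum_add_distrib,
    ← Finset.mul_sum, Finset.sum_const, Finset.card_univ, Fintype.card_fin, nsmul_eq_mul] at h1 ⊢
  rw [inv_mul_le_iff₀ hn']
  refine h1.trans_eq ?_
  field_simp

lemma gradient_yStar (hn : 0 < n) (h : D.IsSmooth c) (x : EuclideanSpace ℝ (Fin p)) :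
    agentAvg (fun i => (gradient (D.g i) (joint x (D.yStar x))).snd) = 0 := by
  have h1 : IsMinOn (fun y' => D.gAvg (joint x y')) Set.univ (D.yStar x) :=
    Classical.epsilon_spec (h.exists_isMinOn hn x)
  have h2 := hasGradientAt_agentAvg fun i => h.hasGradientAt_g_slice i x (D.yStar x)
  have h3 := (h1.isLocalMin Filter.univ_mem).hasFDerivAt_eq_zero h2.hasFDerivAt
  exact (InnerProductSpace.toDual ℝ _).map_eq_zero_iff.1 h3

lemma norm_yStar_sub_le (hn : 0 < n) (h : D.IsSmooth c) (x x' : EuclideanSpace ℝ (Fin p)) :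
    ‖D.yStar x - D.yStar x'‖ ≤ c.yLip * ‖x - x'‖ := by
  have h1 := inner_agentAvg_ge hn fun i =>
    h.inner_gradient_g_sub_ge i x (D.yStar x) (D.yStar x')
  refine (norm_le_div_of_coercive c.μg_pos h1).trans ?_
  rw [DSBOConstants.yLip, div_mul_eq_mul_div]
  refine div_le_div_of_nonneg_right ?_ c.μg_pos.le
  rw [agentAvg_sub, h.gradient_yStar hn, ← h.gradient_yStar hn x', ← agentAvg_sub]
  refine norm_agentAvg_le_of_forall hn fun i => ?_
  refine (norm_joint_snd_le (gradient (D.g i) (joint x' (D.yStar x'))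
    - gradient (D.g i) (joint x (D.yStar x')))).trans ?_
  refine (h.norm_gradient_g_sub_le i _ _).trans_eq ?_
  rw [joint_sub, sub_self, norm_joint_zero_right, norm_sub_rev]

lemma continuous_yStar (hn : 0 < n) (h : D.IsSmooth c) : Continuous D.yStar := by
  refine (LipschitzWith.of_dist_le_mul (K := ⟨c.yLip, c.yLip_nonneg⟩) fun x x' => ?_).continuous
  rw [dist_eq_norm, dist_eq_norm]
  exact h.norm_yStar_sub_le hn x x'

lemma norm_joint_yStar_sub_le (hn : 0 < n) (h : D.IsSmooth c) (x x' : EuclideanSpace ℝ (Fin p)) :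
    ‖(joint x (D.yStar x) : JointSpace p q) - joint x' (D.yStar x')‖
      ≤ (1 + c.yLip) * ‖x - x'‖ := by
  rw [joint_sub, add_mul, one_mul]
  exact (norm_joint_le _ _).trans (add_le_add_right (h.norm_yStar_sub_le hn x x') _)

/-- The gradient of the bilevel objective. Along the curve `x ↦ (x, y*(x))` the objective agrees
with the Lagrangian `f - ⟨z, ∇_y g⟩`, and for `z` the solution of the lower level linear system
the `y`-derivative of the Lagrangian vanishes, so that no derivative of `y*` is needed. -/
lemma hasGradientAt_Phi (hn : 0 < n) (h : D.IsSmooth c) (x : EuclideanSpace ℝ (Fin p)) :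
    HasGradientAt D.Phi (D.hyp fun _ => joint x (D.yStar x)) x := by
  set w : JointSpace p q := joint x (D.yStar x) with hw
  set z := D.zsol fun _ => w with hz
  let ζ : JointSpace p q := joint 0 z
  -- the Lagrangian of each agent and its gradient
  have hL : ∀ i, HasGradientAt (fun v => D.f i v - inner ℝ ζ (gradient (D.g i) v))
      (gradient (D.f i) w - D.hessian i w ζ) w := by
    intro i
    rw [hasGradientAt_iff_hasFDerivAt]
    have h1 := ((h.differentiable_f i) w).hasGradientAt.hasFDerivAt
    have h2 : HasFDerivAt (fun v => inner ℝ ζ (gradient (D.g i) v))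
        ((innerSL ℝ ζ) ∘L D.hessian i w) w :=
      ((innerSL ℝ ζ).hasFDerivAt).comp w (h.differentiable_gradient_g i w).hasFDerivAt
    refine (h1.sub h2).congr_fderiv (ContinuousLinearMap.ext fun v => ?_)
    rw [map_sub]
    change inner ℝ (gradient (D.f i) w) v - inner ℝ ζ (D.hessian i w v) =
      inner ℝ (gradient (D.f i) w) v - inner ℝ (D.hessian i w ζ) v
    rw [hessian, inner_fderiv_gradient_symm (h.differentiable_g i) (h.differentiable_gradient_g i)]
  have hA := hasGradientAt_agentAvg hL
  set G := agentAvg fun i => gradient (D.f i) w - D.hessian i w ζ with hG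
  have hG1 : G.fst = D.hyp fun _ => w := by
    rw [hG, ← fstJoint_apply, ← agentAvg_map]; rfl
  have hG2 : G.snd = 0 := by
    have h1 := h.hbar_zsol hn fun _ => w
    rw [hbar_apply, ← hz] at h1
    have h2 : G.snd = D.bbar (fun _ => w) - agentAvg fun i => hessYY (D.hessian i w) z := by
      rw [hG, ← sndJoint_apply, ← agentAvg_map, bbar, ← agentAvg_sub]; rfl
    rw [h2, h1, sub_self]
  have hPhi : ∀ x', D.Phi x' = agentAvg fun i => D.f i (joint x' (D.yStar x'))
      - inner ℝ ζ (gradient (D.g i) (joint x' (D.yStar x'))) := by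
    intro x'
    rw [agentAvg_sub, Phi]
    have h1 : agentAvg (fun i => inner ℝ ζ (gradient (D.g i) (joint x' (D.yStar x')))) = 0 := by
      have h2 : ∀ i, inner ℝ ζ (gradient (D.g i) (joint x' (D.yStar x'))) =
          inner ℝ z (gradient (D.g i) (joint x' (D.yStar x'))).snd := fun i => by
        rw [real_inner_comm, inner_joint_right, real_inner_comm]
      simp only [h2]
      have h3 := agentAvg_map (innerSL ℝ z)
        fun i => (gradient (D.g i) (joint x' (D.yStar x'))).snd
      rw [h.gradient_yStar hn, map_zero] at h3
      exact h3
    rw [h1, sub_zero]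
  rw [hasGradientAt_iff_hasFDerivAt]
  have hcont : Tendsto (fun x' => (joint x' (D.yStar x') : JointSpace p q)) (𝓝 x) (𝓝 w) :=
    (continuous_joint.comp (continuous_id.prodMk (h.continuous_yStar hn))).tendsto x
  have hO : (fun x' => (joint x' (D.yStar x') : JointSpace p q) - w) =O[𝓝 x] fun x' => x' - x :=
    IsBigO.of_bound (1 + c.yLip) (Eventually.of_forall fun x' =>
      h.norm_joint_yStar_sub_le hn x' x)
  have ho := (hA.hasFDerivAt.isLittleO.comp_tendsto hcont).trans_isBigO hO
  refine HasFDerivAt.of_isLittleO (ho.congr_left fun x' => ?_)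
  rw [hPhi, hPhi]
  change _ - _ - inner ℝ G (joint x' (D.yStar x') - w) = _ - _ - inner ℝ (D.hyp fun _ => w) (x' - x)
  congr 1
  rw [WithLp.prod_inner_apply]
  change inner ℝ G.fst _ + inner ℝ G.snd _ = _
  rw [hG1, hG2, inner_zero_left, add_zero]
  rfl

lemma gradient_Phi (hn : 0 < n) (h : D.IsSmooth c) (x : EuclideanSpace ℝ (Fin p)) :
    gradient D.Phi x = D.hyp fun _ => joint x (D.yStar x) :=
  (h.hasGradientAt_Phi hn x).gradient

lemma differentiable_Phi (hn : 0 < n) (h : D.IsSmooth c) : Differentiable ℝ D.Phi := fun x =>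
  (h.hasGradientAt_Phi hn x).hasFDerivAt.differentiableAt

lemma norm_gradient_Phi_le (hn : 0 < n) (h : D.IsSmooth c) (x : EuclideanSpace ℝ (Fin p)) :
    ‖gradient D.Phi x‖ ≤ c.hypBound := by
  rw [h.gradient_Phi hn]; exact h.norm_hyp_le hn _

lemma norm_gradient_Phi_sub_le (hn : 0 < n) (h : D.IsSmooth c) (x x' : EuclideanSpace ℝ (Fin p)) :
    ‖gradient D.Phi x - gradient D.Phi x'‖ ≤ c.phiLip * ‖x - x'‖ := by
  rw [h.gradient_Phi hn, h.gradient_Phi hn, DSBOConstants.phiLip, mul_assoc]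
  exact h.norm_hyp_sub_le hn fun _ => h.norm_joint_yStar_sub_le hn x x'

lemma continuous_gradient_Phi (hn : 0 < n) (h : D.IsSmooth c) : Continuous (gradient D.Phi) := by
  refine (LipschitzWith.of_dist_le_mul (K := ⟨c.phiLip, c.phiLip_nonneg⟩)
    fun x x' => ?_).continuous
  rw [dist_eq_norm, dist_eq_norm]
  exact h.norm_gradient_Phi_sub_le hn x x'

lemma Phi_add_le (hn : 0 < n) (h : D.IsSmooth c) (x v : EuclideanSpace ℝ (Fin p)) :
    D.Phi (x + v) ≤ D.Phi x + inner ℝ (gradient D.Phi x) v + c.phiLip * ‖v‖ ^ 2 := by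
  have h1 := Convex.norm_image_sub_le_of_norm_fderiv_le' (f := D.Phi) (𝕜 := ℝ)
    (φ := InnerProductSpace.toDual ℝ _ (gradient D.Phi x)) (C := c.phiLip * ‖v‖)
    (s := Metric.closedBall x ‖v‖) (x := x) (y := x + v)
    (fun y _ => h.differentiable_Phi hn y) (fun y hy => ?_) (convex_closedBall _ _)
    (Metric.mem_closedBall_self (norm_nonneg _)) (by simp)
  · rw [add_sub_cancel_left, Real.norm_eq_abs] at h1
    have h2 := (abs_le.1 h1).2
    rw [InnerProductSpace.toDual_apply_apply] at h2
    nlinarith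
  · rw [← (h.differentiable_Phi hn y).hasGradientAt.hasFDerivAt.fderiv.symm,
      ← map_sub, LinearIsometryEquiv.norm_map]
    refine (h.norm_gradient_Phi_sub_le hn y x).trans
      (mul_le_mul_of_nonneg_left ?_ c.phiLip_nonneg)
    rwa [← dist_eq_norm]

lemma abs_Phi_sub_le (hn : 0 < n) (h : D.IsSmooth c) (x x' : EuclideanSpace ℝ (Fin p)) :
    |D.Phi x - D.Phi x'| ≤ c.hypBound * ‖x - x'‖ := by
  have h1 := Convex.norm_image_sub_le_of_norm_fderiv_le (f := D.Phi) (𝕜 := ℝ)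
    (C := c.hypBound) (s := Set.univ) (x := x') (y := x)
    (fun y _ => h.differentiable_Phi hn y) (fun y _ => ?_) convex_univ
    (Set.mem_univ _) (Set.mem_univ _)
  · rwa [Real.norm_eq_abs] at h1
  · have := h.norm_gradient_Phi_le hn y
    rwa [gradient, LinearIsometryEquiv.norm_map] at this

end IsSmooth

end DSBOProblem

/-! ### Stability of gradient tracking on a linear system -/

/-- Real recursion governing the oracle. Here `a` is the squared error of the average, `b` and `d`
are the consensus errors of the iterates and of the tracking variables, `τ` is the noise level. For
small `γ` the weights `A`, `1`, `B` with `1 ≪ A ≪ B` turn the system into a linear contraction. -/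
lemma exists_tracking_bound {μ ρ C : ℝ} (hμ : 0 < μ) (hρ0 : 0 < ρ) (hρ : ρ < 1) (hC : 1 ≤ C) :
    ∃ γ₀ M : ℝ, 0 < γ₀ ∧ 0 < M ∧ ∀ γ, 0 < γ → γ < γ₀ →
      (0 < 1 - γ * μ / 4 ∧ 1 - γ * μ / 4 < 1) ∧
      ∀ (a b d : ℕ → ℝ) (X τ : ℝ), 0 ≤ X → 0 ≤ τ →
        a 0 ≤ X → b 0 ≤ X → d 0 ≤ X →
        (∀ t, a (t + 1) ≤ (1 - γ * μ / 2) * a t + γ * C * b t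
          + γ ^ 2 * C * (a t + b t + τ)) →
        (∀ t, b (t + 1) ≤ ρ * b t + γ ^ 2 * C * d t) →
        (∀ t, d (t + 1) ≤ ρ * d t + C * (a t + b t + a (t + 1) + b (t + 1) + τ)) →
        ∀ t, a t ≤ M * ((1 - γ * μ / 4) ^ t * X + τ) ∧ b t ≤ M * ((1 - γ * μ / 4) ^ t * X + τ) := by
  set A := 8 * C / μ + 1 with hA
  set B := 2 * C * (2 * A + 3) / (1 - ρ) + 1 with hB
  have h1ρ : 0 < 1 - ρ := by linarith
  have hA1 : 1 ≤ A := by rw [hA]; linarith [show 0 ≤ 8 * C / μ by positivity]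
  have hB1 : 1 ≤ B := by
    rw [hB]; linarith [show 0 ≤ 2 * C * (2 * A + 3) / (1 - ρ) by positivity]
  have hAμ : 8 * C ≤ μ * A := by
    rw [hA, mul_add, mul_div_cancel₀ _ hμ.ne']; linarith
  have hBρ : 2 * C * (2 * A + 3) ≤ (1 - ρ) * B := by
    have h : (1 - ρ) * B = 2 * C * (2 * A + 3) + (1 - ρ) := by rw [hB]; field_simp
    linarith
  refine ⟨min (min 1 (1 / (A + 2))) (min ((1 - ρ) / μ) ((1 - ρ) / (2 * C * B))), A, by positivity,
    by positivity, fun γ hγ0 hγ => ?_⟩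
  obtain ⟨⟨hg1, hg2⟩, hg3, hg4⟩ : (γ < 1 ∧ γ < 1 / (A + 2)) ∧ γ < (1 - ρ) / μ ∧
      γ < (1 - ρ) / (2 * C * B) := by simpa [lt_min_iff] using hγ
  rw [lt_div_iff₀ (by positivity)] at hg2 hg3 hg4
  set θ := 1 - γ * μ / 4 with hθ
  have hθ0 : 0 < θ := by rw [hθ]; nlinarith
  have hθ1 : θ < 1 := by rw [hθ]; nlinarith [mul_pos hγ0 hμ]
  have hθρ : (1 - ρ) / 2 ≤ θ - ρ := by rw [hθ]; nlinarith
  refine ⟨⟨hθ0, hθ1⟩, fun a b d X τ hX hτ ha0 hb0 hd0 ha hb hd => ?_⟩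
  have hQ0 : ∀ t, 0 ≤ θ ^ t * X + τ := fun t => by positivity
  have key : ∀ t, a t ≤ A * (θ ^ t * X + τ) ∧ b t ≤ θ ^ t * X + τ ∧ d t ≤ B * (θ ^ t * X + τ) := by
    intro t
    induction t with
    | zero =>
      simp only [pow_zero, one_mul]
      refine ⟨by nlinarith, by linarith, by nlinarith⟩
    | succ t ih =>
      obtain ⟨iha, ihb, ihd⟩ := ih
      set Q := θ ^ t * X + τ with hQ
      set Q' := θ ^ (t + 1) * X + τ with hQ'
      have hQ0' : 0 ≤ Q := hQ0 t
      have hτQ : τ ≤ Q := by rw [hQ]; linarith [show 0 ≤ θ ^ t * X by positivity]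
      have hQQ : θ * Q ≤ Q' := by
        rw [hQ, hQ', pow_succ]; nlinarith
      have hQQ' : Q' ≤ Q := by
        have : θ ^ (t + 1) * X ≤ θ ^ t * X := by
          rw [pow_succ]; nlinarith [show 0 ≤ θ ^ t * X by positivity]
        rw [hQ, hQ']; linarith
      have hγμ : 0 ≤ 1 - γ * μ / 2 := by
        have : γ * μ ≤ 1 := by linarith
        linarith
      have ha' : a (t + 1) ≤ A * Q' := by
        have h1 : a (t + 1) ≤ (1 - γ * μ / 2) * (A * Q) + γ * C * Q
            + γ ^ 2 * C * (A * Q + Q + Q) := by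
          refine (ha t).trans ?_
          gcongr
        have h2 : (1 - γ * μ / 2) * (A * Q) + γ * C * Q + γ ^ 2 * C * (A * Q + Q + Q)
            ≤ θ * (A * Q) := by
          have h3 : γ * C * Q * (γ * (A + 2)) ≤ γ * C * Q * 1 :=
            mul_le_mul_of_nonneg_left hg2.le (by positivity)
          have h4 : γ * Q * (8 * C) ≤ γ * Q * (μ * A) :=
            mul_le_mul_of_nonneg_left hAμ (by positivity)
          rw [hθ]
          linarith
        have h5 : A * (θ * Q) ≤ A * Q' := mul_le_mul_of_nonneg_left hQQ (by linarith)
        linarith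
      have hb' : b (t + 1) ≤ Q' := by
        have h1 : b (t + 1) ≤ ρ * Q + γ ^ 2 * C * (B * Q) := by
          refine (hb t).trans ?_
          gcongr
        have h2 : γ * (γ * (2 * C * B)) ≤ 1 * (1 - ρ) :=
          mul_le_mul hg1.le hg4.le (by positivity) zero_le_one
        have h3 : (ρ + γ ^ 2 * C * B) * Q ≤ θ * Q :=
          mul_le_mul_of_nonneg_right (by linarith) hQ0'
        linarith
      refine ⟨ha', hb', ?_⟩
      have h1 : d (t + 1) ≤ ρ * (B * Q) + C * (A * Q + Q + A * Q + Q + Q) := by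
        refine (hd t).trans ?_
        have : A * Q' ≤ A * Q := by gcongr
        gcongr
        · exact ha'.trans this
        · exact hb'.trans hQQ'
      have h2 : C * (2 * A + 3) ≤ (θ - ρ) * B := by
        have := mul_le_mul_of_nonneg_right hθρ (zero_le_one.trans hB1)
        linarith
      have h3 : C * (2 * A + 3) * Q ≤ (θ - ρ) * B * Q := mul_le_mul_of_nonneg_right h2 hQ0'
      have h5 : B * (θ * Q) ≤ B * Q' := mul_le_mul_of_nonneg_left hQQ (by linarith)
      linarith
  intro t
  exact ⟨(key t).1, (key t).2.1.trans (le_mul_of_one_le_left (hQ0 t) hA1)⟩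

section HIGP

variable {n q : ℕ} {W : Matrix (Fin n) (Fin n) ℝ} {ρ γ μ L : ℝ}

local notation "𝔼" => EuclideanSpace ℝ (Fin q)

/-- The local residuals at `z`, without noise. -/
def localResid {n q : ℕ} (hm : Fin n → EuclideanSpace ℝ (Fin q) →L[ℝ] EuclideanSpace ℝ (Fin q))
    (bm : Fin n → EuclideanSpace ℝ (Fin q)) (z : Fin n → EuclideanSpace ℝ (Fin q)) (i : Fin n) :
    EuclideanSpace ℝ (Fin q) :=
  hm i (z i) - bm i

lemma sqNorm_map_le {hm : Fin n → 𝔼 →L[ℝ] 𝔼} (hL : ∀ i, ‖hm i‖ ≤ L) (v : Fin n → 𝔼) :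
    sqNorm (fun i => hm i (v i)) ≤ L ^ 2 * sqNorm v :=
  sqNorm_le_mul_of_forall fun i => (hm i).le_of_opNorm_le (hL i) (v i)

/-- Gradient step of the averaged iterate on the averaged linear system. -/
lemma norm_agentAvg_localResid_step_sq_le (hn : 0 < n) (hμ : 0 < μ) (hγ : 0 < γ)
    (hγL : γ * L ^ 2 ≤ μ) {hm : Fin n → 𝔼 →L[ℝ] 𝔼} {bm : Fin n → 𝔼} {zs : 𝔼}
    (hL : ∀ i, ‖hm i‖ ≤ L) (hco : ∀ v, μ * ‖v‖ ^ 2 ≤ inner ℝ (agentAvg fun i => hm i v) v)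
    (hzs : (agentAvg fun i => hm i zs) = agentAvg bm) (z : Fin n → 𝔼) :
    ‖agentAvg z - zs - γ • agentAvg (localResid hm bm z)‖ ^ 2
      ≤ (1 - γ * μ / 2) * ‖agentAvg z - zs‖ ^ 2
        + γ * (γ + 2 / μ) * L ^ 2 * sqNorm (dev z) := by
  set e := agentAvg z - zs with he
  have h1 : agentAvg (localResid hm bm z) =
      (agentAvg fun i => hm i e) + agentAvg fun i => hm i (dev z i) := by
    have : localResid hm bm z = fun i => (hm i e + hm i (dev z i)) + (hm i zs - bm i) := by
      funext i
      rw [localResid, ← map_add, dev, he]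
      rw [show agentAvg z - zs + (z i - agentAvg z) = z i - zs by abel, map_sub]; abel
    rw [this, agentAvg_add, agentAvg_sub, hzs, sub_self, add_zero, agentAvg_add]
  have h2 : e - γ • agentAvg (localResid hm bm z) =
      (e - γ • agentAvg fun i => hm i e) + -(γ • agentAvg fun i => hm i (dev z i)) := by
    rw [h1, smul_add]; abel
  have h3 : ‖e - γ • agentAvg fun i => hm i e‖ ^ 2 ≤ (1 - γ * μ) * ‖e‖ ^ 2 :=
    norm_sub_smul_sq_le hγ.le hγL (hco e)
      (norm_agentAvg_le_of_forall hn fun i => (hm i).le_of_opNorm_le (hL i) e)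
  have h4 : ‖agentAvg fun i => hm i (dev z i)‖ ^ 2 ≤ L ^ 2 * sqNorm (dev z) :=
    (norm_agentAvg_sq_le' hn _).trans (sqNorm_map_le hL _)
  have hγμ : 0 < γ * μ := mul_pos hγ hμ
  have h5 := norm_add_sq_le_young (s := γ * μ / 2) (by positivity)
    (e - γ • agentAvg fun i => hm i e) (-(γ • agentAvg fun i => hm i (dev z i)))
  rw [h2]
  refine h5.trans (add_le_add ?_ ?_)
  · calc _ ≤ (1 + γ * μ / 2) * ((1 - γ * μ) * ‖e‖ ^ 2) := by gcongr
      _ ≤ _ := by nlinarith [mul_nonneg (sq_nonneg (γ * μ)) (sq_nonneg ‖e‖)]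
  · rw [norm_neg, norm_smul, mul_pow, Real.norm_eq_abs, sq_abs]
    have h6 : (1 + 1 / (γ * μ / 2)) * γ ^ 2 = γ * (γ + 2 / μ) := by field_simp
    calc _ = ((1 + 1 / (γ * μ / 2)) * γ ^ 2) * ‖agentAvg fun i => hm i (dev z i)‖ ^ 2 := by ring
      _ ≤ γ * (γ + 2 / μ) * (L ^ 2 * sqNorm (dev z)) := by
          rw [h6]; exact mul_le_mul_of_nonneg_left h4 (by positivity)
      _ = _ := by ring

/-- Change of the local stochastic residuals in one step. -/
lemma sqNorm_localResid_sub_le {hm : Fin n → 𝔼 →L[ℝ] 𝔼} {bm : Fin n → 𝔼}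
    (hL : ∀ i, ‖hm i‖ ≤ L) (zs : 𝔼) (z z' ζ ζ' : Fin n → 𝔼) :
    sqNorm (fun i => (localResid hm bm z' i + ζ' i) - (localResid hm bm z i + ζ i)) ≤
      4 * (L ^ 2 * sqNorm (fun i => z' i - zs) + L ^ 2 * sqNorm (fun i => z i - zs)
        + sqNorm ζ' + sqNorm ζ) := by
  have e : (fun i => (localResid hm bm z' i + ζ' i) - (localResid hm bm z i + ζ i)) =
      fun i => (hm i (z' i - zs) - hm i (z i - zs)) + (ζ' i - ζ i) := by
    funext i; simp only [localResid, map_sub]; abel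
  rw [e]
  have h1 := sqNorm_add_le_two (fun i => hm i (z' i - zs) - hm i (z i - zs)) fun i => ζ' i - ζ i
  have h2 := sqNorm_sub_le_two (fun i => hm i (z' i - zs)) fun i => hm i (z i - zs)
  have h3 := sqNorm_sub_le_two ζ' ζ
  have h4 := sqNorm_map_le hL fun i => z' i - zs
  have h5 := sqNorm_map_le hL fun i => z i - zs
  linarith

lemma higp_zero (H : ℕ → Fin n → 𝔼 → 𝔼) (b : ℕ → Fin n → 𝔼) :
    higp W γ H b 0 = { z := 0, d := fun i => -b 0 i, s := fun i => -b 0 i } := rfl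

lemma higp_d_succ (H : ℕ → Fin n → 𝔼 → 𝔼) (b : ℕ → Fin n → 𝔼) (t : ℕ) :
    (higp W γ H b (t + 1)).d =
      fun i => mix W (higp W γ H b t).d i + (higp W γ H b (t + 1)).s i
        - (higp W γ H b t).s i := rfl

lemma higp_s (H : ℕ → Fin n → 𝔼 →L[ℝ] 𝔼) (b : ℕ → Fin n → 𝔼) (t : ℕ) (i : Fin n) :
    (higp W γ (fun t i => H t i) b t).s i =
      H t i ((higp W γ (fun t i => H t i) b t).z i) - b t i := by
  cases t with
  | zero => simp [higp_zero]
  | succ t => rfl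

/-- Gradient tracking: the tracking variables and the local residuals have the same average. -/
lemma agentAvg_higp_d (hW : IsGossip W ρ) (H : ℕ → Fin n → 𝔼 → 𝔼) (b : ℕ → Fin n → 𝔼) (t : ℕ) :
    agentAvg (higp W γ H b t).d = agentAvg (higp W γ H b t).s := by
  induction t with
  | zero => rfl
  | succ t ih =>
    rw [higp_d_succ, agentAvg_sub, agentAvg_add, hW.agentAvg_mix, ih]; abel

end HIGP

/-! ### Square integrability of families of vectors -/

section MemLp

variable {n : ℕ} {Ω V : Type*} [MeasurableSpace Ω] {P : Measure Ω} [NormedAddCommGroup V]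

lemma integrable_sqNorm {v : Ω → Fin n → V} (hv : ∀ i, MemLp (fun ω => v ω i) 2 P) :
    Integrable (fun ω => sqNorm (v ω)) P :=
  integrable_finsetSum _ fun i _ => (hv i).integrable_norm_pow two_ne_zero

lemma integral_sqNorm {v : Ω → Fin n → V} (hv : ∀ i, MemLp (fun ω => v ω i) 2 P) :
    ∫ ω, sqNorm (v ω) ∂P = ∑ i, ∫ ω, ‖v ω i‖ ^ 2 ∂P :=
  integral_finsetSum _ fun i _ => (hv i).integrable_norm_pow two_ne_zero

variable [NormedSpace ℝ V]

lemma memLp_mix (W : Matrix (Fin n) (Fin n) ℝ) {v : Ω → Fin n → V}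
    (hv : ∀ i, MemLp (fun ω => v ω i) 2 P) (i : Fin n) :
    MemLp (fun ω => mix W (v ω) i) 2 P := by
  simp only [mix]
  exact memLp_finsetSum _ fun j _ => (hv j).const_smul (W i j)

lemma memLp_agentAvg {v : Ω → Fin n → V} (hv : ∀ i, MemLp (fun ω => v ω i) 2 P) :
    MemLp (fun ω => agentAvg (v ω)) 2 P := by
  simp only [agentAvg]
  exact (memLp_finsetSum _ fun j _ => hv j).const_smul _

lemma memLp_dev {v : Ω → Fin n → V} (hv : ∀ i, MemLp (fun ω => v ω i) 2 P) (i : Fin n) :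
    MemLp (fun ω => dev (v ω) i) 2 P :=
  (hv i).sub (memLp_agentAvg hv)

lemma integral_mix (W : Matrix (Fin n) (Fin n) ℝ) {v : Ω → Fin n → V}
    (hv : ∀ i, Integrable (fun ω => v ω i) P) (i : Fin n) :
    ∫ ω, mix W (v ω) i ∂P = mix W (fun j => ∫ ω, v ω j ∂P) i := by
  simp only [mix]
  have h : ∀ j ∈ Finset.univ, Integrable (fun ω => W i j • v ω j) P := fun j _ => (hv j).smul (W i j)
  rw [integral_finsetSum _ h]
  simp only [integral_smul]

lemma integral_agentAvg {v : Ω → Fin n → V} (hv : ∀ i, Integrable (fun ω => v ω i) P) :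
    ∫ ω, agentAvg (v ω) ∂P = agentAvg fun i => ∫ ω, v ω i ∂P := by
  simp only [agentAvg]
  rw [integral_smul, integral_finsetSum _ fun j _ => hv j]

lemma measurable_mix [MeasurableSpace V] [BorelSpace V] [SecondCountableTopology V]
    {α : Type*} [MeasurableSpace α] (W : Matrix (Fin n) (Fin n) ℝ) {v : α → Fin n → V}
    (hv : Measurable v) : Measurable fun ω => mix W (v ω) := by
  refine measurable_pi_lambda _ fun i => ?_
  simp only [mix]
  exact Finset.measurable_fun_sum _ fun j _ => ((measurable_pi_apply j).comp hv).const_smul (W i j)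

lemma measurable_agentAvg [MeasurableSpace V] [BorelSpace V] [SecondCountableTopology V]
    {α : Type*} [MeasurableSpace α] {v : α → Fin n → V} (hv : Measurable v) :
    Measurable fun ω => agentAvg (v ω) := by
  simp only [agentAvg]
  exact (Finset.measurable_fun_sum _ fun j _ => (measurable_pi_apply j).comp hv).const_smul _

end MemLp

/-! ### The oracle for the inverse Hessian vector product -/

section LinearOracle

variable {n q : ℕ} {Ω : Type*} [MeasurableSpace Ω]

local notation "𝔼" => EuclideanSpace ℝ (Fin q)

/-- Unbiased random matrices `H t i` and vectors `b t i` with bounded variances. -/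
structure IsLinearOracle {n q : ℕ} {Ω : Type*} [MeasurableSpace Ω] (P : Measure Ω)
    (H : ℕ → Fin n → Ω → EuclideanSpace ℝ (Fin q) →L[ℝ] EuclideanSpace ℝ (Fin q))
    (b : ℕ → Fin n → Ω → EuclideanSpace ℝ (Fin q))
    (hm : Fin n → EuclideanSpace ℝ (Fin q) →L[ℝ] EuclideanSpace ℝ (Fin q))
    (bm : Fin n → EuclideanSpace ℝ (Fin q)) (σH σb : ℝ) : Prop where
  measurable_H : ∀ t i, Measurable (H t i)
  measurable_b : ∀ t i, Measurable (b t i)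
  memLp_H : ∀ t i, MemLp (H t i) 2 P
  memLp_b : ∀ t i, MemLp (b t i) 2 P
  integral_H : ∀ t i, ∫ ω, H t i ω ∂P = hm i
  integral_b : ∀ t i, ∫ ω, b t i ω ∂P = bm i
  variance_H : ∀ t i, ∫ ω, ‖H t i ω - hm i‖ ^ 2 ∂P ≤ σH ^ 2
  variance_b : ∀ t i, ∫ ω, ‖b t i ω - bm i‖ ^ 2 ∂P ≤ σb ^ 2

/-- The state of the oracle driven by random matrices and vectors. -/
def higpRun (W : Matrix (Fin n) (Fin n) ℝ) (γ : ℝ) (H : ℕ → Fin n → Ω → 𝔼 →L[ℝ] 𝔼)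
    (b : ℕ → Fin n → Ω → 𝔼) (t : ℕ) (ω : Ω) : HIGPState n q :=
  higp W γ (fun t i => H t i ω) (fun t i => b t i ω) t

/-- The noise of the local residuals at `z`, for the sampled matrices and vectors `ξ`. -/
def residNoise (hm : Fin n → 𝔼 →L[ℝ] 𝔼) (bm : Fin n → 𝔼) (z : Fin n → 𝔼)
    (ξ : (Fin n → 𝔼 →L[ℝ] 𝔼) × (Fin n → 𝔼)) (i : Fin n) : 𝔼 :=
  (ξ.1 i - hm i) (z i) - (ξ.2 i - bm i)

/-- The sample used in step `t`. -/
def oracleSample (H : ℕ → Fin n → Ω → 𝔼 →L[ℝ] 𝔼) (b : ℕ → Fin n → Ω → 𝔼) (t : ℕ) (ω : Ω) :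
    (Fin n → 𝔼 →L[ℝ] 𝔼) × (Fin n → 𝔼) :=
  (fun i => H t i ω, fun i => b t i ω)

lemma measurable_clm_apply {α : Type*} [MeasurableSpace α] {A : α → 𝔼 →L[ℝ] 𝔼} {v : α → 𝔼}
    (hA : Measurable A) (hv : Measurable v) : Measurable fun x => A x (v x) :=
  (isBoundedBilinearMap_apply (𝕜 := ℝ) (E := 𝔼) (F := 𝔼)).continuous.measurable.comp
    (hA.prodMk hv)

/-- The oracle state at `t` is a function of the matrices `1, ..., t` and the vectors
`0, ..., t`: the matrix sampled at time `0` only multiplies `z_0 = 0`. -/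
lemma measurable_higpRun (W : Matrix (Fin n) (Fin n) ℝ) (γ : ℝ) {H : ℕ → Fin n → Ω → 𝔼 →L[ℝ] 𝔼}
    {b : ℕ → Fin n → Ω → 𝔼} (t : ℕ) (hH : ∀ s, 1 ≤ s → s ≤ t → ∀ i, Measurable (H s i))
    (hb : ∀ s, s ≤ t → ∀ i, Measurable (b s i)) :
    Measurable (fun ω => (higpRun W γ H b t ω).z) ∧ Measurable (fun ω => (higpRun W γ H b t ω).d) ∧
      Measurable (fun ω => (higpRun W γ H b t ω).s) := by
  induction t with
  | zero =>
    refine ⟨measurable_const, ?_, ?_⟩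
    all_goals exact measurable_pi_lambda _ fun i => (hb 0 le_rfl i).neg
  | succ t ih =>
    obtain ⟨ihz, ihd, ihs⟩ := ih (fun s h1 h2 => hH s h1 (h2.trans t.le_succ))
      (fun s h2 => hb s (h2.trans t.le_succ))
    have hz : Measurable fun ω => (higpRun W γ H b (t + 1) ω).z :=
      (measurable_mix W ihz).sub (ihd.const_smul γ)
    have hs : Measurable fun ω => (higpRun W γ H b (t + 1) ω).s := by
      refine measurable_pi_lambda _ fun i => ?_
      exact (measurable_clm_apply (hH (t + 1) (by lia) le_rfl i)
        ((measurable_pi_apply i).comp hz)).sub (hb (t + 1) le_rfl i)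
    exact ⟨hz, ((measurable_mix W ihd).add hs).sub ihs, hs⟩

/-- The iterate `z_t` only uses samples drawn before time `t`. -/
lemma measurable_higpRun_z (W : Matrix (Fin n) (Fin n) ℝ) (γ : ℝ)
    {H : ℕ → Fin n → Ω → 𝔼 →L[ℝ] 𝔼} {b : ℕ → Fin n → Ω → 𝔼} (t : ℕ)
    (hH : ∀ s, 1 ≤ s → s < t → ∀ i, Measurable (H s i))
    (hb : ∀ s, s < t → ∀ i, Measurable (b s i)) :
    Measurable (fun ω => (higpRun W γ H b t ω).z) := by
  cases t with
  | zero => exact measurable_const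
  | succ t =>
    obtain ⟨ihz, ihd, -⟩ := measurable_higpRun W γ t (fun s h1 h2 => hH s h1 (by lia))
      (fun s h2 => hb s (by lia))
    exact (measurable_mix W ihz).sub (ihd.const_smul γ)

variable {P : Measure Ω} {W : Matrix (Fin n) (Fin n) ℝ} {ρ γ μ L : ℝ}
  {H : ℕ → Fin n → Ω → EuclideanSpace ℝ (Fin q) →L[ℝ] EuclideanSpace ℝ (Fin q)}
  {b : ℕ → Fin n → Ω → EuclideanSpace ℝ (Fin q)}
  {hm : Fin n → EuclideanSpace ℝ (Fin q) →L[ℝ] EuclideanSpace ℝ (Fin q)}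
  {bm : Fin n → EuclideanSpace ℝ (Fin q)} {σH σb : ℝ}

lemma measurable_residNoise :
    Measurable (Function.uncurry (residNoise hm bm)) := by
  refine measurable_pi_lambda _ fun i => ?_
  refine (measurable_clm_apply ?_ ?_).sub ?_
  · exact ((measurable_pi_apply i).comp (measurable_fst.comp measurable_snd)).sub_const _
  · exact (measurable_pi_apply i).comp measurable_fst
  · exact ((measurable_pi_apply i).comp (measurable_snd.comp measurable_snd)).sub_const _

lemma higpRun_s (t : ℕ) (ω : Ω) : (higpRun W γ H b t ω).s =
    fun i => localResid hm bm (higpRun W γ H b t ω).z i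
      + residNoise hm bm (higpRun W γ H b t ω).z (oracleSample H b t ω) i := by
  funext i
  rw [higpRun, higp_s]
  simp only [localResid, residNoise, oracleSample, sub_apply]
  abel

namespace IsLinearOracle

lemma measurable_sample (ho : IsLinearOracle P H b hm bm σH σb) (t : ℕ) :
    Measurable (oracleSample H b t) :=
  (measurable_pi_lambda _ fun i => ho.measurable_H t i).prodMk
    (measurable_pi_lambda _ fun i => ho.measurable_b t i)

lemma measurable_z (ho : IsLinearOracle P H b hm bm σH σb) (t : ℕ) :
    Measurable fun ω => (higpRun W γ H b t ω).z :=
  measurable_higpRun_z W γ t (fun s _ _ => ho.measurable_H s) fun s _ => ho.measurable_b s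

variable [IsProbabilityMeasure P]

lemma memLp_residNoise (ho : IsLinearOracle P H b hm bm σH σb) (t : ℕ) (z : Fin n → 𝔼)
    (i : Fin n) : MemLp (fun ω => residNoise hm bm z (oracleSample H b t ω) i) 2 P :=
  ((ContinuousLinearMap.apply ℝ 𝔼 (z i)).comp_memLp'
    ((ho.memLp_H t i).sub (memLp_const (hm i)))).sub ((ho.memLp_b t i).sub (memLp_const (bm i)))

lemma integral_residNoise (ho : IsLinearOracle P H b hm bm σH σb) (t : ℕ) (z : Fin n → 𝔼)
    (i : Fin n) : ∫ ω, residNoise hm bm z (oracleSample H b t ω) i ∂P = 0 := by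
  have h1 : Integrable (H t i) P := (ho.memLp_H t i).integrable one_le_two
  have h2 : Integrable (b t i) P := (ho.memLp_b t i).integrable one_le_two
  have h3 : Integrable (fun ω => H t i ω - hm i) P := h1.sub (integrable_const _)
  simp only [residNoise, oracleSample]
  have h4 : Integrable (fun ω => b t i ω - bm i) P := h2.sub (integrable_const _)
  rw [integral_sub (h3.apply_continuousLinearMap (z i)) h4,
    ← ContinuousLinearMap.integral_apply h3, integral_sub h1 (integrable_const _),
    integral_sub h2 (integrable_const _), ho.integral_H, ho.integral_b]
  simp

lemma integral_norm_residNoise_sq_le (ho : IsLinearOracle P H b hm bm σH σb) (t : ℕ)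
    (z : Fin n → 𝔼) (i : Fin n) :
    ∫ ω, ‖residNoise hm bm z (oracleSample H b t ω) i‖ ^ 2 ∂P
      ≤ 2 * σH ^ 2 * ‖z i‖ ^ 2 + 2 * σb ^ 2 := by
  have h1 : Integrable (fun ω => ‖H t i ω - hm i‖ ^ 2) P :=
    ((ho.memLp_H t i).sub (memLp_const (hm i))).integrable_norm_pow two_ne_zero
  have h2 : Integrable (fun ω => ‖b t i ω - bm i‖ ^ 2) P :=
    ((ho.memLp_b t i).sub (memLp_const (bm i))).integrable_norm_pow two_ne_zero
  calc _ ≤ ∫ ω, (2 * ‖z i‖ ^ 2 * ‖H t i ω - hm i‖ ^ 2 + 2 * ‖b t i ω - bm i‖ ^ 2) ∂P := by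
        refine integral_mono ((ho.memLp_residNoise t z i).integrable_norm_pow two_ne_zero)
          ((h1.const_mul _).add (h2.const_mul _)) fun ω => ?_
        refine (norm_sub_sq_le_two _ _).trans (add_le_add ?_ le_rfl)
        have : ‖(H t i ω - hm i) (z i)‖ ^ 2 ≤ (‖H t i ω - hm i‖ * ‖z i‖) ^ 2 :=
          pow_le_pow_left₀ (norm_nonneg _) (ContinuousLinearMap.le_opNorm _ _) 2
        rw [mul_pow] at this
        calc _ ≤ 2 * (‖H t i ω - hm i‖ ^ 2 * ‖z i‖ ^ 2) := by gcongr; exact this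
          _ = _ := by ring
    _ = 2 * ‖z i‖ ^ 2 * ∫ ω, ‖H t i ω - hm i‖ ^ 2 ∂P + 2 * ∫ ω, ‖b t i ω - bm i‖ ^ 2 ∂P := by
        rw [integral_add (h1.const_mul _) (h2.const_mul _), integral_const_mul, integral_const_mul]
    _ ≤ 2 * ‖z i‖ ^ 2 * σH ^ 2 + 2 * σb ^ 2 := by
        gcongr
        · exact ho.variance_H t i
        · exact ho.variance_b t i
    _ = _ := by ring

/-- The samples of step `t` are independent of the iterate `z_t`. -/
def Fresh (P : Measure Ω) (W : Matrix (Fin n) (Fin n) ℝ) (γ : ℝ) (H : ℕ → Fin n → Ω → 𝔼 →L[ℝ] 𝔼)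
    (b : ℕ → Fin n → Ω → 𝔼) : Prop :=
  ∀ t, IndepFun (fun ω => (higpRun W γ H b t ω).z) (oracleSample H b t) P

/-- Square integrability of the noise along the run. -/
lemma memLp_noise (ho : IsLinearOracle P H b hm bm σH σb) (hf : Fresh P W γ H b) {t : ℕ}
    (hz : ∀ i, MemLp (fun ω => (higpRun W γ H b t ω).z i) 2 P) (i : Fin n) :
    MemLp (fun ω => residNoise hm bm (higpRun W γ H b t ω).z (oracleSample H b t ω) i) 2 P ∧
    ∫ ω, ‖residNoise hm bm (higpRun W γ H b t ω).z (oracleSample H b t ω) i‖ ^ 2 ∂P ≤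
      ∫ ω, (2 * σH ^ 2 * ‖(higpRun W γ H b t ω).z i‖ ^ 2 + 2 * σb ^ 2) ∂P :=
  memLp_fresh (ho.measurable_z t) (ho.measurable_sample t) (hf t)
    (G := fun z ξ => residNoise hm bm z ξ i)
    ((measurable_pi_apply i).comp measurable_residNoise)
    (v := fun z => 2 * σH ^ 2 * ‖z i‖ ^ 2 + 2 * σb ^ 2)
    (fun z => ho.memLp_residNoise t z i) (fun z => ho.integral_norm_residNoise_sq_le t z i)
    ((((hz i).integrable_norm_pow two_ne_zero).const_mul _).add (integrable_const _))

lemma memLp_localResid {z : Ω → Fin n → 𝔼} (hz : ∀ i, MemLp (fun ω => z ω i) 2 P) (i : Fin n) :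
    MemLp (fun ω => localResid hm bm (z ω) i) 2 P :=
  ((hm i).comp_memLp' (hz i)).sub (memLp_const (bm i))

lemma memLp_s (ho : IsLinearOracle P H b hm bm σH σb) (hf : Fresh P W γ H b) {t : ℕ}
    (hz : ∀ i, MemLp (fun ω => (higpRun W γ H b t ω).z i) 2 P) (i : Fin n) :
    MemLp (fun ω => (higpRun W γ H b t ω).s i) 2 P := by
  simp only [higpRun_s (hm := hm) (bm := bm)]
  exact (memLp_localResid hz i).add (ho.memLp_noise hf hz i).1

lemma memLp_z_d (ho : IsLinearOracle P H b hm bm σH σb) (hf : Fresh P W γ H b) (t : ℕ) :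
    (∀ i, MemLp (fun ω => (higpRun W γ H b t ω).z i) 2 P) ∧
      ∀ i, MemLp (fun ω => (higpRun W γ H b t ω).d i) 2 P := by
  induction t with
  | zero => exact ⟨fun i => memLp_const 0, fun i => (ho.memLp_b 0 i).neg⟩
  | succ t ih =>
    obtain ⟨ihz, ihd⟩ := ih
    have hz : ∀ i, MemLp (fun ω => (higpRun W γ H b (t + 1) ω).z i) 2 P := fun i =>
      (memLp_mix W ihz i).sub ((ihd i).const_smul γ)
    exact ⟨hz, fun i => ((memLp_mix W ihd i).add (ho.memLp_s hf hz i)).sub (ho.memLp_s hf ihz i)⟩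

/-- The mean of the oracle run is the noiseless run. -/
lemma integral_higpRun (ho : IsLinearOracle P H b hm bm σH σb) (hf : Fresh P W γ H b) (t : ℕ) :
    (∀ i, ∫ ω, (higpRun W γ H b t ω).z i ∂P = (higp W γ (fun _ i => hm i) (fun _ => bm) t).z i) ∧
    ∀ i, ∫ ω, (higpRun W γ H b t ω).d i ∂P = (higp W γ (fun _ i => hm i) (fun _ => bm) t).d i := by
  have hs : ∀ t, (∀ i, ∫ ω, (higpRun W γ H b t ω).z i ∂P =
      (higp W γ (fun _ i => hm i) (fun _ => bm) t).z i) →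
      ∀ i, ∫ ω, (higpRun W γ H b t ω).s i ∂P =
        (higp W γ (fun _ i => hm i) (fun _ => bm) t).s i := by
    intro t hz i
    have hL := (ho.memLp_z_d hf t).1
    have hN := (ho.memLp_noise hf hL i).1.integrable one_le_two
    have h0 : ∫ ω, residNoise hm bm (higpRun W γ H b t ω).z (oracleSample H b t ω) i ∂P = 0 := by
      rw [integral_fresh (ho.measurable_z t) (ho.measurable_sample t) (hf t)
        (φ := fun z ξ => residNoise hm bm z ξ i)
        ((measurable_pi_apply i).comp measurable_residNoise).stronglyMeasurable hN]
      simp [ho.integral_residNoise]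
    have hzi := (hL i).integrable one_le_two
    have e : (higp W γ (fun _ i => hm i) (fun _ => bm) t).s i =
        hm i ((higp W γ (fun _ i => hm i) (fun _ => bm) t).z i) - bm i :=
      higp_s (fun _ => hm) (fun _ => bm) t i
    rw [e]
    simp only [higpRun_s (hm := hm) (bm := bm)]
    rw [integral_add ((memLp_localResid hL i).integrable one_le_two) hN, h0, add_zero, ← hz i]
    simp only [localResid]
    rw [integral_sub ((hm i).integrable_comp hzi) (integrable_const _),
      (hm i).integral_comp_comm hzi]
    simp
  induction t with
  | zero =>
    refine ⟨fun i => by simp [higpRun, higp_zero], fun i => ?_⟩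
    simp only [higpRun, higp_zero]
    rw [integral_neg, ho.integral_b]
  | succ t ih =>
    obtain ⟨ihz, ihd⟩ := ih
    obtain ⟨Lz, Ld⟩ := ho.memLp_z_d hf t
    have Lz' := (ho.memLp_z_d hf (t + 1)).1
    have hz : ∀ i, ∫ ω, (higpRun W γ H b (t + 1) ω).z i ∂P =
        (higp W γ (fun _ i => hm i) (fun _ => bm) (t + 1)).z i := by
      intro i
      have h1 : ∀ ω, (higpRun W γ H b (t + 1) ω).z i =
        mix W (higpRun W γ H b t ω).z i - γ • (higpRun W γ H b t ω).d i := fun ω => rfl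
      simp only [h1]
      have i1 : Integrable (fun ω => γ • (higpRun W γ H b t ω).d i) P :=
        ((Ld i).integrable one_le_two).smul γ
      rw [integral_sub ((memLp_mix W Lz i).integrable one_le_two) i1, integral_mix W fun i =>
          (Lz i).integrable one_le_two, integral_smul, ihd]
      simp only [ihz]
      rfl
    refine ⟨hz, fun i => ?_⟩
    have h1 : ∀ ω, (higpRun W γ H b (t + 1) ω).d i =
      mix W (higpRun W γ H b t ω).d i + (higpRun W γ H b (t + 1) ω).s i
        - (higpRun W γ H b t ω).s i := fun ω => rfl
    simp only [h1]
    have i1 := (memLp_mix W Ld i).integrable one_le_two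
    have i2 := (ho.memLp_s hf Lz' i).integrable one_le_two
    have i3 := (ho.memLp_s hf Lz i).integrable one_le_two
    have i4 : Integrable (fun ω => mix W (higpRun W γ H b t ω).d i
      + (higpRun W γ H b (t + 1) ω).s i) P := i1.add i2
    rw [integral_sub i4 i3, integral_add i1 i2, integral_mix W fun i =>
          (Ld i).integrable one_le_two, hs (t + 1) hz, hs t ihz]
    simp only [ihd]
    rfl

end IsLinearOracle

end LinearOracle

section TrackingRecursion

variable {n q : ℕ} {Ω : Type*} [MeasurableSpace Ω] {P : Measure Ω} [IsProbabilityMeasure P]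
  {W : Matrix (Fin n) (Fin n) ℝ} {ρ γ μ L : ℝ}
  {H : ℕ → Fin n → Ω → EuclideanSpace ℝ (Fin q) →L[ℝ] EuclideanSpace ℝ (Fin q)}
  {b : ℕ → Fin n → Ω → EuclideanSpace ℝ (Fin q)}
  {hm : Fin n → EuclideanSpace ℝ (Fin q) →L[ℝ] EuclideanSpace ℝ (Fin q)}
  {bm : Fin n → EuclideanSpace ℝ (Fin q)} {σH σb : ℝ} {zs : EuclideanSpace ℝ (Fin q)}

/-- The noise level of the oracle near the solution `zs`. -/
def noiseLevel (n : ℕ) (σH σb r : ℝ) : ℝ := 4 * n * σH ^ 2 * r ^ 2 + 2 * n * σb ^ 2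

/-- The constant of the recursion for the oracle. -/
def trackingConst (n : ℕ) (μ L ρ σH : ℝ) : ℝ :=
  1 + (1 + 2 / μ) * L ^ 2 + 4 / (1 - ρ) * (n * L ^ 2 + 4 * n * σH ^ 2 + 2)

lemma noiseLevel_nonneg (n : ℕ) (σH σb r : ℝ) : 0 ≤ noiseLevel n σH σb r := by
  unfold noiseLevel; positivity

namespace IsLinearOracle

lemma integral_noiseBound_le (hn : 0 < n) (ho : IsLinearOracle P H b hm bm σH σb)
    (hf : Fresh P W γ H b) (zs : EuclideanSpace ℝ (Fin q)) (t : ℕ) :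
    Integrable (fun ω => ∑ i, (2 * σH ^ 2 * ‖(higpRun W γ H b t ω).z i‖ ^ 2 + 2 * σb ^ 2)) P ∧
    ∫ ω, ∑ i, (2 * σH ^ 2 * ‖(higpRun W γ H b t ω).z i‖ ^ 2 + 2 * σb ^ 2) ∂P ≤
      4 * n * σH ^ 2 * (∫ ω, ‖agentAvg (higpRun W γ H b t ω).z - zs‖ ^ 2 ∂P
        + ∫ ω, sqNorm (dev (higpRun W γ H b t ω).z) ∂P) + noiseLevel n σH σb ‖zs‖ := by
  have hz := (ho.memLp_z_d hf t).1
  have h1 : Integrable (fun ω => ‖agentAvg (higpRun W γ H b t ω).z - zs‖ ^ 2) P :=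
    ((memLp_agentAvg hz).sub (memLp_const zs)).integrable_norm_pow two_ne_zero
  have h2 := integrable_sqNorm (memLp_dev hz)
  have h0 : Integrable (fun ω => ∑ i, (2 * σH ^ 2 * ‖(higpRun W γ H b t ω).z i‖ ^ 2
      + 2 * σb ^ 2)) P := integrable_finsetSum _ fun i _ =>
    (((hz i).integrable_norm_pow two_ne_zero).const_mul _).add (integrable_const _)
  refine ⟨h0, ?_⟩
  have h3 : Integrable (fun ω => 4 * n * σH ^ 2 * (‖agentAvg (higpRun W γ H b t ω).z - zs‖ ^ 2
        + sqNorm (dev (higpRun W γ H b t ω).z)) + noiseLevel n σH σb ‖zs‖) P :=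
    ((h1.add h2).const_mul _).add (integrable_const _)
  refine (integral_mono h0 h3 fun ω => ?_).trans_eq ?_
  · set z := (higpRun W γ H b t ω).z
    have e : ∑ i, (2 * σH ^ 2 * ‖z i‖ ^ 2 + 2 * σb ^ 2) =
        2 * σH ^ 2 * sqNorm z + 2 * n * σb ^ 2 := by
      rw [Finset.sum_add_distrib, ← Finset.mul_sum, sqNorm]; simp; ring
    have h4 : sqNorm z ≤ 2 * sqNorm (fun i => z i - zs) + 2 * (n * ‖zs‖ ^ 2) := by
      have := sqNorm_add_le_two (fun i => z i - zs) fun _ => zs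
      simpa [sqNorm] using this
    rw [sqNorm_sub_const hn] at h4
    have hn' : (1 : ℝ) ≤ n := by exact_mod_cast hn
    have h5 : sqNorm (dev z) ≤ n * sqNorm (dev z) := le_mul_of_one_le_left (sqNorm_nonneg _) hn'
    simp only [e, noiseLevel]
    have h6 : sqNorm z ≤ 2 * n * (‖agentAvg z - zs‖ ^ 2 + sqNorm (dev z)) + 2 * n * ‖zs‖ ^ 2 := by
      linarith
    have := mul_le_mul_of_nonneg_left h6 (show 0 ≤ 2 * σH ^ 2 by positivity)
    linarith
  · have h4 : Integrable (fun ω => ‖agentAvg (higpRun W γ H b t ω).z - zs‖ ^ 2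
      + sqNorm (dev (higpRun W γ H b t ω).z)) P := h1.add h2
    rw [integral_add (h4.const_mul _) (integrable_const _), integral_const_mul, integral_add h1 h2]
    simp

lemma integral_sqNorm_noise_le (hn : 0 < n) (ho : IsLinearOracle P H b hm bm σH σb)
    (hf : Fresh P W γ H b) (zs : EuclideanSpace ℝ (Fin q)) (t : ℕ) :
    ∫ ω, sqNorm (residNoise hm bm (higpRun W γ H b t ω).z (oracleSample H b t ω)) ∂P ≤
      4 * n * σH ^ 2 * (∫ ω, ‖agentAvg (higpRun W γ H b t ω).z - zs‖ ^ 2 ∂P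
        + ∫ ω, sqNorm (dev (higpRun W γ H b t ω).z) ∂P) + noiseLevel n σH σb ‖zs‖ := by
  have hz := (ho.memLp_z_d hf t).1
  refine le_trans ?_ (ho.integral_noiseBound_le hn hf zs t).2
  have h0 : ∀ i ∈ Finset.univ, Integrable (fun ω =>
      2 * σH ^ 2 * ‖(higpRun W γ H b t ω).z i‖ ^ 2 + 2 * σb ^ 2) P := fun i _ =>
    (((hz i).integrable_norm_pow two_ne_zero).const_mul _).add (integrable_const _)
  rw [integral_sqNorm fun i => (ho.memLp_noise hf hz i).1, integral_finsetSum _ h0]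
  exact Finset.sum_le_sum fun i _ => (ho.memLp_noise hf hz i).2

/-- Mean squared error of the averaged iterate. -/
lemma integral_agentAvg_succ_le (hn : 0 < n) (hW : IsGossip W ρ) (hμ : 0 < μ) (hγ : 0 < γ)
    (hγL : γ * L ^ 2 ≤ μ) (hL : ∀ i, ‖hm i‖ ≤ L)
    (hco : ∀ v, μ * ‖v‖ ^ 2 ≤ inner ℝ (agentAvg fun i => hm i v) v)
    (hzs : (agentAvg fun i => hm i zs) = agentAvg bm)
    (ho : IsLinearOracle P H b hm bm σH σb) (hf : Fresh P W γ H b) (t : ℕ) :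
    ∫ ω, ‖agentAvg (higpRun W γ H b (t + 1) ω).z - zs‖ ^ 2 ∂P ≤
      ((1 - γ * μ / 2) * ∫ ω, ‖agentAvg (higpRun W γ H b t ω).z - zs‖ ^ 2 ∂P
        + γ * (γ + 2 / μ) * L ^ 2 * ∫ ω, sqNorm (dev (higpRun W γ H b t ω).z) ∂P)
      + γ ^ 2 * (4 * n * σH ^ 2 * (∫ ω, ‖agentAvg (higpRun W γ H b t ω).z - zs‖ ^ 2 ∂P
        + ∫ ω, sqNorm (dev (higpRun W γ H b t ω).z) ∂P) + noiseLevel n σH σb ‖zs‖) := by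
  have hz := (ho.memLp_z_d hf t).1
  obtain ⟨hvi, hvle⟩ := ho.integral_noiseBound_le hn hf zs t
  let a : (Fin n → EuclideanSpace ℝ (Fin q)) → EuclideanSpace ℝ (Fin q) := fun z =>
    agentAvg z - zs - γ • agentAvg (localResid hm bm z)
  have hres : Measurable fun z : Fin n → EuclideanSpace ℝ (Fin q) => localResid hm bm z :=
    measurable_pi_lambda _ fun i => ((hm i).measurable.comp (measurable_pi_apply i)).sub_const _
  have ha : Measurable a := ((measurable_agentAvg measurable_id).sub_const zs).sub
    ((measurable_agentAvg hres).const_smul γ)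
  have hai : MemLp (fun ω => a (higpRun W γ H b t ω).z) 2 P :=
    ((memLp_agentAvg hz).sub (memLp_const zs)).sub
      ((memLp_agentAvg (memLp_localResid hz)).const_smul γ)
  have hstep : ∀ ω, agentAvg (higpRun W γ H b (t + 1) ω).z - zs = a (higpRun W γ H b t ω).z +
      -(γ • agentAvg (residNoise hm bm (higpRun W γ H b t ω).z (oracleSample H b t ω))) := by
    intro ω
    have e1 : (higpRun W γ H b (t + 1) ω).z = fun i =>
      mix W (higpRun W γ H b t ω).z i - γ • (higpRun W γ H b t ω).d i := rfl
    have e2 : agentAvg (higpRun W γ H b t ω).d = agentAvg (higpRun W γ H b t ω).s :=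
      agentAvg_higp_d hW _ _ t
    rw [e1, agentAvg_sub, hW.agentAvg_mix, agentAvg_smul, e2, higpRun_s (hm := hm) (bm := bm),
      agentAvg_add, smul_add]
    simp only [a]
    abel
  simp only [hstep]
  have hnoise : ∀ z : Fin n → EuclideanSpace ℝ (Fin q), ∀ i, Integrable (fun ω =>
      residNoise hm bm z (oracleSample H b t ω) i) P := fun z i =>
    (ho.memLp_residNoise t z i).integrable one_le_two
  have hN : Measurable (Function.uncurry fun (z : Fin n → EuclideanSpace ℝ (Fin q)) ξ =>
      -(γ • agentAvg (residNoise hm bm z ξ))) :=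
    ((measurable_agentAvg measurable_residNoise).const_smul γ).neg
  have h1 := integral_norm_add_fresh_sq_le (ho.measurable_z t) (ho.measurable_sample t) (hf t)
    (G := fun z ξ => -(γ • agentAvg (residNoise hm bm z ξ))) hN ha hai
    (fun z => ((memLp_agentAvg (ho.memLp_residNoise t z)).const_smul γ).neg)
    (fun z => by
      rw [integral_neg, integral_smul, integral_agentAvg (hnoise z)]
      simp [ho.integral_residNoise, agentAvg])
    (v := fun z => γ ^ 2 * ∑ i, (2 * σH ^ 2 * ‖z i‖ ^ 2 + 2 * σb ^ 2))
    (fun z => by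
      simp only [norm_neg, norm_smul, mul_pow, Real.norm_eq_abs, sq_abs]
      rw [integral_const_mul]
      refine mul_le_mul_of_nonneg_left ?_ (sq_nonneg γ)
      refine (integral_mono ((memLp_agentAvg (ho.memLp_residNoise t z)).integrable_norm_pow
        two_ne_zero) (integrable_sqNorm (ho.memLp_residNoise t z))
        fun ω => norm_agentAvg_sq_le' hn _).trans ?_
      rw [integral_sqNorm (ho.memLp_residNoise t z)]
      exact Finset.sum_le_sum fun i _ => ho.integral_norm_residNoise_sq_le t z i)
    (hvi.const_mul _)
  refine h1.trans (add_le_add ?_ ?_)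
  · have i1 : Integrable (fun ω => ‖agentAvg (higpRun W γ H b t ω).z - zs‖ ^ 2) P :=
      ((memLp_agentAvg hz).sub (memLp_const zs)).integrable_norm_pow two_ne_zero
    have i2 := integrable_sqNorm (memLp_dev hz)
    rw [← integral_const_mul, ← integral_const_mul, ← integral_add (i1.const_mul _)
      (i2.const_mul _)]
    exact integral_mono (hai.integrable_norm_pow two_ne_zero) ((i1.const_mul _).add
      (i2.const_mul _)) fun ω => norm_agentAvg_localResid_step_sq_le hn hμ hγ hγL hL hco hzs _
  · rw [integral_const_mul]
    exact mul_le_mul_of_nonneg_left hvle (sq_nonneg γ)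

/-- Consensus error of the iterates. -/
lemma integral_dev_z_succ_le (hn : 0 < n) (hW : IsGossip W ρ)
    (ho : IsLinearOracle P H b hm bm σH σb) (hf : Fresh P W γ H b) (t : ℕ) :
    ∫ ω, sqNorm (dev (higpRun W γ H b (t + 1) ω).z) ∂P ≤
      ρ * ∫ ω, sqNorm (dev (higpRun W γ H b t ω).z) ∂P
        + γ ^ 2 / (1 - ρ) * ∫ ω, sqNorm (dev (higpRun W γ H b t ω).d) ∂P := by
  obtain ⟨hz, hd⟩ := ho.memLp_z_d hf t
  have i1 := integrable_sqNorm (memLp_dev hz)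
  have i2 := integrable_sqNorm (memLp_dev hd)
  rw [← integral_const_mul, ← integral_const_mul, ← integral_add (i1.const_mul _) (i2.const_mul _)]
  refine integral_mono (integrable_sqNorm (memLp_dev (ho.memLp_z_d hf (t + 1)).1))
    ((i1.const_mul _).add (i2.const_mul _)) fun ω => ?_
  have e1 : (higpRun W γ H b (t + 1) ω).z = fun i =>
      mix W (higpRun W γ H b t ω).z i + (-γ) • (higpRun W γ H b t ω).d i := by
    funext i
    rw [neg_smul, ← sub_eq_add_neg]; rfl
  have h1 := hW.sqNorm_dev_step_le hn (higpRun W γ H b t ω).z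
    fun i => (-γ) • (higpRun W γ H b t ω).d i
  rw [← e1, dev_smul, sqNorm_smul] at h1
  refine h1.trans_eq ?_
  ring

/-- Consensus error of the tracking variables. -/
lemma integral_dev_d_succ_le (hn : 0 < n) (hW : IsGossip W ρ) (hL : ∀ i, ‖hm i‖ ≤ L)
    (ho : IsLinearOracle P H b hm bm σH σb) (hf : Fresh P W γ H b) (zs : EuclideanSpace ℝ (Fin q))
    (t : ℕ) :
    ∫ ω, sqNorm (dev (higpRun W γ H b (t + 1) ω).d) ∂P ≤
      ρ * ∫ ω, sqNorm (dev (higpRun W γ H b t ω).d) ∂P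
      + 4 / (1 - ρ) * (L ^ 2 * (n * ∫ ω, ‖agentAvg (higpRun W γ H b (t + 1) ω).z - zs‖ ^ 2 ∂P
          + ∫ ω, sqNorm (dev (higpRun W γ H b (t + 1) ω).z) ∂P)
        + L ^ 2 * (n * ∫ ω, ‖agentAvg (higpRun W γ H b t ω).z - zs‖ ^ 2 ∂P
          + ∫ ω, sqNorm (dev (higpRun W γ H b t ω).z) ∂P)
        + ∫ ω, sqNorm (residNoise hm bm (higpRun W γ H b (t + 1) ω).z
            (oracleSample H b (t + 1) ω)) ∂P
        + ∫ ω, sqNorm (residNoise hm bm (higpRun W γ H b t ω).z (oracleSample H b t ω)) ∂P) := by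
  obtain ⟨hz, hd⟩ := ho.memLp_z_d hf t
  obtain ⟨hz', hd'⟩ := ho.memLp_z_d hf (t + 1)
  have i1 := integrable_sqNorm (memLp_dev hd)
  have ia : ∀ t, Integrable (fun ω => ‖agentAvg (higpRun W γ H b t ω).z - zs‖ ^ 2) P := fun t =>
    ((memLp_agentAvg (ho.memLp_z_d hf t).1).sub (memLp_const zs)).integrable_norm_pow two_ne_zero
  have ib : ∀ t, Integrable (fun ω => sqNorm (dev (higpRun W γ H b t ω).z)) P := fun t =>
    integrable_sqNorm (memLp_dev (ho.memLp_z_d hf t).1)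
  have ic : ∀ t, Integrable (fun ω => sqNorm (residNoise hm bm (higpRun W γ H b t ω).z
      (oracleSample H b t ω))) P := fun t =>
    integrable_sqNorm fun i => (ho.memLp_noise hf (ho.memLp_z_d hf t).1 i).1
  have iab : ∀ t, Integrable (fun ω => L ^ 2 * (n * ‖agentAvg (higpRun W γ H b t ω).z - zs‖ ^ 2
      + sqNorm (dev (higpRun W γ H b t ω).z))) P := fun t =>
    (((ia t).const_mul _).add (ib t)).const_mul _
  have eab : ∀ t, ∫ ω, L ^ 2 * (n * ‖agentAvg (higpRun W γ H b t ω).z - zs‖ ^ 2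
      + sqNorm (dev (higpRun W γ H b t ω).z)) ∂P =
      L ^ 2 * (n * ∫ ω, ‖agentAvg (higpRun W γ H b t ω).z - zs‖ ^ 2 ∂P
          + ∫ ω, sqNorm (dev (higpRun W γ H b t ω).z) ∂P) := fun t => by
    rw [integral_const_mul, integral_add ((ia t).const_mul _) (ib t), integral_const_mul]
  have j1 : Integrable (fun ω => L ^ 2 * (n * ‖agentAvg (higpRun W γ H b (t + 1) ω).z - zs‖ ^ 2
        + sqNorm (dev (higpRun W γ H b (t + 1) ω).z))
      + L ^ 2 * (n * ‖agentAvg (higpRun W γ H b t ω).z - zs‖ ^ 2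
        + sqNorm (dev (higpRun W γ H b t ω).z))) P := (iab (t + 1)).add (iab t)
  have j2 : Integrable (fun ω => L ^ 2 * (n * ‖agentAvg (higpRun W γ H b (t + 1) ω).z - zs‖ ^ 2
        + sqNorm (dev (higpRun W γ H b (t + 1) ω).z))
      + L ^ 2 * (n * ‖agentAvg (higpRun W γ H b t ω).z - zs‖ ^ 2
        + sqNorm (dev (higpRun W γ H b t ω).z))
      + sqNorm (residNoise hm bm (higpRun W γ H b (t + 1) ω).z
            (oracleSample H b (t + 1) ω))) P := j1.add (ic (t + 1))
  have j3 : Integrable (fun ω => L ^ 2 * (n * ‖agentAvg (higpRun W γ H b (t + 1) ω).z - zs‖ ^ 2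
        + sqNorm (dev (higpRun W γ H b (t + 1) ω).z))
      + L ^ 2 * (n * ‖agentAvg (higpRun W γ H b t ω).z - zs‖ ^ 2
        + sqNorm (dev (higpRun W γ H b t ω).z))
      + sqNorm (residNoise hm bm (higpRun W γ H b (t + 1) ω).z (oracleSample H b (t + 1) ω))
      + sqNorm (residNoise hm bm (higpRun W γ H b t ω).z (oracleSample H b t ω))) P :=
    j2.add (ic t)
  rw [← eab, ← eab, ← integral_add (iab (t + 1)) (iab t), ← integral_add j1 (ic (t + 1)),
    ← integral_add j2 (ic t), ← integral_const_mul, ← integral_const_mul,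
    ← integral_add (i1.const_mul _) (j3.const_mul _)]
  refine integral_mono (integrable_sqNorm (memLp_dev hd'))
    ((i1.const_mul _).add (j3.const_mul _)) fun ω => ?_
  have e1 : (higpRun W γ H b (t + 1) ω).d = fun i => mix W (higpRun W γ H b t ω).d i
      + ((higpRun W γ H b (t + 1) ω).s i - (higpRun W γ H b t ω).s i) := by
    funext i
    rw [← add_sub_assoc]; rfl
  have h1 := hW.sqNorm_dev_step_le hn (higpRun W γ H b t ω).d
    fun i => (higpRun W γ H b (t + 1) ω).s i - (higpRun W γ H b t ω).s i
  rw [← e1] at h1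
  refine h1.trans ?_
  have h2 := sqNorm_dev_le hn fun i => (higpRun W γ H b (t + 1) ω).s i - (higpRun W γ H b t ω).s i
  simp only [higpRun_s (hm := hm) (bm := bm)] at h2 ⊢
  have h3 := h2.trans (sqNorm_localResid_sub_le hL zs _ _ _ _)
  rw [sqNorm_sub_const hn, sqNorm_sub_const hn] at h3
  have h1ρ : 0 < 1 - ρ := by linarith [hW.lt_one]
  refine add_le_add le_rfl ((div_le_div_of_nonneg_right h3 h1ρ.le).trans_eq ?_)
  ring

end IsLinearOracle

end TrackingRecursion

/-- Mean square stability of the oracle, uniformly in the dimension and in the problem data: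
up to the noise level, the squared error decays linearly. -/
lemma exists_higp_bound {n : ℕ} (hn : 0 < n) {μ L ρ : ℝ} (σH : ℝ) (hμ : 0 < μ) (hρ0 : 0 < ρ)
    (hρ : ρ < 1) :
    ∃ γ₀ M : ℝ, 0 < γ₀ ∧ 0 < M ∧ ∀ γ, 0 < γ → γ < γ₀ →
      (0 < 1 - γ * μ / 4 ∧ 1 - γ * μ / 4 < 1) ∧
      ∀ {q : ℕ} {Ω : Type*} [MeasurableSpace Ω] {P : Measure Ω} [IsProbabilityMeasure P]
        {W : Matrix (Fin n) (Fin n) ℝ}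
        {H : ℕ → Fin n → Ω → EuclideanSpace ℝ (Fin q) →L[ℝ] EuclideanSpace ℝ (Fin q)}
        {b : ℕ → Fin n → Ω → EuclideanSpace ℝ (Fin q)}
        {hm : Fin n → EuclideanSpace ℝ (Fin q) →L[ℝ] EuclideanSpace ℝ (Fin q)}
        {bm : Fin n → EuclideanSpace ℝ (Fin q)} {σ σb : ℝ} {zs : EuclideanSpace ℝ (Fin q)},
        IsGossip W ρ → (∀ i, ‖hm i‖ ≤ L) →
        (∀ v, μ * ‖v‖ ^ 2 ≤ inner ℝ (agentAvg fun i => hm i v) v) →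
        (agentAvg fun i => hm i zs) = agentAvg bm →
        σ ^ 2 ≤ σH ^ 2 → IsLinearOracle P H b hm bm σ σb → IsLinearOracle.Fresh P W γ H b →
        ∀ X : ℝ, ‖zs‖ ^ 2 ≤ X → ∫ ω, sqNorm (fun i => b 0 i ω) ∂P ≤ X →
        ∀ t, ∫ ω, sqNorm (fun i => (higpRun W γ H b t ω).z i - zs) ∂P ≤
          M * ((1 - γ * μ / 4) ^ t * X + noiseLevel n σ σb ‖zs‖) := by
  have h1ρ : 0 < 1 - ρ := by linarith
  set C := trackingConst n μ L ρ σH with hC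
  have hA0 : 0 ≤ (1 + 2 / μ) * L ^ 2 := by positivity
  have hB0 : 0 ≤ (n : ℝ) * L ^ 2 + 4 * n * σH ^ 2 := by positivity
  have h4 : 4 ≤ 4 / (1 - ρ) := by rw [le_div_iff₀ h1ρ]; linarith
  have hC1 : 1 ≤ C := by
    rw [hC, trackingConst]
    linarith [show 0 ≤ 4 / (1 - ρ) * (n * L ^ 2 + 4 * n * σH ^ 2 + 2) by positivity]
  have hCA : (1 + 2 / μ) * L ^ 2 ≤ C := by
    rw [hC, trackingConst]
    linarith [show 0 ≤ 4 / (1 - ρ) * (n * L ^ 2 + 4 * n * σH ^ 2 + 2) by positivity]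
  have hCB : 4 / (1 - ρ) * (n * L ^ 2 + 4 * n * σH ^ 2 + 2) ≤ C := by
    rw [hC, trackingConst]; linarith
  have hCσ : 4 * n * σH ^ 2 ≤ C := by
    refine le_trans ?_ hCB
    have h5 : 0 ≤ (n : ℝ) * L ^ 2 := by positivity
    have h6 : 0 ≤ (n : ℝ) * σH ^ 2 := by positivity
    have := mul_le_mul_of_nonneg_right h4 (show 0 ≤ n * L ^ 2 + 4 * n * σH ^ 2 + 2 by positivity)
    linarith
  have hCρ : 1 / (1 - ρ) ≤ C := by
    refine le_trans ?_ hCB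
    have h7 : 4 / (1 - ρ) * 1 ≤ 4 / (1 - ρ) * (n * L ^ 2 + 4 * n * σH ^ 2 + 2) := by
      gcongr; linarith
    refine le_trans ?_ h7
    rw [mul_one]; gcongr; norm_num
  obtain ⟨γ₁, M, hγ₁, hM, key⟩ := exists_tracking_bound hμ hρ0 hρ hC1
  refine ⟨min γ₁ (min 1 (μ / (L ^ 2 + 1))), (n + 1) * M, by positivity, by positivity,
    fun γ hγ0 hγ => ?_⟩
  obtain ⟨hg1, hg2, hg3⟩ : γ < γ₁ ∧ γ < 1 ∧ γ < μ / (L ^ 2 + 1) := by simpa [lt_min_iff] using hγ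
  rw [lt_div_iff₀ (by positivity)] at hg3
  obtain ⟨hθ, key⟩ := key γ hγ0 hg1
  refine ⟨hθ, fun {q Ω _ P _ W H b hm bm σ σb zs} hW hL hco hzs hσ ho hf X hX hX' t => ?_⟩
  set τ := noiseLevel n σ σb ‖zs‖ with hτ
  have hτ0 : 0 ≤ τ := noiseLevel_nonneg _ _ _ _
  have hγL : γ * L ^ 2 ≤ μ := by linarith
  set a : ℕ → ℝ := fun t => ∫ ω, ‖agentAvg (higpRun W γ H b t ω).z - zs‖ ^ 2 ∂P with ha
  set B : ℕ → ℝ := fun t => ∫ ω, sqNorm (dev (higpRun W γ H b t ω).z) ∂P with hB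
  set d : ℕ → ℝ := fun t => ∫ ω, sqNorm (dev (higpRun W γ H b t ω).d) ∂P with hd
  set w : ℕ → ℝ := fun t => ∫ ω, sqNorm (residNoise hm bm (higpRun W γ H b t ω).z
    (oracleSample H b t ω)) ∂P with hw
  have ha0 : ∀ t, 0 ≤ a t := fun t => integral_nonneg fun ω => by positivity
  have hB0' : ∀ t, 0 ≤ B t := fun t => integral_nonneg fun ω => sqNorm_nonneg _
  have hd0 : ∀ t, 0 ≤ d t := fun t => integral_nonneg fun ω => sqNorm_nonneg _
  have hσC : 4 * n * σ ^ 2 ≤ C := le_trans (by gcongr) hCσ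
  have rw' : ∀ t, w t ≤ 4 * n * σH ^ 2 * (a t + B t) + τ := fun t => by
    refine (ho.integral_sqNorm_noise_le hn hf zs t).trans (add_le_add ?_ le_rfl)
    exact mul_le_mul_of_nonneg_right (by gcongr) (add_nonneg (ha0 t) (hB0' t))
  have ra : ∀ t, a (t + 1) ≤ (1 - γ * μ / 2) * a t + γ * C * B t
      + γ ^ 2 * C * (a t + B t + τ) := fun t => by
    refine (ho.integral_agentAvg_succ_le hn hW hμ hγ0 hγL hL hco hzs hf t).trans
      (add_le_add (add_le_add le_rfl ?_) ?_)
    · refine mul_le_mul_of_nonneg_right ?_ (hB0' t)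
      calc γ * (γ + 2 / μ) * L ^ 2 ≤ γ * (1 + 2 / μ) * L ^ 2 := by gcongr
        _ = γ * ((1 + 2 / μ) * L ^ 2) := by ring
        _ ≤ γ * C := by gcongr
    · rw [mul_assoc (γ ^ 2)]
      refine mul_le_mul_of_nonneg_left ?_ (sq_nonneg γ)
      have h1 : 4 * n * σ ^ 2 * (a t + B t) ≤ C * (a t + B t) :=
        mul_le_mul_of_nonneg_right hσC (add_nonneg (ha0 t) (hB0' t))
      have h2 : τ ≤ C * τ := le_mul_of_one_le_left hτ0 hC1
      calc _ ≤ C * (a t + B t) + C * τ := add_le_add h1 h2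
        _ = _ := by ring
  have rb : ∀ t, B (t + 1) ≤ ρ * B t + γ ^ 2 * C * d t := fun t => by
    refine (ho.integral_dev_z_succ_le hn hW hf t).trans (add_le_add le_rfl ?_)
    refine mul_le_mul_of_nonneg_right ?_ (hd0 t)
    rw [div_eq_mul_one_div]
    exact mul_le_mul_of_nonneg_left hCρ (sq_nonneg γ)
  have rd : ∀ t, d (t + 1) ≤ ρ * d t + C * (a t + B t + a (t + 1) + B (t + 1) + τ) := fun t => by
    refine (ho.integral_dev_d_succ_le hn hW hL hf zs t).trans (add_le_add le_rfl ?_)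
    change 4 / (1 - ρ) * (L ^ 2 * (n * a (t + 1) + B (t + 1)) + L ^ 2 * (n * a t + B t)
      + w (t + 1) + w t) ≤ _
    set S := a t + B t + a (t + 1) + B (t + 1) + τ with hS
    have hS0 : 0 ≤ S := by
      have := ha0 t; have := ha0 (t + 1); have := hB0' t; have := hB0' (t + 1); positivity
    refine le_trans ?_ (mul_le_mul_of_nonneg_right hCB hS0)
    rw [mul_assoc]
    refine mul_le_mul_of_nonneg_left ?_ (by positivity)
    have hn' : (1 : ℝ) ≤ n := by exact_mod_cast hn
    have h1 : L ^ 2 * B t ≤ n * L ^ 2 * B t :=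
      mul_le_mul_of_nonneg_right (le_mul_of_one_le_left (sq_nonneg L) hn') (hB0' t)
    have h2 : L ^ 2 * B (t + 1) ≤ n * L ^ 2 * B (t + 1) :=
      mul_le_mul_of_nonneg_right (le_mul_of_one_le_left (sq_nonneg L) hn') (hB0' _)
    have h3 := rw' t
    have h4 := rw' (t + 1)
    have h5 : 0 ≤ (n * L ^ 2 + 4 * n * σH ^ 2) * τ := by positivity
    have h6 : 0 ≤ 2 * (a t + B t + a (t + 1) + B (t + 1)) := by
      have := ha0 t; have := ha0 (t + 1); have := hB0' t; have := hB0' (t + 1); positivity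
    rw [hS]
    linarith
  have hz0 : ∀ ω, (higpRun W γ H b 0 ω).z = 0 := fun ω => rfl
  have h0 := key a B d X τ ((sq_nonneg _).trans hX) hτ0 (by
      simp only [ha, hz0]; simpa [agentAvg] using hX) (by
      simp only [hB, hz0]
      simpa [sqNorm, dev, agentAvg] using (sq_nonneg _).trans hX) (by
      refine le_trans ?_ hX'
      refine integral_mono (integrable_sqNorm (memLp_dev (ho.memLp_z_d hf 0).2))
        (integrable_sqNorm fun i => ho.memLp_b 0 i) fun ω => ?_
      refine (sqNorm_dev_le hn _).trans_eq ?_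
      simp [higpRun, higp_zero, sqNorm]) ra rb rd t
  have hz := (ho.memLp_z_d hf t).1
  have e : ∫ ω, sqNorm (fun i => (higpRun W γ H b t ω).z i - zs) ∂P = n * a t + B t := by
    simp only [sqNorm_sub_const hn]
    have i1 : Integrable (fun ω => ‖agentAvg (higpRun W γ H b t ω).z - zs‖ ^ 2) P :=
      ((memLp_agentAvg hz).sub (memLp_const zs)).integrable_norm_pow two_ne_zero
    rw [integral_add (i1.const_mul _) (integrable_sqNorm (memLp_dev hz)), integral_const_mul]
  rw [e]
  have hn' : (0 : ℝ) ≤ n := n.cast_nonneg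
  have := mul_le_mul_of_nonneg_left h0.1 hn'
  linarith [h0.2]

/-! ### Independence of disjoint families of samples -/

namespace DSBOSamples

variable {n p q : ℕ} {Ξ Ψ Ω : Type*} [MeasurableSpace Ξ] [MeasurableSpace Ψ]

/-- The σ-algebra generated by the samples with index in `A`. -/
@[reducible] def generated (S : DSBOSamples n Ξ Ψ Ω) (A : Set (SampleIndex n)) :
    MeasurableSpace Ω :=
  ⨆ j ∈ A, S.sigmaAlgebra j

variable {S : DSBOSamples n Ξ Ψ Ω} {A B : Set (SampleIndex n)}

lemma measurable_lower_generated {k t : ℕ} {i : Fin n} (h : SampleIndex.lower k t i ∈ A) :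
    Measurable[S.generated A] (S.lower k t i) :=
  (comap_measurable (S.lower k t i)).mono
    (le_iSup₂_of_le (f := fun j (_ : j ∈ A) => S.sigmaAlgebra j) _ h le_rfl) le_rfl

lemma measurable_hess_generated {k t : ℕ} {i : Fin n} (h : SampleIndex.hess k t i ∈ A) :
    Measurable[S.generated A] (S.hess k t i) :=
  (comap_measurable (S.hess k t i)).mono
    (le_iSup₂_of_le (f := fun j (_ : j ∈ A) => S.sigmaAlgebra j) _ h le_rfl) le_rfl

lemma measurable_grad_generated {k t : ℕ} {i : Fin n} (h : SampleIndex.grad k t i ∈ A) :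
    Measurable[S.generated A] (S.grad k t i) :=
  (comap_measurable (S.grad k t i)).mono
    (le_iSup₂_of_le (f := fun j (_ : j ∈ A) => S.sigmaAlgebra j) _ h le_rfl) le_rfl

lemma IsIndependentSampling.indepFun [MeasurableSpace Ω] {D : DSBOProblem n p q Ξ Ψ}
    {P : Measure Ω} (h : S.IsIndependentSampling D P) (hAB : Disjoint A B) {α β : Type*}
    [MeasurableSpace α] [MeasurableSpace β] {X : Ω → α} {Y : Ω → β}
    (hX : Measurable[S.generated A] X) (hY : Measurable[S.generated B] Y) : IndepFun X Y P := by
  have hle : ∀ j, S.sigmaAlgebra j ≤ (inferInstance : MeasurableSpace Ω) := by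
    rintro (⟨k, t, i⟩ | ⟨k, t, i⟩ | ⟨k, t, i⟩)
    · exact (h.lower k t i).measurable.comap_le
    · exact (h.hess k t i).measurable.comap_le
    · exact (h.grad k t i).measurable.comap_le
  have h1 := indep_iSup_of_disjoint hle h.indep hAB
  rw [IndepFun_iff_Indep]
  exact indep_of_indep_of_le_left (indep_of_indep_of_le_right h1 hY.comap_le) hX.comap_le

/-- All samples of outer iteration `k` used for the hypergradient estimation. -/
def block (S : DSBOSamples n Ξ Ψ Ω) (k : ℕ) (ω : Ω) : (ℕ → Fin n → Ξ) × (ℕ → Fin n → Ψ) :=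
  (fun t i => S.hess k t i ω, fun t i => S.grad k t i ω)

end DSBOSamples

/-! ### The hypergradient estimator -/

lemma IsUnbiasedOracle.memLp_comp {Ω Z S V : Type*} [MeasurableSpace Z] [MeasurableSpace S]
    [NormedAddCommGroup V] [NormedSpace ℝ V] [MeasurableSpace V] [MeasurableSpace Ω]
    {G : Z → S → V} {m : Z → V} {μ : Measure S} {σ : ℝ} {P : Measure Ω}
    (hG : IsUnbiasedOracle G m μ σ) {ξ : Ω → S} (hξ : MeasurePreserving ξ P μ) (z : Z) :
    MemLp (fun ω => G z (ξ ω)) 2 P :=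
  (hG.memLp z).comp_measurePreserving hξ

lemma IsUnbiasedOracle.integral_comp {Ω Z S V : Type*} [MeasurableSpace Z] [MeasurableSpace S]
    [NormedAddCommGroup V] [NormedSpace ℝ V] [MeasurableSpace V] [MeasurableSpace Ω]
    {G : Z → S → V} {m : Z → V} {μ : Measure S} {σ : ℝ} {P : Measure Ω}
    (hG : IsUnbiasedOracle G m μ σ) {ξ : Ω → S} (hξ : MeasurePreserving ξ P μ) (z : Z) :
    ∫ ω, G z (ξ ω) ∂P = m z := by
  have h := (hG.memLp z).aestronglyMeasurable
  rw [← hξ.map_eq] at h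
  rw [← hG.unbiased z, ← hξ.map_eq, integral_map hξ.measurable.aemeasurable h]

lemma IsUnbiasedOracle.integral_clm_comp {Ω Z S V F : Type*} [MeasurableSpace Z] [MeasurableSpace S]
    [NormedAddCommGroup V] [NormedSpace ℝ V] [FiniteDimensional ℝ V] [MeasurableSpace V]
    [NormedAddCommGroup F] [NormedSpace ℝ F] [FiniteDimensional ℝ F] [MeasurableSpace Ω]
    {G : Z → S → V} {m : Z → V} {μ : Measure S} {σ : ℝ} {P : Measure Ω} [IsProbabilityMeasure P]
    (hG : IsUnbiasedOracle G m μ σ) {ξ : Ω → S} (hξ : MeasurePreserving ξ P μ) (A : V →L[ℝ] F)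
    (z : Z) : ∫ ω, A (G z (ξ ω)) ∂P = A (m z) := by
  have : CompleteSpace V := FiniteDimensional.complete ℝ V
  have : CompleteSpace F := FiniteDimensional.complete ℝ F
  rw [A.integral_comp_comm ((IsUnbiasedOracle.memLp_comp hG hξ z).integrable one_le_two),
    IsUnbiasedOracle.integral_comp hG hξ]

lemma IsUnbiasedOracle.variance_comp_le {Ω Z S V : Type*} [MeasurableSpace Z] [MeasurableSpace S]
    [NormedAddCommGroup V] [NormedSpace ℝ V] [MeasurableSpace V] [MeasurableSpace Ω]
    {G : Z → S → V} {m : Z → V} {μ : Measure S} {σ : ℝ} {P : Measure Ω}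
    (hG : IsUnbiasedOracle G m μ σ) {ξ : Ω → S} (hξ : MeasurePreserving ξ P μ) (z : Z) :
    ∫ ω, ‖G z (ξ ω) - m z‖ ^ 2 ∂P ≤ σ ^ 2 := by
  have h : AEStronglyMeasurable (fun s => ‖G z s - m z‖ ^ 2) μ :=
    (((hG.memLp z).aestronglyMeasurable.sub aestronglyMeasurable_const).norm.pow 2)
  rw [← hξ.map_eq] at h
  refine le_trans (le_of_eq ?_) (hG.variance_le z)
  conv_rhs => rw [← hξ.map_eq]
  rw [integral_map hξ.measurable.aemeasurable h]

namespace DSBOProblem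

variable {n p q : ℕ} {Ξ Ψ Ω : Type*} [MeasurableSpace Ξ] [MeasurableSpace Ψ]

/-- The Hessian blocks seen by the oracle at the points `w`. -/
def sampleHess (D : DSBOProblem n p q Ξ Ψ) (w : Fin n → JointSpace p q)
    (B : (ℕ → Fin n → Ξ) × (ℕ → Fin n → Ψ)) (t : ℕ) (i : Fin n) :
    EuclideanSpace ℝ (Fin q) →L[ℝ] EuclideanSpace ℝ (Fin q) :=
  hessYYL (D.hessG i (w i) (B.1 t i))

/-- The right-hand sides seen by the oracle at the points `w`. -/
def sampleGrad (D : DSBOProblem n p q Ξ Ψ) (w : Fin n → JointSpace p q)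
    (B : (ℕ → Fin n → Ξ) × (ℕ → Fin n → Ψ)) (t : ℕ) (i : Fin n) : EuclideanSpace ℝ (Fin q) :=
  (D.gradF i (w i) (B.2 t i)).snd

/-- The hypergradient estimates at the points `w`, as functions of the samples. -/
def estimate (D : DSBOProblem n p q Ξ Ψ) (γ : ℝ) (N : ℕ) (w : Fin n → JointSpace p q)
    (B : (ℕ → Fin n → Ξ) × (ℕ → Fin n → Ψ)) (i : Fin n) : EuclideanSpace ℝ (Fin p) :=
  (D.gradF i (w i) (B.2 0 i)).fst - jacXY (D.hessG i (w i) (B.1 0 i))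
    ((higp D.W γ (fun t i => D.sampleHess w B t i) (D.sampleGrad w B) N).z i)

/-- The noiseless Hessian blocks at the points `w`. -/
def meanHess (D : DSBOProblem n p q Ξ Ψ) (w : Fin n → JointSpace p q) (i : Fin n) :
    EuclideanSpace ℝ (Fin q) →L[ℝ] EuclideanSpace ℝ (Fin q) :=
  hessYYL (D.hessian i (w i))

/-- The noiseless right-hand sides at the points `w`. -/
def meanGrad (D : DSBOProblem n p q Ξ Ψ) (w : Fin n → JointSpace p q) (i : Fin n) :
    EuclideanSpace ℝ (Fin q) :=
  (gradient (D.f i) (w i)).snd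

/-- The mean of the hypergradient estimates at the points `w`. -/
def meanEstimate (D : DSBOProblem n p q Ξ Ψ) (γ : ℝ) (N : ℕ) (w : Fin n → JointSpace p q)
    (i : Fin n) : EuclideanSpace ℝ (Fin p) :=
  (gradient (D.f i) (w i)).fst - jacXY (D.hessian i (w i))
    ((higp D.W γ (fun _ i => D.meanHess w i) (fun _ => D.meanGrad w) N).z i)

/-- `hessYYL` as a continuous linear map. -/
def hessYYCLM (p q : ℕ) : (JointSpace p q →L[ℝ] JointSpace p q) →L[ℝ]
    EuclideanSpace ℝ (Fin q) →L[ℝ] EuclideanSpace ℝ (Fin q) :=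
  LinearMap.mkContinuous { toFun := hessYYL, map_add' := fun _ _ => rfl, map_smul' := fun _ _ => rfl }
    1 fun A => by rw [one_mul]; exact norm_hessYYL_le A

/-- `A ↦ jacXY A v` as a continuous linear map. -/
def jacXYCLM (p q : ℕ) (v : EuclideanSpace ℝ (Fin q)) : (JointSpace p q →L[ℝ] JointSpace p q) →L[ℝ]
    EuclideanSpace ℝ (Fin p) :=
  LinearMap.mkContinuous
    { toFun := fun A => jacXY A v, map_add' := fun _ _ => rfl, map_smul' := fun _ _ => rfl }
    ‖v‖ fun A => by rw [mul_comm]; exact norm_jacXY_le A v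

lemma continuous_jacXY : Continuous fun z : (JointSpace p q →L[ℝ] JointSpace p q) ×
    EuclideanSpace ℝ (Fin q) => jacXY z.1 z.2 := by
  have h := (isBoundedBilinearMap_apply (𝕜 := ℝ) (E := JointSpace p q)
    (F := JointSpace p q)).continuous
  exact (fstJoint p q).continuous.comp (h.comp (continuous_fst.prodMk
    ((inrJoint p q).continuous.comp continuous_snd)))

variable {D : DSBOProblem n p q Ξ Ψ} {c : DSBOConstants}

section Measurability

variable {α : Type*} [MeasurableSpace α]

lemma measurable_sampleHess (hO : D.HasOracles c) {w : α → Fin n → JointSpace p q}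
    {B : α → (ℕ → Fin n → Ξ) × (ℕ → Fin n → Ψ)} (hw : Measurable w) {t : ℕ} {i : Fin n}
    (hB : Measurable fun a => (B a).1 t i) : Measurable fun a => D.sampleHess (w a) (B a) t i :=
  (hessYYCLM p q).continuous.measurable.comp ((hO.hessG i).measurable.comp
    (((measurable_pi_apply i).comp hw).prodMk hB))

lemma measurable_sampleGrad (hO : D.HasOracles c) {w : α → Fin n → JointSpace p q}
    {B : α → (ℕ → Fin n → Ξ) × (ℕ → Fin n → Ψ)} (hw : Measurable w) {t : ℕ} {i : Fin n}
    (hB : Measurable fun a => (B a).2 t i) : Measurable fun a => D.sampleGrad (w a) (B a) t i :=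
  (sndJoint p q).continuous.measurable.comp ((hO.gradF i).measurable.comp
    (((measurable_pi_apply i).comp hw).prodMk hB))

lemma measurable_estimate (hO : D.HasOracles c) (γ : ℝ) (N : ℕ)
    {w : α → Fin n → JointSpace p q} {B : α → (ℕ → Fin n → Ξ) × (ℕ → Fin n → Ψ)}
    (hw : Measurable w) (h1 : ∀ t i, Measurable fun a => (B a).1 t i)
    (h2 : ∀ t i, Measurable fun a => (B a).2 t i) :
    Measurable fun a => D.estimate γ N (w a) (B a) := by
  refine measurable_pi_lambda _ fun i => ?_
  have hz := measurable_higpRun_z (Ω := α) D.W γ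
    (H := fun t i a => D.sampleHess (w a) (B a) t i) (b := fun t i a => D.sampleGrad (w a) (B a) t i)
    N (fun s _ _ i => measurable_sampleHess hO hw (h1 s i))
    (fun s _ i => measurable_sampleGrad hO hw (h2 s i))
  have hwi : Measurable fun a => w a i := (measurable_pi_apply i).comp hw
  have e1 : Measurable fun a => (D.gradF i (w a i) ((B a).2 0 i)).fst :=
    (fstJoint p q).continuous.measurable.comp ((hO.gradF i).measurable.comp (hwi.prodMk (h2 0 i)))
  have e2 : Measurable fun a => D.hessG i (w a i) ((B a).1 0 i) :=
    (hO.hessG i).measurable.comp (hwi.prodMk (h1 0 i))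
  exact e1.sub (continuous_jacXY.measurable.comp (e2.prodMk ((measurable_pi_apply i).comp hz)))

end Measurability

lemma IsSmooth.continuous_gradient_f (h : D.IsSmooth c) (i : Fin n) :
    Continuous (gradient (D.f i)) := (h.lipschitz_gradient_f i).continuous

lemma IsSmooth.continuous_hessian (h : D.IsSmooth c) (i : Fin n) :
    Continuous (D.hessian i) := (h.lipschitz_hessian_g i).continuous

lemma IsSmooth.measurable_meanEstimate (h : D.IsSmooth c) (γ : ℝ) (N : ℕ) :
    Measurable fun w => D.meanEstimate γ N w := by
  refine measurable_pi_lambda _ fun i => ?_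
  have hH : ∀ i, Measurable fun w : Fin n → JointSpace p q => D.hessian i (w i) := fun i =>
    ((h.continuous_hessian i).comp (continuous_apply i)).measurable
  have hF : ∀ i, Measurable fun w : Fin n → JointSpace p q => gradient (D.f i) (w i) := fun i =>
    ((h.continuous_gradient_f i).comp (continuous_apply i)).measurable
  have hz := measurable_higpRun_z (Ω := Fin n → JointSpace p q) D.W γ
    (H := fun _ i w => D.meanHess w i) (b := fun _ i w => D.meanGrad w i)
    N (fun s _ _ i => (hessYYCLM p q).continuous.measurable.comp (hH i))
    (fun s _ i => (sndJoint p q).continuous.measurable.comp (hF i))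
  exact ((fstJoint p q).continuous.measurable.comp (hF i)).sub
    (continuous_jacXY.measurable.comp ((hH i).prodMk ((measurable_pi_apply i).comp hz)))

lemma integral_norm_sq_le_of_variance {V : Type*} [NormedAddCommGroup V] [MeasurableSpace Ω]
    {P : Measure Ω} [IsProbabilityMeasure P] {G : Ω → V} {m : V} {σ L : ℝ} (hG : MemLp G 2 P)
    (hm : ‖m‖ ≤ L) (hv : ∫ ω, ‖G ω - m‖ ^ 2 ∂P ≤ σ ^ 2) :
    ∫ ω, ‖G ω‖ ^ 2 ∂P ≤ 2 * L ^ 2 + 2 * σ ^ 2 := by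
  have h1 : Integrable (fun ω => ‖G ω - m‖ ^ 2) P :=
    (hG.sub (memLp_const m)).integrable_norm_pow two_ne_zero
  calc _ ≤ ∫ ω, (2 * L ^ 2 + 2 * ‖G ω - m‖ ^ 2) ∂P := by
        refine integral_mono (hG.integrable_norm_pow two_ne_zero)
          ((integrable_const _).add (h1.const_mul _)) fun ω => ?_
        have h2 := norm_add_sq_le_two m (G ω - m)
        rw [add_sub_cancel] at h2
        have h3 : ‖m‖ ^ 2 ≤ L ^ 2 := pow_le_pow_left₀ (norm_nonneg _) hm 2
        simp only
        linarith
    _ = 2 * L ^ 2 + 2 * ∫ ω, ‖G ω - m‖ ^ 2 ∂P := by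
        rw [integral_add (integrable_const _) (h1.const_mul _),
          integral_const_mul 2 fun ω => ‖G ω - m‖ ^ 2]
        simp only [integral_const, probReal_univ, one_smul]
    _ ≤ _ := by linarith

section Estimator

variable [MeasurableSpace Ω] {P : Measure Ω} [IsProbabilityMeasure P] {S : DSBOSamples n Ξ Ψ Ω}

lemma isLinearOracle (hO : D.HasOracles c) (hS : S.IsIndependentSampling D P)
    (k : ℕ) (w : Fin n → JointSpace p q) :
    IsLinearOracle P (fun t i ω => D.sampleHess w (S.block k ω) t i)
      (fun t i ω => D.sampleGrad w (S.block k ω) t i) (D.meanHess w) (D.meanGrad w) c.σg2 c.σf where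
  measurable_H t i := measurable_sampleHess hO measurable_const (hS.hess k t i).measurable
  measurable_b t i := measurable_sampleGrad hO measurable_const (hS.grad k t i).measurable
  memLp_H t i := (hessYYCLM p q).comp_memLp'
    (IsUnbiasedOracle.memLp_comp (hO.hessG i) (hS.hess k t i) (w i))
  memLp_b t i := (sndJoint p q).comp_memLp'
    (IsUnbiasedOracle.memLp_comp (hO.gradF i) (hS.grad k t i) (w i))
  integral_H t i :=
    IsUnbiasedOracle.integral_clm_comp (hO.hessG i) (hS.hess k t i) (hessYYCLM p q) (w i)
  integral_b t i :=
    IsUnbiasedOracle.integral_clm_comp (hO.gradF i) (hS.grad k t i) (sndJoint p q) (w i)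
  variance_H t i := by
    refine le_trans ?_ (IsUnbiasedOracle.variance_comp_le (hO.hessG i) (hS.hess k t i) (w i))
    have h2 := (IsUnbiasedOracle.memLp_comp (hO.hessG i) (hS.hess k t i) (w i)).sub
      (memLp_const (D.hessian i (w i)))
    refine integral_mono (((hessYYCLM p q).comp_memLp' h2).integrable_norm_pow two_ne_zero)
      (h2.integrable_norm_pow two_ne_zero) fun ω => ?_
    exact pow_le_pow_left₀ (norm_nonneg _) (norm_hessYYL_le
      (D.hessG i (w i) (S.hess k t i ω) - D.hessian i (w i))) 2
  variance_b t i := by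
    refine le_trans ?_ (IsUnbiasedOracle.variance_comp_le (hO.gradF i) (hS.grad k t i) (w i))
    have h2 := (IsUnbiasedOracle.memLp_comp (hO.gradF i) (hS.grad k t i) (w i)).sub
      (memLp_const (gradient (D.f i) (w i)))
    refine integral_mono (((sndJoint p q).comp_memLp' h2).integrable_norm_pow two_ne_zero)
      (h2.integrable_norm_pow two_ne_zero) fun ω => ?_
    exact pow_le_pow_left₀ (norm_nonneg _) (norm_joint_snd_le
      (D.gradF i (w i) (S.grad k t i ω) - gradient (D.f i) (w i))) 2

lemma fresh_oracle (hO : D.HasOracles c) (hS : S.IsIndependentSampling D P) (γ : ℝ)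
    (k : ℕ) (w : Fin n → JointSpace p q) :
    IsLinearOracle.Fresh P D.W γ (fun t i ω => D.sampleHess w (S.block k ω) t i)
      (fun t i ω => D.sampleGrad w (S.block k ω) t i) := by
  intro t
  refine hS.indepFun (A := {j | ∃ s i, s < t ∧ (j = .hess k s i ∨ j = .grad k s i)})
    (B := {j | ∃ i, j = .hess k t i ∨ j = .grad k t i}) ?_ ?_ ?_
  · rw [Set.disjoint_left]
    rintro j ⟨s, i, hs, hj⟩ ⟨i', hj'⟩
    rcases hj with rfl | rfl <;> rcases hj' with h | h <;> cases h <;> exact lt_irrefl _ hs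
  · refine @measurable_higpRun_z n q Ω (S.generated _) D.W γ _ _ t (fun s _ hs i => ?_)
      (fun s hs i => ?_)
    · exact @measurable_sampleHess n p q Ξ Ψ _ _ D c Ω (S.generated _) hO _ _
        (@measurable_const _ _ _ (S.generated _) _) s i
        (DSBOSamples.measurable_hess_generated ⟨s, i, hs, Or.inl rfl⟩)
    · exact @measurable_sampleGrad n p q Ξ Ψ _ _ D c Ω (S.generated _) hO _ _
        (@measurable_const _ _ _ (S.generated _) _) s i
        (DSBOSamples.measurable_grad_generated ⟨s, i, hs, Or.inr rfl⟩)
  · refine @Measurable.prodMk _ (S.generated _) _ _ _ _ _ _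
      (@measurable_pi_lambda _ _ _ (S.generated _) _ _ fun i => ?_)
      (@measurable_pi_lambda _ _ _ (S.generated _) _ _ fun i => ?_)
    · exact @measurable_sampleHess n p q Ξ Ψ _ _ D c Ω (S.generated _) hO _ _
        (@measurable_const _ _ _ (S.generated _) _) t i
        (DSBOSamples.measurable_hess_generated ⟨i, Or.inl rfl⟩)
    · exact @measurable_sampleGrad n p q Ξ Ψ _ _ D c Ω (S.generated _) hO _ _
        (@measurable_const _ _ _ (S.generated _) _) t i
        (DSBOSamples.measurable_grad_generated ⟨i, Or.inr rfl⟩)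

end Estimator

end DSBOProblem

namespace DSBOProblem

section EstimatorMoments

variable {n p q : ℕ} {Ξ Ψ Ω : Type*} [MeasurableSpace Ξ] [MeasurableSpace Ψ] [MeasurableSpace Ω]
  {P : Measure Ω} [IsProbabilityMeasure P] {D : DSBOProblem n p q Ξ Ψ} {c : DSBOConstants}
  {S : DSBOSamples n Ξ Ψ Ω}

lemma isLinearOracle_const {W : Matrix (Fin n) (Fin n) ℝ} {γ : ℝ}
    (hm : Fin n → EuclideanSpace ℝ (Fin q) →L[ℝ] EuclideanSpace ℝ (Fin q))
    (bm : Fin n → EuclideanSpace ℝ (Fin q)) :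
    IsLinearOracle P (fun _ i _ => hm i) (fun _ i _ => bm i) hm bm 0 0 ∧
      IsLinearOracle.Fresh P W γ (fun _ i _ => hm i) (fun _ i _ => bm i) := by
  refine ⟨⟨fun _ _ => measurable_const, fun _ _ => measurable_const, fun _ _ => memLp_const _,
    fun _ _ => memLp_const _, fun _ _ => ?_, fun _ _ => ?_, fun _ _ => ?_, fun _ _ => ?_⟩,
    fun t => indepFun_const_right _ _⟩
  · simp
  · simp
  · simp
  · simp

/-- The Hessian sample of time `0` is independent of the output of the oracle. -/
lemma indepFun_output_hess_zero (hO : D.HasOracles c) (hS : S.IsIndependentSampling D P) (γ : ℝ)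
    (N k : ℕ) (w : Fin n → JointSpace p q) (i : Fin n) :
    IndepFun (fun ω => (higpRun D.W γ (fun t i ω => D.sampleHess w (S.block k ω) t i)
      (fun t i ω => D.sampleGrad w (S.block k ω) t i) N ω).z i) (S.hess k 0 i) P := by
  refine hS.indepFun (A := {j | ∃ s i, j = .hess k (s + 1) i ∨ j = .grad k s i})
    (B := {j | j = .hess k 0 i}) ?_ ?_ (DSBOSamples.measurable_hess_generated rfl)
  · rw [Set.disjoint_left]
    rintro j ⟨s, i, hj⟩ hj'
    rcases hj with rfl | rfl <;> cases hj'
  · have h := @measurable_higpRun_z n q Ω (S.generated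
      {j | ∃ s i, j = .hess k (s + 1) i ∨ j = .grad k s i}) D.W γ
      (fun t i ω => D.sampleHess w (S.block k ω) t i)
      (fun t i ω => D.sampleGrad w (S.block k ω) t i) N
      (fun s h1 _ i => @measurable_sampleHess n p q Ξ Ψ _ _ D c Ω (S.generated _) hO _ _
        (@measurable_const _ _ _ (S.generated _) _) s i
        (DSBOSamples.measurable_hess_generated ⟨s - 1, i, Or.inl (by rw [Nat.sub_add_cancel h1])⟩))
      (fun s _ i => @measurable_sampleGrad n p q Ξ Ψ _ _ D c Ω (S.generated _) hO _ _
        (@measurable_const _ _ _ (S.generated _) _) s i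
        (DSBOSamples.measurable_grad_generated ⟨s, i, Or.inr rfl⟩))
    exact (measurable_pi_apply i).comp h

lemma measurable_jacXY_sample (hO : D.HasOracles c) (w : Fin n → JointSpace p q) (i : Fin n) :
    Measurable (Function.uncurry fun (z : EuclideanSpace ℝ (Fin q)) (s : Ξ) =>
      jacXY (D.hessG i (w i) s) z) :=
  continuous_jacXY.measurable.comp (((hO.hessG i).measurable.comp
    (measurable_const.prodMk measurable_snd)).prodMk measurable_fst)

lemma memLp_jacXY_sample (hO : D.HasOracles c) (hS : S.IsIndependentSampling D P)
    (k : ℕ) (w : Fin n → JointSpace p q) (i : Fin n) (z : EuclideanSpace ℝ (Fin q)) :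
    MemLp (fun ω => jacXY (D.hessG i (w i) (S.hess k 0 i ω)) z) 2 P :=
  (jacXYCLM p q z).comp_memLp' ((hO.hessG i).memLp_comp (hS.hess k 0 i) (w i))

lemma integral_norm_jacXY_sample_sq_le (h : D.IsSmooth c) (hO : D.HasOracles c)
    (hS : S.IsIndependentSampling D P) (k : ℕ) (w : Fin n → JointSpace p q) (i : Fin n)
    (z : EuclideanSpace ℝ (Fin q)) :
    ∫ ω, ‖jacXY (D.hessG i (w i) (S.hess k 0 i ω)) z‖ ^ 2 ∂P
      ≤ (2 * c.Lg1 ^ 2 + 2 * c.σg2 ^ 2) * ‖z‖ ^ 2 := by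
  have h1 := (hO.hessG i).memLp_comp (hS.hess k 0 i) (w i)
  have h2 := integral_norm_sq_le_of_variance h1 (h.norm_hessian_le i (w i))
    ((hO.hessG i).variance_comp_le (hS.hess k 0 i) (w i))
  refine le_trans ?_ (mul_le_mul_of_nonneg_right h2 (sq_nonneg ‖z‖))
  rw [← integral_mul_const]
  refine integral_mono ((memLp_jacXY_sample hO hS k w i z).integrable_norm_pow two_ne_zero)
    ((h1.integrable_norm_pow two_ne_zero).mul_const _) fun ω => ?_
  simp only [← mul_pow]
  exact pow_le_pow_left₀ (norm_nonneg _) (norm_jacXY_le _ _) 2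

/-- Moments of the hypergradient estimates, given square integrability of the oracle output. -/
lemma estimate_moments (h : D.IsSmooth c) (hO : D.HasOracles c)
    (hS : S.IsIndependentSampling D P) (γ : ℝ) (N k : ℕ) (w : Fin n → JointSpace p q) {Z : ℝ}
    (i : Fin n)
    (hZ : ∫ ω, ‖(higpRun D.W γ (fun t i ω => D.sampleHess w (S.block k ω) t i)
      (fun t i ω => D.sampleGrad w (S.block k ω) t i) N ω).z i‖ ^ 2 ∂P ≤ Z) :
    MemLp (fun ω => D.estimate γ N w (S.block k ω) i) 2 P ∧
    ∫ ω, D.estimate γ N w (S.block k ω) i ∂P = D.meanEstimate γ N w i ∧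
    ∫ ω, ‖D.estimate γ N w (S.block k ω) i‖ ^ 2 ∂P ≤
      2 * (2 * c.Lf0 ^ 2 + 2 * c.σf ^ 2) + 2 * ((2 * c.Lg1 ^ 2 + 2 * c.σg2 ^ 2) * Z) := by
  have ho := isLinearOracle hO hS k w
  have hf := fresh_oracle hO hS γ k w
  have hz := (ho.memLp_z_d hf N).1 i
  have hzm : Measurable fun ω => (higpRun D.W γ (fun t i ω => D.sampleHess w (S.block k ω) t i)
      (fun t i ω => D.sampleGrad w (S.block k ω) t i) N ω).z i :=
    (measurable_pi_apply i).comp (ho.measurable_z N)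
  have hind := indepFun_output_hess_zero hO hS γ N k w i
  obtain ⟨hJ, hJle⟩ := memLp_fresh hzm (hS.hess k 0 i).measurable hind
    (measurable_jacXY_sample hO w i) (fun z => memLp_jacXY_sample hO hS k w i z)
    (v := fun z => (2 * c.Lg1 ^ 2 + 2 * c.σg2 ^ 2) * ‖z‖ ^ 2)
    (fun z => integral_norm_jacXY_sample_sq_le h hO hS k w i z)
    ((hz.integrable_norm_pow two_ne_zero).const_mul _)
  have hJint := integral_fresh hzm (hS.hess k 0 i).measurable hind
    (measurable_jacXY_sample hO w i).stronglyMeasurable (hJ.integrable one_le_two)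
  have hJmean : ∀ z, ∫ ω, jacXY (D.hessG i (w i) (S.hess k 0 i ω)) z ∂P =
      jacXYL (D.hessian i (w i)) z := fun z =>
    (hO.hessG i).integral_clm_comp (hS.hess k 0 i) (jacXYCLM p q z) (w i)
  simp only [hJmean] at hJint
  rw [(jacXYL (D.hessian i (w i))).integral_comp_comm (hz.integrable one_le_two),
    (ho.integral_higpRun hf N).1 i] at hJint
  have hF := (hO.gradF i).memLp_comp (hS.grad k 0 i) (w i)
  have hF1 : MemLp (fun ω => (D.gradF i (w i) (S.grad k 0 i ω)).fst) 2 P :=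
    (fstJoint p q).comp_memLp' hF
  have hF2 : ∫ ω, (D.gradF i (w i) (S.grad k 0 i ω)).fst ∂P = (gradient (D.f i) (w i)).fst :=
    (hO.gradF i).integral_clm_comp (hS.grad k 0 i) (fstJoint p q) (w i)
  have hF3 : ∫ ω, ‖(D.gradF i (w i) (S.grad k 0 i ω)).fst‖ ^ 2 ∂P ≤
      2 * c.Lf0 ^ 2 + 2 * c.σf ^ 2 := by
    refine le_trans ?_ (integral_norm_sq_le_of_variance hF (h.norm_gradient_f_le i (w i))
      ((hO.gradF i).variance_comp_le (hS.grad k 0 i) (w i)))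
    exact integral_mono (hF1.integrable_norm_pow two_ne_zero)
      (hF.integrable_norm_pow two_ne_zero) fun ω =>
        pow_le_pow_left₀ (norm_nonneg _) (norm_joint_fst_le _) 2
  refine ⟨hF1.sub hJ, ?_, ?_⟩
  · refine (integral_sub (hF1.integrable one_le_two) (hJ.integrable one_le_two)).trans ?_
    rw [hF2, hJint]; rfl
  · have i1 := (hF1.integrable_norm_pow two_ne_zero).const_mul 2
    have i2 := (hJ.integrable_norm_pow two_ne_zero).const_mul 2
    refine (integral_mono ((hF1.sub hJ).integrable_norm_pow two_ne_zero) (i1.add i2)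
      fun ω => norm_sub_sq_le_two _ _).trans ?_
    refine (integral_add i1 i2).trans_le ?_
    rw [integral_const_mul, integral_const_mul]
    refine add_le_add (by linarith) (mul_le_mul_of_nonneg_left (hJle.trans ?_) zero_le_two)
    rw [integral_const_mul]
    exact mul_le_mul_of_nonneg_left hZ (by positivity)

end EstimatorMoments

/-- The hypergradient estimator: for step sizes `γ` in an interval depending only on the constants
of the problem class, its second moment is bounded and its bias decays linearly in `N`. -/
lemma exists_estimator_bound {n : ℕ} (hn : 0 < n) (c : DSBOConstants) :
    ∃ c₁ c₂ : ℝ, 0 < c₁ ∧ c₁ < c₂ ∧ ∀ γ ∈ Set.Ioo c₁ c₂, ∃ θ U B : ℝ, 0 < θ ∧ θ < 1 ∧ 0 < U ∧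
      0 < B ∧ ∀ {p q : ℕ} {Ξ Ψ Ω : Type*} [MeasurableSpace Ξ] [MeasurableSpace Ψ]
        [MeasurableSpace Ω] {P : Measure Ω} [IsProbabilityMeasure P] {D : DSBOProblem n p q Ξ Ψ}
        {S : DSBOSamples n Ξ Ψ Ω}, D.IsSmooth c → D.IsMixing c → D.HasOracles c →
        S.IsIndependentSampling D P → ∀ (N k : ℕ) (w : Fin n → JointSpace p q),
        (∀ i, MemLp (fun ω => D.estimate γ N w (S.block k ω) i) 2 P) ∧
        (∀ i, ∫ ω, D.estimate γ N w (S.block k ω) i ∂P = D.meanEstimate γ N w i) ∧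
        (∀ i, ∫ ω, ‖D.estimate γ N w (S.block k ω) i‖ ^ 2 ∂P ≤ U) ∧
        ‖agentAvg (D.meanEstimate γ N w) - D.hyp w‖ ^ 2 ≤ B * θ ^ N := by
  set ρ := max c.ρ (1 / 2) with hρ
  have hρ0 : 0 < ρ := lt_of_lt_of_le (by norm_num) (le_max_right _ _)
  have hρ1 : ρ < 1 := max_lt c.ρ_lt_one (by norm_num)
  obtain ⟨γ₀, M, hγ₀, hM, key⟩ := exists_higp_bound hn (L := c.Lg1) c.σg2 c.μg_pos hρ0 hρ1
  refine ⟨γ₀ / 2, γ₀, by positivity, by linarith, fun γ hγ => ?_⟩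
  obtain ⟨⟨hθ0, hθ1⟩, key⟩ := key γ (by linarith [hγ.1]) hγ.2
  have hLf := c.Lf0_pos
  have hLg := c.Lg1_pos
  set θ := 1 - γ * c.μg / 4 with hθ
  set X := c.zBound ^ 2 + n * (2 * c.Lf0 ^ 2 + 2 * c.σf ^ 2) with hX
  set τ := noiseLevel n c.σg2 c.σf c.zBound with hτ
  have hX0 : 0 < X := by positivity
  have hτ0 : 0 ≤ τ := noiseLevel_nonneg _ _ _ _
  set Z := 2 * (M * (X + τ)) + 2 * c.zBound ^ 2 with hZ
  have hZ0 : 0 ≤ Z := by positivity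
  refine ⟨θ, 2 * (2 * c.Lf0 ^ 2 + 2 * c.σf ^ 2) + 2 * ((2 * c.Lg1 ^ 2 + 2 * c.σg2 ^ 2) * Z),
    c.Lg1 ^ 2 * (M * X), hθ0, hθ1, by positivity, by positivity, ?_⟩
  intro p q Ξ Ψ Ω _ _ _ P _ D S h hmix hO hS N k w
  have hW := hmix.isGossip hn
  have hL : ∀ i, ‖D.meanHess w i‖ ≤ c.Lg1 := fun i =>
    (norm_hessYYL_le _).trans (h.norm_hessian_le i (w i))
  have hco : ∀ v, c.μg * ‖v‖ ^ 2 ≤ inner ℝ (agentAvg fun i => D.meanHess w i v) v := fun v => by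
    have := h.hbar_coercive hn w v
    rw [hbar_apply] at this
    exact this
  have hzs : (agentAvg fun i => D.meanHess w i (D.zsol w)) = agentAvg (D.meanGrad w) := by
    have := h.hbar_zsol hn w
    rw [hbar_apply] at this
    exact this
  have hzn := h.norm_zsol_le hn w
  have hzn2 : ‖D.zsol w‖ ^ 2 ≤ c.zBound ^ 2 := pow_le_pow_left₀ (norm_nonneg _) hzn 2
  have hzX : ‖D.zsol w‖ ^ 2 ≤ X := hzn2.trans (by
    rw [hX]; linarith [show 0 ≤ (n : ℝ) * (2 * c.Lf0 ^ 2 + 2 * c.σf ^ 2) by positivity])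
  have hgn : ∀ i, ‖D.meanGrad w i‖ ≤ c.Lf0 := fun i =>
    (norm_joint_snd_le _).trans (h.norm_gradient_f_le i _)
  have hθN : θ ^ N ≤ 1 := pow_le_one₀ hθ0.le hθ1.le
  -- the noisy run gives the second moment
  have ho := isLinearOracle hO hS k w
  have hf := fresh_oracle hO hS γ k w
  have hrun := key hW hL hco hzs le_rfl ho hf X hzX (by
    rw [integral_sqNorm fun i => ho.memLp_b 0 i]
    refine (Finset.sum_le_sum fun i _ => integral_norm_sq_le_of_variance (ho.memLp_b 0 i) (hgn i)
      (ho.variance_b 0 i)).trans ?_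
    simp only [Finset.sum_const, Finset.card_univ, Fintype.card_fin, nsmul_eq_mul]
    rw [hX]; linarith [sq_nonneg c.zBound]) N
  have hzL := (ho.memLp_z_d hf N).1
  have hzi : ∀ i, ∫ ω, ‖(higpRun D.W γ (fun t i ω => D.sampleHess w (S.block k ω) t i)
      (fun t i ω => D.sampleGrad w (S.block k ω) t i) N ω).z i‖ ^ 2 ∂P ≤ Z := by
    intro i
    have i1 := integrable_sqNorm fun i => (hzL i).sub (memLp_const (D.zsol w))
    have i2 := (i1.const_mul 2).fun_add (integrable_const (2 * c.zBound ^ 2))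
    refine (integral_mono ((hzL i).integrable_norm_pow two_ne_zero) i2 fun ω => ?_).trans ?_
    · set z := (higpRun D.W γ (fun t i ω => D.sampleHess w (S.block k ω) t i)
        (fun t i ω => D.sampleGrad w (S.block k ω) t i) N ω).z
      have h1 := norm_add_sq_le_two (z i - D.zsol w) (D.zsol w)
      rw [sub_add_cancel] at h1
      have h2 := norm_sq_le_sqNorm (fun i => z i - D.zsol w) i
      change ‖z i‖ ^ 2 ≤ 2 * sqNorm (fun i => z i - D.zsol w) + 2 * c.zBound ^ 2
      linarith
    · rw [integral_add (i1.const_mul 2) (integrable_const _), integral_const_mul]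
      simp only [integral_const, probReal_univ, one_smul]
      refine add_le_add (mul_le_mul_of_nonneg_left (hrun.trans ?_) zero_le_two) le_rfl
      have h3 : noiseLevel n c.σg2 c.σf ‖D.zsol w‖ ≤ τ := by
        rw [hτ, noiseLevel, noiseLevel]
        gcongr
      have h4 : θ ^ N * X ≤ X := mul_le_of_le_one_left hX0.le hθN
      exact mul_le_mul_of_nonneg_left (add_le_add h4 h3) hM.le
  have hmom := fun i => estimate_moments h hO hS γ N k w i (hzi i)
  refine ⟨fun i => (hmom i).1, fun i => (hmom i).2.1, fun i => (hmom i).2.2, ?_⟩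
  -- the noiseless run gives the bias
  obtain ⟨hoc, hfc⟩ := isLinearOracle_const (P := P) (W := D.W) (γ := γ) (D.meanHess w)
    (D.meanGrad w)
  have hdet := key hW hL hco hzs (by simpa using sq_nonneg c.σg2) hoc hfc X hzX (by
    simp only [integral_const, probReal_univ, one_smul]
    refine (Finset.sum_le_sum (g := fun _ => 2 * (c.Lf0 : ℝ) ^ 2 + 2 * c.σf ^ 2)
      fun i _ => ?_).trans ?_
    · have := pow_le_pow_left₀ (norm_nonneg _) (hgn i) 2
      nlinarith [sq_nonneg c.σf, sq_nonneg (c.Lf0 : ℝ)]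
    · simp only [Finset.sum_const, Finset.card_univ, Fintype.card_fin, nsmul_eq_mul]
      rw [hX]; linarith [sq_nonneg c.zBound]) N
  have hnl : noiseLevel n 0 0 ‖D.zsol w‖ = 0 := by simp [noiseLevel]
  rw [hnl, add_zero] at hdet
  set zd := (higp D.W γ (fun _ i => D.meanHess w i) (fun _ => D.meanGrad w) N).z with hzd
  have hdet' : sqNorm (fun i => zd i - D.zsol w) ≤ M * (θ ^ N * X) := by
    have h1 : ∫ _ : Ω, sqNorm (fun i => zd i - D.zsol w) ∂P ≤ M * (θ ^ N * X) := hdet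
    simpa only [integral_const, probReal_univ, one_smul] using h1
  have e : agentAvg (D.meanEstimate γ N w) - D.hyp w =
      agentAvg fun i => - jacXY (D.hessian i (w i)) (zd i - D.zsol w) := by
    rw [hyp, ← agentAvg_sub]
    congr 1
    funext i
    rw [meanEstimate, jacXY_vec_sub]; abel
  rw [e]
  refine (norm_agentAvg_sq_le' hn _).trans ?_
  refine (sqNorm_le_mul_of_forall (L := c.Lg1) (w := fun i => zd i - D.zsol w) fun i => ?_).trans ?_
  · rw [norm_neg]
    exact h.norm_jacXY_hessian_le i _ _
  · calc _ ≤ (c.Lg1 : ℝ) ^ 2 * (M * (θ ^ N * X)) := by gcongr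
      _ = _ := by ring

end DSBOProblem

/-! ### The run of the algorithm: measurability, independence, square integrability -/

namespace DSBOProblem

variable {n p q : ℕ} {Ξ Ψ Ω : Type*} [MeasurableSpace Ξ] [MeasurableSpace Ψ]

/-- The state at outer iteration `k`, for constant step sizes. -/
def run (D : DSBOProblem n p q Ξ Ψ) (S : DSBOSamples n Ξ Ψ Ω) (α β γ : ℝ) (T N k : ℕ) (ω : Ω) :
    MADSBOState n p q :=
  D.maDSBO S (fun _ => α) (fun _ => β) γ T N ω k

/-- The inner iterates `y_{i,k}^{(t)}`. -/
def runInner (D : DSBOProblem n p q Ξ Ψ) (S : DSBOSamples n Ξ Ψ Ω) (α β γ : ℝ) (T N k t : ℕ)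
    (ω : Ω) : Fin n → EuclideanSpace ℝ (Fin q) :=
  innerLoop D.W β (fun t i y =>
    (D.gradG i (joint ((D.run S α β γ T N k ω).x i) y) (S.lower k t i ω)).snd)
    (D.run S α β γ T N k ω).y t

/-- The points `(x_i, y_i)` of the agents. -/
def points (x : Fin n → EuclideanSpace ℝ (Fin p)) (y : Fin n → EuclideanSpace ℝ (Fin q)) :
    Fin n → JointSpace p q :=
  fun i => joint (x i) (y i)

lemma measurable_points {α : Type*} [MeasurableSpace α]
    {x : α → Fin n → EuclideanSpace ℝ (Fin p)} {y : α → Fin n → EuclideanSpace ℝ (Fin q)}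
    (hx : Measurable x) (hy : Measurable y) : Measurable fun a => points (x a) (y a) :=
  measurable_pi_lambda _ fun i => continuous_joint.measurable.comp
    (((measurable_pi_apply i).comp hx).prodMk ((measurable_pi_apply i).comp hy))

variable {D : DSBOProblem n p q Ξ Ψ} {S : DSBOSamples n Ξ Ψ Ω} {α β γ : ℝ} {T N : ℕ}
  {c : DSBOConstants}

lemma run_zero (ω : Ω) : D.run S α β γ T N 0 ω = { x := 0, r := 0, y := 0 } := rfl

lemma run_x_succ (k : ℕ) (ω : Ω) : (D.run S α β γ T N (k + 1) ω).x =
    fun i => mix D.W (D.run S α β γ T N k ω).x i - α • (D.run S α β γ T N k ω).r i := rfl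

lemma run_y_succ (k : ℕ) (ω : Ω) :
    (D.run S α β γ T N (k + 1) ω).y = D.runInner S α β γ T N k T ω := rfl

lemma run_r_succ (k : ℕ) (ω : Ω) : (D.run S α β γ T N (k + 1) ω).r =
    fun i => (1 - α) • (D.run S α β γ T N k ω).r i + α • D.estimate γ N
      (points (D.run S α β γ T N k ω).x (D.runInner S α β γ T N k T ω)) (S.block k ω) i := rfl

lemma runInner_zero (k : ℕ) (ω : Ω) :
    D.runInner S α β γ T N k 0 ω = (D.run S α β γ T N k ω).y := rfl

lemma runInner_succ (k t : ℕ) (ω : Ω) : D.runInner S α β γ T N k (t + 1) ω =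
    fun i => mix D.W (D.runInner S α β γ T N k t ω) i - β • (D.gradG i
      (points (D.run S α β γ T N k ω).x (D.runInner S α β γ T N k t ω) i) (S.lower k t i ω)).snd :=
  rfl

section Measurability

variable [MeasurableSpace Ω]

lemma measurable_runInner (hO : D.HasOracles c) {k t : ℕ}
    (hx : Measurable fun ω => (D.run S α β γ T N k ω).x)
    (hy : Measurable fun ω => (D.run S α β γ T N k ω).y)
    (hl : ∀ s i, s < t → Measurable (S.lower k s i)) :
    Measurable (D.runInner S α β γ T N k t) := by
  induction t with
  | zero => exact hy
  | succ t ih =>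
    have ih := ih fun s i hs => hl s i (by lia)
    refine measurable_pi_lambda _ fun i => ?_
    have h1 : Measurable fun ω => mix D.W (D.runInner S α β γ T N k t ω) i :=
      (measurable_pi_apply i).comp (measurable_mix D.W ih)
    have h2 : Measurable fun ω => (D.gradG i (points (D.run S α β γ T N k ω).x
        (D.runInner S α β γ T N k t ω) i) (S.lower k t i ω)).snd :=
      (sndJoint p q).continuous.measurable.comp ((hO.gradG i).measurable.comp
        (((measurable_pi_apply i).comp (measurable_points hx ih)).prodMk (hl t i (by lia))))
    exact h1.sub (h2.const_smul β)

lemma measurable_run (hO : D.HasOracles c) {k : ℕ}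
    (hl : ∀ k' s i, k' < k → Measurable (S.lower k' s i))
    (hh : ∀ k' s i, k' < k → Measurable (S.hess k' s i))
    (hg : ∀ k' s i, k' < k → Measurable (S.grad k' s i)) :
    Measurable (fun ω => (D.run S α β γ T N k ω).x) ∧
    Measurable (fun ω => (D.run S α β γ T N k ω).r) ∧
    Measurable (fun ω => (D.run S α β γ T N k ω).y) := by
  induction k with
  | zero => exact ⟨measurable_const, measurable_const, measurable_const⟩
  | succ k ih =>
    obtain ⟨hx, hr, hy⟩ := ih (fun k' s i h => hl k' s i (by lia))
      (fun k' s i h => hh k' s i (by lia)) (fun k' s i h => hg k' s i (by lia))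
    have hin : Measurable (D.runInner S α β γ T N k T) :=
      measurable_runInner hO hx hy fun s i _ => hl k s i (by lia)
    refine ⟨(measurable_mix D.W hx).sub (hr.const_smul α), ?_, hin⟩
    have hu : Measurable fun ω => D.estimate γ N (points (D.run S α β γ T N k ω).x
        (D.runInner S α β γ T N k T ω)) (S.block k ω) :=
      measurable_estimate hO γ N (measurable_points hx hin) (fun t i => hh k t i (by lia))
        fun t i => hg k t i (by lia)
    exact (hr.const_smul (1 - α)).add (hu.const_smul α)

end Measurability

/-- The samples drawn before inner step `t` of outer iteration `k`. -/
def pastIndex (n k t : ℕ) : Set (SampleIndex n) :=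
  {j | (∃ k' s i, (k' < k ∨ k' = k ∧ s < t) ∧ j = .lower k' s i) ∨
    ∃ k' s i, k' < k ∧ (j = .hess k' s i ∨ j = .grad k' s i)}

lemma measurable_run_past (hO : D.HasOracles c) (k t : ℕ) :
    Measurable[S.generated (pastIndex n k t)] (fun ω => (D.run S α β γ T N k ω).x) ∧
    Measurable[S.generated (pastIndex n k t)] (fun ω => (D.run S α β γ T N k ω).r) ∧
    Measurable[S.generated (pastIndex n k t)] (D.runInner S α β γ T N k t) := by
  have h := @measurable_run n p q Ξ Ψ Ω _ _ D S α β γ T N c (S.generated (pastIndex n k t)) hO k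
    (fun k' s i hk => DSBOSamples.measurable_lower_generated
      (Or.inl ⟨k', s, i, Or.inl hk, rfl⟩))
    (fun k' s i hk => DSBOSamples.measurable_hess_generated (Or.inr ⟨k', s, i, hk, Or.inl rfl⟩))
    (fun k' s i hk => DSBOSamples.measurable_grad_generated (Or.inr ⟨k', s, i, hk, Or.inr rfl⟩))
  exact ⟨h.1, h.2.1, @measurable_runInner n p q Ξ Ψ Ω _ _ D S α β γ T N c
    (S.generated (pastIndex n k t)) hO k t h.1 h.2.2 fun s i hs =>
      DSBOSamples.measurable_lower_generated (Or.inl ⟨k, s, i, Or.inr ⟨rfl, hs⟩, rfl⟩)⟩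

variable [MeasurableSpace Ω] {P : Measure Ω}

/-- The samples of inner step `t` are independent of the iterates they are applied to. -/
lemma indepFun_lower (hO : D.HasOracles c) (hS : S.IsIndependentSampling D P) (k t : ℕ) :
    IndepFun (fun ω => ((D.run S α β γ T N k ω).x, D.runInner S α β γ T N k t ω))
      (fun ω i => S.lower k t i ω) P := by
  obtain ⟨hx, -, hy⟩ := measurable_run_past (S := S) (α := α) (β := β) (γ := γ) (T := T) (N := N)
    hO k t
  refine hS.indepFun (A := pastIndex n k t) (B := {j | ∃ i, j = .lower k t i}) ?_
    (hx.prodMk hy) (@measurable_pi_lambda _ _ _ (S.generated _) _ _ fun i =>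
      DSBOSamples.measurable_lower_generated ⟨i, rfl⟩)
  rw [Set.disjoint_left]
  rintro j hj ⟨i, rfl⟩
  rcases hj with ⟨k', s, i', h, hj⟩ | ⟨k', s, i', h, hj | hj⟩
  · cases hj; lia
  · cases hj
  · cases hj

/-- The samples of the hypergradient estimation are independent of the current iterates. -/
lemma indepFun_block (hO : D.HasOracles c) (hS : S.IsIndependentSampling D P) (k : ℕ) :
    IndepFun (fun ω => ((D.run S α β γ T N k ω).x, (D.run S α β γ T N k ω).r,
      D.runInner S α β γ T N k T ω)) (S.block k) P := by
  obtain ⟨hx, hr, hy⟩ := measurable_run_past (S := S) (α := α) (β := β) (γ := γ) (T := T) (N := N)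
    hO k T
  refine hS.indepFun (A := pastIndex n k T)
    (B := {j | ∃ t i, j = .hess k t i ∨ j = .grad k t i}) ?_
    (hx.prodMk (hr.prodMk hy)) ?_
  · rw [Set.disjoint_left]
    rintro j hj ⟨t, i, hj' | hj'⟩
    all_goals
      subst hj'
      rcases hj with ⟨k', s, i', h, hj⟩ | ⟨k', s, i', h, hj | hj⟩ <;> cases hj
      exact lt_irrefl _ h
  · refine @Measurable.prodMk _ (S.generated _) _ _ _ _ _ _
      (@measurable_pi_lambda _ _ _ (S.generated _) _ _ fun t =>
        @measurable_pi_lambda _ _ _ (S.generated _) _ _ fun i => ?_)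
      (@measurable_pi_lambda _ _ _ (S.generated _) _ _ fun t =>
        @measurable_pi_lambda _ _ _ (S.generated _) _ _ fun i => ?_)
    · exact DSBOSamples.measurable_hess_generated ⟨t, i, Or.inl rfl⟩
    · exact DSBOSamples.measurable_grad_generated ⟨t, i, Or.inr rfl⟩

lemma measurable_run' (hO : D.HasOracles c) (hS : S.IsIndependentSampling D P) (k : ℕ) :
    Measurable (fun ω => (D.run S α β γ T N k ω).x) ∧
    Measurable (fun ω => (D.run S α β γ T N k ω).r) ∧
    Measurable (fun ω => (D.run S α β γ T N k ω).y) :=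
  measurable_run hO (fun k' s i _ => (hS.lower k' s i).measurable)
    (fun k' s i _ => (hS.hess k' s i).measurable) fun k' s i _ => (hS.grad k' s i).measurable

lemma measurable_runInner' (hO : D.HasOracles c) (hS : S.IsIndependentSampling D P) (k t : ℕ) :
    Measurable (D.runInner S α β γ T N k t) :=
  measurable_runInner hO (measurable_run' hO hS k).1 (measurable_run' hO hS k).2.2
    fun s i _ => (hS.lower k s i).measurable

lemma measurable_block (hS : S.IsIndependentSampling D P) (k : ℕ) : Measurable (S.block k) :=
  (measurable_pi_lambda _ fun t => measurable_pi_lambda _ fun i => (hS.hess k t i).measurable).prodMk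
    (measurable_pi_lambda _ fun t => measurable_pi_lambda _ fun i => (hS.grad k t i).measurable)

lemma measurable_lowerSample (hS : S.IsIndependentSampling D P) (k t : ℕ) :
    Measurable fun ω i => S.lower k t i ω :=
  measurable_pi_lambda _ fun i => (hS.lower k t i).measurable

/-- The hypergradient estimates have bounded second moments and small bias `b`. -/
structure IsGoodEstimator (D : DSBOProblem n p q Ξ Ψ) (S : DSBOSamples n Ξ Ψ Ω) (P : Measure Ω)
    (γ : ℝ) (N : ℕ) (U b : ℝ) : Prop where
  memLp : ∀ k w i, MemLp (fun ω => D.estimate γ N w (S.block k ω) i) 2 P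
  mean : ∀ k w i, ∫ ω, D.estimate γ N w (S.block k ω) i ∂P = D.meanEstimate γ N w i
  second_moment : ∀ k w i, ∫ ω, ‖D.estimate γ N w (S.block k ω) i‖ ^ 2 ∂P ≤ U
  bias : ∀ w, ‖agentAvg (D.meanEstimate γ N w) - D.hyp w‖ ^ 2 ≤ b

/-- The noise of the stochastic gradients of an inner step. -/
def lowerNoise (D : DSBOProblem n p q Ξ Ψ)
    (X : (Fin n → EuclideanSpace ℝ (Fin p)) × (Fin n → EuclideanSpace ℝ (Fin q))) (ξ : Fin n → Ξ)
    (i : Fin n) : EuclideanSpace ℝ (Fin q) :=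
  (D.gradG i (points X.1 X.2 i) (ξ i)).snd - (gradient (D.g i) (points X.1 X.2 i)).snd

lemma IsSmooth.continuous_gradient_g (h : D.IsSmooth c) (i : Fin n) :
    Continuous (gradient (D.g i)) := (h.lipschitz_gradient_g i).continuous

lemma measurable_lowerNoise (h : D.IsSmooth c) (hO : D.HasOracles c) :
    Measurable (Function.uncurry D.lowerNoise) := by
  refine measurable_pi_lambda _ fun i => ?_
  have hp : Measurable fun z : ((Fin n → EuclideanSpace ℝ (Fin p)) ×
      (Fin n → EuclideanSpace ℝ (Fin q))) × (Fin n → Ξ) => points z.1.1 z.1.2 i :=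
    (measurable_pi_apply i).comp (measurable_points (measurable_fst.comp measurable_fst)
      (measurable_snd.comp measurable_fst))
  exact ((sndJoint p q).continuous.measurable.comp ((hO.gradG i).measurable.comp
    (hp.prodMk ((measurable_pi_apply i).comp measurable_snd)))).sub
      ((sndJoint p q).continuous.measurable.comp ((h.continuous_gradient_g i).measurable.comp hp))

variable [IsProbabilityMeasure P]

lemma memLp_lowerNoise (hO : D.HasOracles c) (hS : S.IsIndependentSampling D P) (k t : ℕ)
    (X : (Fin n → EuclideanSpace ℝ (Fin p)) × (Fin n → EuclideanSpace ℝ (Fin q))) (i : Fin n) :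
    MemLp (fun ω => D.lowerNoise X (fun i => S.lower k t i ω) i) 2 P :=
  ((sndJoint p q).comp_memLp' ((hO.gradG i).memLp_comp (hS.lower k t i) _)).sub (memLp_const _)

lemma integral_lowerNoise (hO : D.HasOracles c) (hS : S.IsIndependentSampling D P) (k t : ℕ)
    (X : (Fin n → EuclideanSpace ℝ (Fin p)) × (Fin n → EuclideanSpace ℝ (Fin q))) (i : Fin n) :
    ∫ ω, D.lowerNoise X (fun i => S.lower k t i ω) i ∂P = 0 := by
  have h1 := ((sndJoint p q).comp_memLp' ((hO.gradG i).memLp_comp (hS.lower k t i)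
    (points X.1 X.2 i))).integrable one_le_two
  refine (integral_sub h1 (integrable_const _)).trans ?_
  have h2 := (hO.gradG i).integral_clm_comp (hS.lower k t i) (sndJoint p q) (points X.1 X.2 i)
  rw [integral_const, probReal_univ, one_smul]
  exact sub_eq_zero.2 h2

lemma integral_norm_lowerNoise_sq_le (hO : D.HasOracles c) (hS : S.IsIndependentSampling D P)
    (k t : ℕ) (X : (Fin n → EuclideanSpace ℝ (Fin p)) × (Fin n → EuclideanSpace ℝ (Fin q)))
    (i : Fin n) :
    ∫ ω, ‖D.lowerNoise X (fun i => S.lower k t i ω) i‖ ^ 2 ∂P ≤ c.σg1 ^ 2 := by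
  refine le_trans ?_ ((hO.gradG i).variance_comp_le (hS.lower k t i) (points X.1 X.2 i))
  have h1 := ((hO.gradG i).memLp_comp (hS.lower k t i) (points X.1 X.2 i)).sub
    (memLp_const (gradient (D.g i) (points X.1 X.2 i)))
  exact integral_mono ((memLp_lowerNoise hO hS k t X i).integrable_norm_pow two_ne_zero)
    (h1.integrable_norm_pow two_ne_zero) fun ω =>
      pow_le_pow_left₀ (norm_nonneg _) (norm_joint_snd_le (D.gradG i (points X.1 X.2 i)
        (S.lower k t i ω) - gradient (D.g i) (points X.1 X.2 i))) 2

lemma memLp_runNoise (h : D.IsSmooth c) (hO : D.HasOracles c) (hS : S.IsIndependentSampling D P)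
    (k t : ℕ) (i : Fin n) :
    MemLp (fun ω => D.lowerNoise ((D.run S α β γ T N k ω).x, D.runInner S α β γ T N k t ω)
      (fun i => S.lower k t i ω) i) 2 P ∧
    ∫ ω, ‖D.lowerNoise ((D.run S α β γ T N k ω).x, D.runInner S α β γ T N k t ω)
      (fun i => S.lower k t i ω) i‖ ^ 2 ∂P ≤ c.σg1 ^ 2 := by
  have h1 := memLp_fresh ((measurable_run' hO hS k).1.prodMk (measurable_runInner' hO hS k t))
    (measurable_lowerSample hS k t)
    (indepFun_lower (α := α) (β := β) (γ := γ) (T := T) (N := N) hO hS k t)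
    (G := fun X ξ => D.lowerNoise X ξ i)
    ((measurable_pi_apply i).comp (measurable_lowerNoise h hO))
    (v := fun _ => c.σg1 ^ 2)
    (fun X => memLp_lowerNoise hO hS k t X i)
    (fun X => integral_norm_lowerNoise_sq_le hO hS k t X i) (integrable_const _)
  simpa using h1

lemma memLp_joint {x : Ω → EuclideanSpace ℝ (Fin p)} {y : Ω → EuclideanSpace ℝ (Fin q)}
    (hx : MemLp x 2 P) (hy : MemLp y 2 P) :
    MemLp (fun ω => (joint (x ω) (y ω) : JointSpace p q)) 2 P := by
  refine (hx.norm.add hy.norm).mono' (continuous_joint.comp_aestronglyMeasurable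
    (hx.aestronglyMeasurable.prodMk hy.aestronglyMeasurable)) (ae_of_all _ fun ω => ?_)
  exact norm_joint_le _ _

lemma IsSmooth.memLp_gradient_g (h : D.IsSmooth c) {z : Ω → JointSpace p q} (hz : MemLp z 2 P)
    (i : Fin n) : MemLp (fun ω => gradient (D.g i) (z ω)) 2 P := by
  refine ((memLp_const ‖gradient (D.g i) 0‖).add (hz.norm.const_mul c.Lg1)).mono'
    ((h.continuous_gradient_g i).comp_aestronglyMeasurable hz.aestronglyMeasurable)
    (ae_of_all _ fun ω => ?_)
  have h1 := h.norm_gradient_g_sub_le i (z ω) 0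
  rw [sub_zero] at h1
  have h2 := norm_add_le (gradient (D.g i) 0) (gradient (D.g i) (z ω) - gradient (D.g i) 0)
  rw [add_sub_cancel] at h2
  exact h2.trans (add_le_add le_rfl h1)

/-- The gradients of an inner step, without noise. -/
def lowerGrad (D : DSBOProblem n p q Ξ Ψ) (w : Fin n → JointSpace p q) (i : Fin n) :
    EuclideanSpace ℝ (Fin q) :=
  (gradient (D.g i) (w i)).snd

lemma runInner_succ_eq (k t : ℕ) (ω : Ω) : D.runInner S α β γ T N k (t + 1) ω = fun i =>
    mix D.W (D.runInner S α β γ T N k t ω) i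
      - β • (D.lowerGrad (points (D.run S α β γ T N k ω).x (D.runInner S α β γ T N k t ω)) i
        + D.lowerNoise ((D.run S α β γ T N k ω).x, D.runInner S α β γ T N k t ω)
          (fun i => S.lower k t i ω) i) := by
  funext i
  rw [runInner_succ, lowerGrad, lowerNoise, add_sub_cancel]

lemma memLp_lowerGrad (h : D.IsSmooth c) {x : Ω → Fin n → EuclideanSpace ℝ (Fin p)}
    {y : Ω → Fin n → EuclideanSpace ℝ (Fin q)} (hx : ∀ i, MemLp (fun ω => x ω i) 2 P)
    (hy : ∀ i, MemLp (fun ω => y ω i) 2 P) (i : Fin n) :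
    MemLp (fun ω => D.lowerGrad (points (x ω) (y ω)) i) 2 P :=
  (sndJoint p q).comp_memLp' (h.memLp_gradient_g (memLp_joint (hx i) (hy i)) i)

lemma memLp_runInner (h : D.IsSmooth c) (hO : D.HasOracles c) (hS : S.IsIndependentSampling D P)
    {k : ℕ} (hx : ∀ i, MemLp (fun ω => (D.run S α β γ T N k ω).x i) 2 P)
    (hy : ∀ i, MemLp (fun ω => (D.run S α β γ T N k ω).y i) 2 P) (t : ℕ) (i : Fin n) :
    MemLp (fun ω => D.runInner S α β γ T N k t ω i) 2 P := by
  induction t generalizing i with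
  | zero => exact hy i
  | succ t ih =>
    simp only [runInner_succ_eq]
    exact (memLp_mix D.W ih i).sub (((memLp_lowerGrad h hx ih i).add
      (memLp_runNoise h hO hS k t i).1).const_smul β)

variable {U b : ℝ}

/-- Second moment of the hypergradient estimates along the run. -/
lemma memLp_runEstimate (hO : D.HasOracles c) (hS : S.IsIndependentSampling D P)
    (hE : D.IsGoodEstimator S P γ N U b) (k : ℕ) (i : Fin n) :
    MemLp (fun ω => D.estimate γ N (points (D.run S α β γ T N k ω).x
      (D.runInner S α β γ T N k T ω)) (S.block k ω) i) 2 P ∧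
    ∫ ω, ‖D.estimate γ N (points (D.run S α β γ T N k ω).x
      (D.runInner S α β γ T N k T ω)) (S.block k ω) i‖ ^ 2 ∂P ≤ U := by
  have hm : Measurable (Function.uncurry fun (X : (Fin n → EuclideanSpace ℝ (Fin p)) ×
      (Fin n → EuclideanSpace ℝ (Fin p)) × (Fin n → EuclideanSpace ℝ (Fin q)))
      (B : (ℕ → Fin n → Ξ) × (ℕ → Fin n → Ψ)) => D.estimate γ N (points X.1 X.2.2) B i) :=
    (measurable_pi_apply i).comp (measurable_estimate hO γ N
      (measurable_points (measurable_fst.comp measurable_fst)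
        (measurable_snd.comp (measurable_snd.comp measurable_fst)))
      (fun t j => (measurable_pi_apply j).comp ((measurable_pi_apply t).comp
        (measurable_fst.comp measurable_snd)))
      (fun t j => (measurable_pi_apply j).comp ((measurable_pi_apply t).comp
        (measurable_snd.comp measurable_snd))))
  have h1 := memLp_fresh ((measurable_run' hO hS k).1.prodMk
    ((measurable_run' hO hS k).2.1.prodMk (measurable_runInner' hO hS k T)))
    (measurable_block hS k)
    (indepFun_block (α := α) (β := β) (γ := γ) (T := T) (N := N) hO hS k) hm
    (v := fun _ => U) (fun X => hE.memLp k _ i) (fun X => hE.second_moment k _ i)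
    (integrable_const _)
  simpa using h1

lemma memLp_run (h : D.IsSmooth c) (hO : D.HasOracles c) (hS : S.IsIndependentSampling D P)
    (hE : D.IsGoodEstimator S P γ N U b) (k : ℕ) :
    (∀ i, MemLp (fun ω => (D.run S α β γ T N k ω).x i) 2 P) ∧
    (∀ i, MemLp (fun ω => (D.run S α β γ T N k ω).r i) 2 P) ∧
    (∀ i, MemLp (fun ω => (D.run S α β γ T N k ω).y i) 2 P) := by
  induction k with
  | zero => exact ⟨fun i => memLp_const 0, fun i => memLp_const 0, fun i => memLp_const 0⟩
  | succ k ih =>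
    obtain ⟨hx, hr, hy⟩ := ih
    refine ⟨fun i => ?_, fun i => ?_, fun i => ?_⟩
    · exact (memLp_mix D.W hx i).sub ((hr i).const_smul α)
    · exact ((hr i).const_smul (1 - α)).add
        ((memLp_runEstimate hO hS hE k i).1.const_smul α)
    · exact memLp_runInner h hO hS hx hy T i

lemma memLp_inner (h : D.IsSmooth c) (hO : D.HasOracles c) (hS : S.IsIndependentSampling D P)
    (hE : D.IsGoodEstimator S P γ N U b) (k t : ℕ) (i : Fin n) :
    MemLp (fun ω => D.runInner S α β γ T N k t ω i) 2 P :=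
  memLp_runInner h hO hS (memLp_run h hO hS hE k).1 (memLp_run h hO hS hE k).2.2 t i

end DSBOProblem

/-! ### One step of the lower level iteration -/

namespace DSBOProblem

variable {n p q : ℕ} {Ξ Ψ Ω : Type*} [MeasurableSpace Ξ] [MeasurableSpace Ψ]
  {D : DSBOProblem n p q Ξ Ψ} {c : DSBOConstants}

lemma sqNorm_lowerGrad_sub_le (h : D.IsSmooth c) (w w' : Fin n → JointSpace p q) :
    sqNorm (fun i => D.lowerGrad w i - D.lowerGrad w' i)
      ≤ c.Lg1 ^ 2 * sqNorm (fun i => w i - w' i) :=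
  sqNorm_le_mul_of_forall fun i =>
    (norm_joint_snd_le (gradient (D.g i) (w i) - gradient (D.g i) (w' i))).trans
      (h.norm_gradient_g_sub_le i (w i) (w' i))

lemma sqNorm_points_sub_const (hn : 0 < n) (x : Fin n → EuclideanSpace ℝ (Fin p))
    (y : Fin n → EuclideanSpace ℝ (Fin q)) (v : EuclideanSpace ℝ (Fin q)) :
    sqNorm (fun i => points x y i - joint (agentAvg x) v)
      = sqNorm (dev x) + sqNorm (dev y) + n * ‖agentAvg y - v‖ ^ 2 := by
  have e : sqNorm (fun i => points x y i - joint (agentAvg x) v)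
      = sqNorm (fun i => x i - agentAvg x) + sqNorm (fun i => y i - v) := by
    simp only [sqNorm, ← Finset.sum_add_distrib]
    exact Finset.sum_congr rfl fun i _ => by rw [points, joint_sub, norm_joint_sq]
  rw [e, sqNorm_sub_const hn y v]
  have : sqNorm (fun i => x i - agentAvg x) = sqNorm (dev x) := rfl
  rw [this]; ring

/-- Bounded heterogeneity controls the disagreement of the gradients at a common point, and
smoothness the effect of the disagreement of the iterates. -/
lemma sqNorm_dev_lowerGrad_le (hn : 0 < n) (h : D.IsSmooth c) (het : D.HasBoundedHeterogeneity c)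
    (x : Fin n → EuclideanSpace ℝ (Fin p)) (y : Fin n → EuclideanSpace ℝ (Fin q)) :
    sqNorm (dev (D.lowerGrad (points x y)))
      ≤ 2 * c.Lg1 ^ 2 * (sqNorm (dev x) + sqNorm (dev y)) + 2 * n * c.δ ^ 2 := by
  set w' : Fin n → JointSpace p q := fun _ => joint (agentAvg x) (agentAvg y) with hw'
  have e : D.lowerGrad (points x y) = fun i =>
      (D.lowerGrad (points x y) i - D.lowerGrad w' i) + D.lowerGrad w' i := by
    funext i; rw [sub_add_cancel]
  have h1 : sqNorm (fun i => D.lowerGrad (points x y) i - D.lowerGrad w' i)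
      ≤ c.Lg1 ^ 2 * (sqNorm (dev x) + sqNorm (dev y)) := by
    refine (sqNorm_lowerGrad_sub_le h _ _).trans_eq ?_
    simp only [hw']
    rw [sqNorm_points_sub_const hn, sub_self, norm_zero]; ring
  have h2 : sqNorm (dev (D.lowerGrad w')) ≤ n * c.δ ^ 2 := by
    refine (Finset.sum_le_sum (g := fun _ => c.δ ^ 2) fun i _ =>
      pow_le_pow_left₀ (norm_nonneg _) (het i (joint (agentAvg x) (agentAvg y))) 2).trans_eq ?_
    simp
  rw [e, dev_add]
  have h3 := sqNorm_add_le_two (dev fun i => D.lowerGrad (points x y) i - D.lowerGrad w' i)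
    (dev (D.lowerGrad w'))
  have h4 := sqNorm_dev_le hn fun i => D.lowerGrad (points x y) i - D.lowerGrad w' i
  linarith

lemma sqNorm_dev_lowerStep_le (hn : 0 < n) (h : D.IsSmooth c)
    (het : D.HasBoundedHeterogeneity c) {ρ : ℝ} (hW : IsGossip D.W ρ) (β : ℝ)
    (x : Fin n → EuclideanSpace ℝ (Fin p)) (y e : Fin n → EuclideanSpace ℝ (Fin q)) :
    sqNorm (dev fun i => mix D.W y i - β • (D.lowerGrad (points x y) i + e i))
      ≤ ρ * sqNorm (dev y) + β ^ 2 / (1 - ρ) *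
        (4 * c.Lg1 ^ 2 * (sqNorm (dev x) + sqNorm (dev y)) + 4 * n * c.δ ^ 2 + 2 * sqNorm e) := by
  have h1 : 0 < 1 - ρ := by linarith [hW.lt_one]
  have h2 := hW.sqNorm_dev_step_le hn y fun i => (-β) • (D.lowerGrad (points x y) i + e i)
  simp only [neg_smul, ← sub_eq_add_neg] at h2
  refine h2.trans (add_le_add le_rfl ?_)
  have h3 : sqNorm (dev fun i => -(β • (D.lowerGrad (points x y) i + e i)))
      = β ^ 2 * sqNorm (dev fun i => D.lowerGrad (points x y) i + e i) := by
    have := dev_smul (-β) fun i => D.lowerGrad (points x y) i + e i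
    simp only [neg_smul] at this
    rw [this]
    have := sqNorm_smul (-β) (dev fun i => D.lowerGrad (points x y) i + e i)
    simp only [neg_smul, neg_sq] at this
    exact this
  have h4 := sqNorm_add_le_two (dev (D.lowerGrad (points x y))) (dev e)
  rw [← dev_add] at h4
  have h5 := sqNorm_dev_lowerGrad_le hn h het x y
  have h6 := sqNorm_dev_le hn e
  rw [h3, mul_div_right_comm]
  refine mul_le_mul_of_nonneg_left ?_ (by positivity)
  linarith

/-- One noiseless inner step contracts the distance of the averaged iterate to `y*(x̄)`, up to the
disagreement of the agents. -/
lemma norm_lowerStep_sub_sq_le (hn : 0 < n) (h : D.IsSmooth c) {β : ℝ} (hβ : 0 < β)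
    (hβL : β * c.Lg1 ^ 2 ≤ c.μg) (x : Fin n → EuclideanSpace ℝ (Fin p))
    (y : Fin n → EuclideanSpace ℝ (Fin q)) :
    ‖agentAvg y - D.yStar (agentAvg x) - β • agentAvg (D.lowerGrad (points x y))‖ ^ 2
      ≤ (1 - β * c.μg / 2) * ‖agentAvg y - D.yStar (agentAvg x)‖ ^ 2
        + (β ^ 2 + 2 * β / c.μg) * (c.Lg1 ^ 2 * (sqNorm (dev x) + sqNorm (dev y))) := by
  have hμ := c.μg_pos
  set v := agentAvg y - D.yStar (agentAvg x) with hv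
  set w' : Fin n → JointSpace p q := fun _ => joint (agentAvg x) (agentAvg y) with hw'
  set w₀ : Fin n → JointSpace p q := fun _ => joint (agentAvg x) (D.yStar (agentAvg x)) with hw₀
  set G := agentAvg (D.lowerGrad w') with hG
  have hG0 : G = agentAvg fun i => D.lowerGrad w' i - D.lowerGrad w₀ i := by
    rw [agentAvg_sub]
    have : agentAvg (D.lowerGrad w₀) = 0 := h.gradient_yStar hn (agentAvg x)
    rw [this, sub_zero]
  have h1 : c.μg * ‖v‖ ^ 2 ≤ inner ℝ G v := by
    rw [hG0]
    exact IsSmooth.inner_agentAvg_ge hn fun i => h.inner_gradient_g_sub_ge i _ _ _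
  have h2 : ‖G‖ ≤ c.Lg1 * ‖v‖ := by
    rw [hG0]
    refine norm_agentAvg_le_of_forall hn fun i => ?_
    refine (norm_joint_snd_le (gradient (D.g i) (w' i) - gradient (D.g i) (w₀ i))).trans
      ((h.norm_gradient_g_sub_le i _ _).trans_eq ?_)
    simp only [hw', hw₀]
    rw [joint_sub, sub_self, norm_joint_zero_left]
  have h3 := norm_sub_smul_sq_le hβ.le hβL h1 h2
  have h4 : ‖agentAvg (D.lowerGrad (points x y)) - G‖ ^ 2
      ≤ c.Lg1 ^ 2 * (sqNorm (dev x) + sqNorm (dev y)) := by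
    rw [hG, ← agentAvg_sub]
    refine (norm_agentAvg_sq_le' hn _).trans ((sqNorm_lowerGrad_sub_le h _ _).trans_eq ?_)
    simp only [hw']
    rw [sqNorm_points_sub_const hn, sub_self, norm_zero]; ring
  have e : v - β • agentAvg (D.lowerGrad (points x y))
      = (v - β • G) + (-β) • (agentAvg (D.lowerGrad (points x y)) - G) := by
    rw [neg_smul, smul_sub]; abel
  have hs : 0 < β * c.μg / 2 := by positivity
  have h5 := norm_add_sq_le_young hs (v - β • G)
    ((-β) • (agentAvg (D.lowerGrad (points x y)) - G))
  rw [e]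
  refine h5.trans (add_le_add ?_ ?_)
  · refine (mul_le_mul_of_nonneg_left h3 (by linarith)).trans ?_
    rw [← mul_assoc]
    refine mul_le_mul_of_nonneg_right ?_ (by positivity)
    nlinarith [sq_nonneg (β * c.μg)]
  · rw [norm_smul, norm_neg, Real.norm_of_nonneg hβ.le, mul_pow, ← mul_assoc]
    have : (1 + 1 / (β * c.μg / 2)) * β ^ 2 = β ^ 2 + 2 * β / c.μg := by field_simp
    rw [this]
    exact mul_le_mul_of_nonneg_left h4 (by positivity)

/-- The minimizer `y*(x̄)` moves little between outer iterations. -/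
lemma norm_sub_yStar_drift_sq_le (hn : 0 < n) (h : D.IsSmooth c) {s : ℝ} (hs : 0 < s) (α : ℝ)
    (y : EuclideanSpace ℝ (Fin q)) (x r : EuclideanSpace ℝ (Fin p)) :
    ‖y - D.yStar (x - α • r)‖ ^ 2
      ≤ (1 + s) * ‖y - D.yStar x‖ ^ 2 + (1 + 1 / s) * (c.yLip ^ 2 * α ^ 2 * ‖r‖ ^ 2) := by
  have e : y - D.yStar (x - α • r) = (y - D.yStar x) + (D.yStar x - D.yStar (x - α • r)) := by abel
  rw [e]
  refine (norm_add_sq_le_young hs _ _).trans (add_le_add le_rfl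
    (mul_le_mul_of_nonneg_left ?_ (by positivity)))
  have h1 := pow_le_pow_left₀ (norm_nonneg _) (h.norm_yStar_sub_le hn x (x - α • r)) 2
  rw [sub_sub_cancel, norm_smul, mul_pow, mul_pow, Real.norm_eq_abs, sq_abs] at h1
  linarith

/-! ### Error of the mean hypergradient estimate -/

lemma norm_hyp_points_sub_sq_le (hn : 0 < n) (h : D.IsSmooth c)
    (x : Fin n → EuclideanSpace ℝ (Fin p)) (y : Fin n → EuclideanSpace ℝ (Fin q)) :
    ‖D.hyp (points x y) - gradient D.Phi (agentAvg x)‖ ^ 2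
      ≤ c.hypLip ^ 2 * (sqNorm (dev x) + sqNorm (dev y)
        + n * ‖agentAvg y - D.yStar (agentAvg x)‖ ^ 2) := by
  rw [h.gradient_Phi hn, ← sqNorm_points_sub_const hn]
  set u := fun i => points x y i - joint (agentAvg x) (D.yStar (agentAvg x)) with hu
  have h1 : ∀ i, ‖points x y i - joint (agentAvg x) (D.yStar (agentAvg x))‖ ≤ √(sqNorm u) :=
    fun i => Real.le_sqrt_of_sq_le (norm_sq_le_sqNorm u i)
  have h2 := pow_le_pow_left₀ (norm_nonneg _) (h.norm_hyp_sub_le hn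
    (w' := fun _ => joint (agentAvg x) (D.yStar (agentAvg x))) h1) 2
  rwa [mul_pow, Real.sq_sqrt (sqNorm_nonneg _)] at h2

end DSBOProblem

/-! ### One step of the upper level iteration -/

lemma norm_sq_moving_avg_le {E : Type*} [NormedAddCommGroup E] [InnerProductSpace ℝ E]
    (α : ℝ) (r u : E) :
    ‖(1 - α) • r + α • u‖ ^ 2
      ≤ ‖r‖ ^ 2 + 2 * α * inner ℝ r u - 2 * α * ‖r‖ ^ 2
        + α ^ 2 * (2 * ‖u‖ ^ 2 + 2 * ‖r‖ ^ 2) := by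
  have e : (1 - α) • r + α • u = r + α • (u - r) := by rw [sub_smul, smul_sub, one_smul]; abel
  rw [e, norm_add_sq_real, inner_smul_right, inner_sub_right, real_inner_self_eq_norm_sq,
    norm_smul, mul_pow, Real.norm_eq_abs, sq_abs]
  nlinarith [mul_le_mul_of_nonneg_left (norm_sub_sq_le_two u r) (sq_nonneg α)]

namespace DSBOProblem

variable {n p q : ℕ} {Ξ Ψ Ω : Type*} [MeasurableSpace Ξ] [MeasurableSpace Ψ]
  {D : DSBOProblem n p q Ξ Ψ} {c : DSBOConstants}

/-- The noiseless part of the error recursion of the moving average, seen as an estimator of the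
gradient of `Φ`. -/
lemma norm_gradErr_step_sq_le (hn : 0 < n) (h : D.IsSmooth c) {α : ℝ} (hα : 0 < α) (hα1 : α ≤ 1)
    (x r m : EuclideanSpace ℝ (Fin p)) :
    ‖(1 - α) • r + α • m - gradient D.Phi (x - α • r)‖ ^ 2
      ≤ (1 - α) * ‖r - gradient D.Phi x‖ ^ 2 + 2 * α * ‖m - gradient D.Phi x‖ ^ 2
        + 2 * α * c.phiLip ^ 2 * ‖r‖ ^ 2 := by
  set g := gradient D.Phi x with hg
  set g' := gradient D.Phi (x - α • r) with hg'
  have e : (1 - α) • r + α • m - g'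
      = (1 - α) • (r - g) + α • ((m - g) + α⁻¹ • (g - g')) := by
    rw [smul_add, smul_smul, mul_inv_cancel₀ hα.ne', one_smul, smul_sub, smul_sub, sub_smul,
      sub_smul, one_smul, one_smul]
    abel
  rw [e]
  refine (norm_convex_comb_sq_le hα.le hα1 _ _).trans ?_
  have h1 := norm_add_sq_le_two (m - g) (α⁻¹ • (g - g'))
  have h2 : ‖α⁻¹ • (g - g')‖ ≤ c.phiLip * ‖r‖ := by
    have h3 := h.norm_gradient_Phi_sub_le hn x (x - α • r)
    rw [sub_sub_cancel, norm_smul, Real.norm_of_nonneg hα.le] at h3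
    rw [norm_smul, Real.norm_of_nonneg (inv_nonneg.2 hα.le), inv_mul_le_iff₀ hα]
    linarith
  have h3 := pow_le_pow_left₀ (norm_nonneg _) h2 2
  rw [mul_pow] at h3
  nlinarith [mul_le_mul_of_nonneg_left h1 hα.le, mul_le_mul_of_nonneg_left h3 hα.le]

/-- Descent of `Φ` along a step in the direction `-r`, with `m` in place of the gradient. -/
lemma Phi_sub_smul_le (hn : 0 < n) (h : D.IsSmooth c) {α : ℝ} (hα : 0 < α)
    (x r m : EuclideanSpace ℝ (Fin p)) :
    D.Phi (x - α • r) ≤ D.Phi x - α * inner ℝ r m + α / 2 * ‖m - gradient D.Phi x‖ ^ 2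
      + α / 2 * ‖r‖ ^ 2 + α ^ 2 * c.phiLip * ‖r‖ ^ 2 := by
  have h1 := h.Phi_add_le hn x (-(α • r))
  rw [← sub_eq_add_neg, norm_neg, norm_smul, Real.norm_of_nonneg hα.le, inner_neg_right,
    inner_smul_right] at h1
  have h2 : inner ℝ (m - gradient D.Phi x) r
      ≤ ‖m - gradient D.Phi x‖ ^ 2 / 2 + ‖r‖ ^ 2 / 2 := by
    have := real_inner_le_norm (m - gradient D.Phi x) r
    nlinarith [sq_nonneg (‖m - gradient D.Phi x‖ - ‖r‖)]
  rw [inner_sub_left, real_inner_comm r m] at h2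
  nlinarith [mul_le_mul_of_nonneg_left h2 hα.le]

end DSBOProblem

/-! ### Expected errors along the run and their recursions -/

namespace DSBOProblem

variable {n p q : ℕ} {Ξ Ψ Ω : Type*} [MeasurableSpace Ξ] [MeasurableSpace Ψ] [MeasurableSpace Ω]

/-- The average upper level iterate `x̄_k`. -/
def avgX (D : DSBOProblem n p q Ξ Ψ) (S : DSBOSamples n Ξ Ψ Ω) (α β γ : ℝ) (T N k : ℕ) (ω : Ω) :
    EuclideanSpace ℝ (Fin p) :=
  agentAvg (D.run S α β γ T N k ω).x

/-- The average moving average `r̄_k`. -/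
def avgR (D : DSBOProblem n p q Ξ Ψ) (S : DSBOSamples n Ξ Ψ Ω) (α β γ : ℝ) (T N k : ℕ) (ω : Ω) :
    EuclideanSpace ℝ (Fin p) :=
  agentAvg (D.run S α β γ T N k ω).r

/-- The conditional mean of the average hypergradient estimate, given the iterates. -/
def avgMean (D : DSBOProblem n p q Ξ Ψ) (S : DSBOSamples n Ξ Ψ Ω) (α β γ : ℝ) (T N k : ℕ)
    (ω : Ω) : EuclideanSpace ℝ (Fin p) :=
  agentAvg (D.meanEstimate γ N
    (points (D.run S α β γ T N k ω).x (D.runInner S α β γ T N k T ω)))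

/-- Expected disagreement of the `x_{i,k}`. -/
def consX (D : DSBOProblem n p q Ξ Ψ) (S : DSBOSamples n Ξ Ψ Ω) (P : Measure Ω) (α β γ : ℝ)
    (T N k : ℕ) : ℝ :=
  ∫ ω, sqNorm (dev (D.run S α β γ T N k ω).x) ∂P

/-- Second moment of the `r_{i,k}`. -/
def momR (D : DSBOProblem n p q Ξ Ψ) (S : DSBOSamples n Ξ Ψ Ω) (P : Measure Ω) (α β γ : ℝ)
    (T N k : ℕ) : ℝ :=
  ∫ ω, sqNorm (D.run S α β γ T N k ω).r ∂P

/-- Expected disagreement of the inner iterates `y_{i,k}^{(t)}`. -/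
def consY (D : DSBOProblem n p q Ξ Ψ) (S : DSBOSamples n Ξ Ψ Ω) (P : Measure Ω) (α β γ : ℝ)
    (T N k t : ℕ) : ℝ :=
  ∫ ω, sqNorm (dev (D.runInner S α β γ T N k t ω)) ∂P

/-- Expected squared distance of the average inner iterate to `y*(x̄_k)`. -/
def lowerErr (D : DSBOProblem n p q Ξ Ψ) (S : DSBOSamples n Ξ Ψ Ω) (P : Measure Ω) (α β γ : ℝ)
    (T N k t : ℕ) : ℝ :=
  ∫ ω, ‖agentAvg (D.runInner S α β γ T N k t ω) - D.yStar (D.avgX S α β γ T N k ω)‖ ^ 2 ∂P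

/-- Second moment of `r̄_k`. -/
def momAvgR (D : DSBOProblem n p q Ξ Ψ) (S : DSBOSamples n Ξ Ψ Ω) (P : Measure Ω) (α β γ : ℝ)
    (T N k : ℕ) : ℝ :=
  ∫ ω, ‖D.avgR S α β γ T N k ω‖ ^ 2 ∂P

/-- Expected squared distance of `r̄_k` to `∇Φ(x̄_k)`. -/
def gradErr (D : DSBOProblem n p q Ξ Ψ) (S : DSBOSamples n Ξ Ψ Ω) (P : Measure Ω) (α β γ : ℝ)
    (T N k : ℕ) : ℝ :=
  ∫ ω, ‖D.avgR S α β γ T N k ω - gradient D.Phi (D.avgX S α β γ T N k ω)‖ ^ 2 ∂P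

/-- Expected squared bias of the hypergradient estimates, given the iterates. -/
def meanErr (D : DSBOProblem n p q Ξ Ψ) (S : DSBOSamples n Ξ Ψ Ω) (P : Measure Ω) (α β γ : ℝ)
    (T N k : ℕ) : ℝ :=
  ∫ ω, ‖D.avgMean S α β γ T N k ω - gradient D.Phi (D.avgX S α β γ T N k ω)‖ ^ 2 ∂P

/-- Expected objective `Φ(x̄_k)`. -/
def expPhi (D : DSBOProblem n p q Ξ Ψ) (S : DSBOSamples n Ξ Ψ Ω) (P : Measure Ω) (α β γ : ℝ)
    (T N k : ℕ) : ℝ :=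
  ∫ ω, D.Phi (D.avgX S α β γ T N k ω) ∂P

variable {D : DSBOProblem n p q Ξ Ψ} {S : DSBOSamples n Ξ Ψ Ω} {P : Measure Ω}
  [IsProbabilityMeasure P] {α β γ : ℝ} {T N : ℕ} {c : DSBOConstants} {U b ρ : ℝ}

lemma avgX_succ (hW : IsGossip D.W ρ) (k : ℕ) (ω : Ω) : D.avgX S α β γ T N (k + 1) ω
    = D.avgX S α β γ T N k ω - α • D.avgR S α β γ T N k ω := by
  rw [avgX, run_x_succ, agentAvg_sub, agentAvg_smul, hW.agentAvg_mix]; rfl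

lemma avgR_succ (k : ℕ) (ω : Ω) : D.avgR S α β γ T N (k + 1) ω
    = (1 - α) • D.avgR S α β γ T N k ω + α • agentAvg (D.estimate γ N
      (points (D.run S α β γ T N k ω).x (D.runInner S α β γ T N k T ω)) (S.block k ω)) := by
  rw [avgR, run_r_succ, agentAvg_add, agentAvg_smul, agentAvg_smul]; rfl

/-! #### Square integrability -/

lemma memLp_avgX (h : D.IsSmooth c) (hO : D.HasOracles c) (hS : S.IsIndependentSampling D P)
    (hE : D.IsGoodEstimator S P γ N U b) (k : ℕ) : MemLp (D.avgX S α β γ T N k) 2 P :=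
  memLp_agentAvg (memLp_run h hO hS hE k).1

lemma memLp_avgR (h : D.IsSmooth c) (hO : D.HasOracles c) (hS : S.IsIndependentSampling D P)
    (hE : D.IsGoodEstimator S P γ N U b) (k : ℕ) : MemLp (D.avgR S α β γ T N k) 2 P :=
  memLp_agentAvg (memLp_run h hO hS hE k).2.1

lemma IsSmooth.memLp_yStar (hn : 0 < n) (h : D.IsSmooth c) {x : Ω → EuclideanSpace ℝ (Fin p)}
    (hx : MemLp x 2 P) : MemLp (fun ω => D.yStar (x ω)) 2 P := by
  refine ((memLp_const ‖D.yStar 0‖).add (hx.norm.const_mul c.yLip)).mono'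
    ((h.continuous_yStar hn).comp_aestronglyMeasurable hx.aestronglyMeasurable)
    (ae_of_all _ fun ω => ?_)
  have h1 := h.norm_yStar_sub_le hn (x ω) 0
  rw [sub_zero] at h1
  have h2 := norm_add_le (D.yStar 0) (D.yStar (x ω) - D.yStar 0)
  rw [add_sub_cancel] at h2
  exact h2.trans (add_le_add le_rfl h1)

lemma IsSmooth.memLp_gradient_Phi (hn : 0 < n) (h : D.IsSmooth c)
    {x : Ω → EuclideanSpace ℝ (Fin p)} (hx : AEStronglyMeasurable x P) :
    MemLp (fun ω => gradient D.Phi (x ω)) 2 P :=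
  (memLp_const c.hypBound).mono' ((h.continuous_gradient_Phi hn).comp_aestronglyMeasurable hx)
    (ae_of_all _ fun ω => h.norm_gradient_Phi_le hn (x ω))

lemma IsSmooth.integrable_Phi (hn : 0 < n) (h : D.IsSmooth c)
    {x : Ω → EuclideanSpace ℝ (Fin p)} (hx : MemLp x 2 P) :
    Integrable (fun ω => D.Phi (x ω)) P := by
  have hx1 := (hx.integrable one_le_two).norm
  refine ((integrable_const |D.Phi 0|).add (hx1.const_mul c.hypBound)).mono'
    ((h.differentiable_Phi hn).continuous.comp_aestronglyMeasurable hx.aestronglyMeasurable)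
    (ae_of_all _ fun ω => ?_)
  have h1 := h.abs_Phi_sub_le hn (x ω) 0
  rw [sub_zero] at h1
  have h2 := abs_add_le (D.Phi 0) (D.Phi (x ω) - D.Phi 0)
  rw [add_sub_cancel] at h2
  exact h2.trans (add_le_add le_rfl h1)

lemma norm_avg_meanEstimate_sq_le (hn : 0 < n) (h : D.IsSmooth c)
    (hE : D.IsGoodEstimator S P γ N U b) (w : Fin n → JointSpace p q) :
    ‖agentAvg (D.meanEstimate γ N w)‖ ^ 2 ≤ 2 * b + 2 * c.hypBound ^ 2 := by
  have h1 := norm_add_sq_le_two (agentAvg (D.meanEstimate γ N w) - D.hyp w) (D.hyp w)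
  rw [sub_add_cancel] at h1
  have h2 := pow_le_pow_left₀ (norm_nonneg _) (h.norm_hyp_le hn w) 2
  linarith [hE.bias w]

lemma memLp_avgMean (hn : 0 < n) (h : D.IsSmooth c) (hO : D.HasOracles c)
    (hS : S.IsIndependentSampling D P) (hE : D.IsGoodEstimator S P γ N U b) (k : ℕ) :
    MemLp (D.avgMean S α β γ T N k) 2 P := by
  have hm : Measurable (D.avgMean S α β γ T N k) :=
    measurable_agentAvg ((h.measurable_meanEstimate γ N).comp
      (measurable_points (measurable_run' hO hS k).1 (measurable_runInner' hO hS k T)))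
  refine (memLp_const (√(2 * b + 2 * c.hypBound ^ 2))).mono' hm.aestronglyMeasurable
    (ae_of_all _ fun ω => Real.le_sqrt_of_sq_le (norm_avg_meanEstimate_sq_le hn h hE _))

lemma memLp_avgEstimate (hO : D.HasOracles c) (hS : S.IsIndependentSampling D P)
    (hE : D.IsGoodEstimator S P γ N U b) (k : ℕ) :
    MemLp (fun ω => agentAvg (D.estimate γ N (points (D.run S α β γ T N k ω).x
      (D.runInner S α β γ T N k T ω)) (S.block k ω))) 2 P :=
  memLp_agentAvg fun i => (memLp_runEstimate hO hS hE k i).1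

/-! #### Consensus errors -/

lemma momR_succ_le (h : D.IsSmooth c) (hO : D.HasOracles c)
    (hS : S.IsIndependentSampling D P) (hE : D.IsGoodEstimator S P γ N U b) (hα : 0 ≤ α)
    (hα1 : α ≤ 1) (k : ℕ) :
    D.momR S P α β γ T N (k + 1) ≤ (1 - α) * D.momR S P α β γ T N k + α * (n * U) := by
  have hr := (memLp_run (α := α) (β := β) (T := T) h hO hS hE k).2.1
  have hu := fun i => memLp_runEstimate (α := α) (β := β) (T := T) hO hS hE k i
  have hi1 := integrable_sqNorm hr
  have hi2 := integrable_sqNorm fun i => (hu i).1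
  have h1 : D.momR S P α β γ T N (k + 1) ≤ ∫ ω, ((1 - α) * sqNorm (D.run S α β γ T N k ω).r
      + α * sqNorm (D.estimate γ N (points (D.run S α β γ T N k ω).x
      (D.runInner S α β γ T N k T ω)) (S.block k ω))) ∂P := by
    refine integral_mono (integrable_sqNorm (memLp_run h hO hS hE (k + 1)).2.1)
      ((hi1.const_mul _).fun_add (hi2.const_mul _)) fun ω => ?_
    simp only [run_r_succ, sqNorm, Finset.mul_sum, ← Finset.sum_add_distrib]
    exact Finset.sum_le_sum fun i _ => norm_convex_comb_sq_le hα hα1 _ _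
  rw [integral_add (hi1.const_mul _) (hi2.const_mul _), integral_const_mul, integral_const_mul,
    integral_sqNorm fun i => (hu i).1] at h1
  refine h1.trans (add_le_add le_rfl (mul_le_mul_of_nonneg_left ?_ hα))
  refine (Finset.sum_le_sum fun i _ => (hu i).2).trans_eq ?_
  simp

lemma momR_le (h : D.IsSmooth c) (hO : D.HasOracles c)
    (hS : S.IsIndependentSampling D P) (hE : D.IsGoodEstimator S P γ N U b) (hU : 0 ≤ U)
    (hα : 0 ≤ α) (hα1 : α ≤ 1) (k : ℕ) : D.momR S P α β γ T N k ≤ n * U := by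
  induction k with
  | zero => simp only [momR, run_zero]; simp [sqNorm]; positivity
  | succ k ih =>
    refine (momR_succ_le h hO hS hE hα hα1 k).trans ?_
    nlinarith [mul_le_mul_of_nonneg_left ih (sub_nonneg.2 hα1)]

lemma consX_succ_le (hn : 0 < n) (h : D.IsSmooth c) (hW : IsGossip D.W ρ) (hO : D.HasOracles c)
    (hS : S.IsIndependentSampling D P) (hE : D.IsGoodEstimator S P γ N U b) (k : ℕ) :
    D.consX S P α β γ T N (k + 1)
      ≤ ρ * D.consX S P α β γ T N k + α ^ 2 / (1 - ρ) * D.momR S P α β γ T N k := by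
  have h1 : 0 < 1 - ρ := by linarith [hW.lt_one]
  obtain ⟨hx, hr, -⟩ := memLp_run (α := α) (β := β) (T := T) h hO hS hE k
  have hi1 := integrable_sqNorm (memLp_dev hx)
  have hi2 := integrable_sqNorm hr
  have h2 : D.consX S P α β γ T N (k + 1) ≤ ∫ ω, (ρ * sqNorm (dev (D.run S α β γ T N k ω).x)
      + α ^ 2 / (1 - ρ) * sqNorm (D.run S α β γ T N k ω).r) ∂P := by
    refine integral_mono (integrable_sqNorm (memLp_dev (memLp_run h hO hS hE (k + 1)).1))
      ((hi1.const_mul _).fun_add (hi2.const_mul _)) fun ω => ?_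
    set A := D.run S α β γ T N k ω with hA
    have h3 := hW.sqNorm_dev_step_le hn A.x fun i => (-α) • A.r i
    simp only [run_x_succ, ← hA, sub_eq_add_neg, ← neg_smul]
    rw [dev_smul, sqNorm_smul, neg_sq] at h3
    refine h3.trans (add_le_add le_rfl ?_)
    rw [mul_div_right_comm]
    exact mul_le_mul_of_nonneg_left (sqNorm_dev_le hn _) (by positivity)
  rwa [integral_add (hi1.const_mul _) (hi2.const_mul _), integral_const_mul, integral_const_mul]
    at h2

/-- The disagreement of the `x_{i,k}` is of order `α ^ 2`. -/
lemma consX_le (hn : 0 < n) (h : D.IsSmooth c) (hW : IsGossip D.W ρ) (hO : D.HasOracles c)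
    (hS : S.IsIndependentSampling D P) (hE : D.IsGoodEstimator S P γ N U b) (hU : 0 ≤ U)
    (hα : 0 ≤ α) (hα1 : α ≤ 1) (k : ℕ) :
    D.consX S P α β γ T N k ≤ α ^ 2 * (n * U / (1 - ρ) ^ 2) := by
  have h1 : 0 < 1 - ρ := by linarith [hW.lt_one]
  induction k with
  | zero =>
    simp only [consX, run_zero]
    simp [sqNorm, dev, agentAvg]; positivity
  | succ k ih =>
    refine (consX_succ_le hn h hW hO hS hE k).trans ?_
    have h2 := mul_le_mul_of_nonneg_left ih hW.pos.le
    have h3 := mul_le_mul_of_nonneg_left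
      (momR_le (β := β) (T := T) h hO hS hE hU hα hα1 k)
      (show 0 ≤ α ^ 2 / (1 - ρ) by positivity)
    refine (add_le_add h2 h3).trans_eq ?_
    field_simp
    ring

lemma consX_nonneg (k : ℕ) : 0 ≤ D.consX S P α β γ T N k :=
  integral_nonneg fun _ => sqNorm_nonneg _

lemma consY_nonneg (k t : ℕ) : 0 ≤ D.consY S P α β γ T N k t :=
  integral_nonneg fun _ => sqNorm_nonneg _

lemma consY_succ_le (hn : 0 < n) (h : D.IsSmooth c) (het : D.HasBoundedHeterogeneity c)
    (hW : IsGossip D.W ρ) (hO : D.HasOracles c)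
    (hS : S.IsIndependentSampling D P) (hE : D.IsGoodEstimator S P γ N U b) (k t : ℕ) :
    D.consY S P α β γ T N k (t + 1) ≤ ρ * D.consY S P α β γ T N k t + β ^ 2 / (1 - ρ) *
      (4 * c.Lg1 ^ 2 * (D.consX S P α β γ T N k + D.consY S P α β γ T N k t)
        + (4 * n * c.δ ^ 2 + 2 * (n * c.σg1 ^ 2))) := by
  have h1 : 0 < 1 - ρ := by linarith [hW.lt_one]
  have hx := (memLp_run (α := α) (β := β) (T := T) h hO hS hE k).1
  have hy := memLp_inner (α := α) (β := β) (T := T) h hO hS hE k t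
  have he := fun i => memLp_runNoise (α := α) (β := β) (γ := γ) (T := T) (N := N) h hO hS k t i
  have hi1 := integrable_sqNorm (memLp_dev hx)
  have hi2 := integrable_sqNorm (memLp_dev hy)
  have hi3 := integrable_sqNorm fun i => (he i).1
  have hi4 : Integrable (fun ω => 4 * (c.Lg1 : ℝ) ^ 2 * (sqNorm (dev (D.run S α β γ T N k ω).x)
      + sqNorm (dev (D.runInner S α β γ T N k t ω)))) P := (hi1.fun_add hi2).const_mul _
  have hi5 : Integrable (fun ω => 4 * (c.Lg1 : ℝ) ^ 2 * (sqNorm (dev (D.run S α β γ T N k ω).x)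
      + sqNorm (dev (D.runInner S α β γ T N k t ω))) + 4 * n * c.δ ^ 2) P :=
    hi4.fun_add (integrable_const _)
  have h2 := integral_mono
    (integrable_sqNorm (memLp_dev (memLp_inner (α := α) (β := β) (T := T) h hO hS hE k (t + 1))))
    ((hi2.const_mul ρ).fun_add ((hi5.fun_add (hi3.const_mul 2)).const_mul (β ^ 2 / (1 - ρ))))
    fun ω => (congrArg (fun v => sqNorm (dev v)) (runInner_succ_eq k t ω)).trans_le
      (sqNorm_dev_lowerStep_le hn h het hW β _ _ _)
  refine h2.trans ?_
  rw [integral_add (hi2.const_mul _) ((hi5.fun_add (hi3.const_mul 2)).const_mul _),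
    integral_const_mul, integral_const_mul, integral_add hi5 (hi3.const_mul 2),
    integral_add hi4 (integrable_const _), integral_const_mul, integral_const_mul,
    integral_const_mul 2,
    integral_add hi1 hi2, integral_sqNorm fun i => (he i).1]
  simp only [integral_const, probReal_univ, one_smul]
  have h3 : ∑ i, ∫ ω, ‖D.lowerNoise ((D.run S α β γ T N k ω).x, D.runInner S α β γ T N k t ω)
      (fun i => S.lower k t i ω) i‖ ^ 2 ∂P ≤ n * c.σg1 ^ 2 :=
    (Finset.sum_le_sum fun i _ => (he i).2).trans_eq (by simp)
  refine add_le_add le_rfl (mul_le_mul_of_nonneg_left ?_ (by positivity))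
  rw [consX, consY]
  linarith

/-- The disagreement of the inner iterates is of order `β ^ 2`. -/
lemma consY_le (hn : 0 < n) (h : D.IsSmooth c) (het : D.HasBoundedHeterogeneity c)
    (hW : IsGossip D.W ρ) (hO : D.HasOracles c)
    (hS : S.IsIndependentSampling D P) (hE : D.IsGoodEstimator S P γ N U b) {C : ℝ}
    (hC : ∀ k, D.consX S P α β γ T N k ≤ C)
    (hβ : β ^ 2 * (8 * c.Lg1 ^ 2) ≤ (1 - ρ) ^ 2) (k t : ℕ) :
    D.consY S P α β γ T N k t ≤ β ^ 2 * (2 / (1 - ρ) ^ 2 *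
      (4 * c.Lg1 ^ 2 * C + (4 * n * c.δ ^ 2 + 2 * (n * c.σg1 ^ 2)))) := by
  have h1 : 0 < 1 - ρ := by linarith [hW.lt_one]
  have hC0 : 0 ≤ C := (consX_nonneg 0).trans (hC 0)
  set V := 4 * c.Lg1 ^ 2 * C + (4 * n * c.δ ^ 2 + 2 * (n * c.σg1 ^ 2)) with hV
  have hV0 : 0 ≤ V := by positivity
  have step : ∀ k t, D.consY S P α β γ T N k t ≤ β ^ 2 * (2 / (1 - ρ) ^ 2 * V) →
      D.consY S P α β γ T N k (t + 1) ≤ β ^ 2 * (2 / (1 - ρ) ^ 2 * V) := by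
    intro k t ih
    refine (consY_succ_le hn h het hW hO hS hE k t).trans ?_
    set Y := D.consY S P α β γ T N k t with hY
    have hY0 : 0 ≤ Y := consY_nonneg k t
    have h2 : β ^ 2 / (1 - ρ) * (4 * c.Lg1 ^ 2 * Y) ≤ (1 - ρ) / 2 * Y := by
      rw [← mul_assoc]
      refine mul_le_mul_of_nonneg_right ?_ hY0
      rw [div_mul_eq_mul_div, div_le_iff₀ h1]
      linarith
    have h3 : β ^ 2 / (1 - ρ) * (4 * c.Lg1 ^ 2 * D.consX S P α β γ T N k) ≤
        β ^ 2 / (1 - ρ) * (4 * c.Lg1 ^ 2 * C) := by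
      have := hC k
      gcongr
    have h4 : (1 + ρ) / 2 * Y ≤ (1 + ρ) / 2 * (β ^ 2 * (2 / (1 - ρ) ^ 2 * V)) :=
      mul_le_mul_of_nonneg_left ih (by linarith [hW.pos])
    have h5 : (1 + ρ) / 2 * (β ^ 2 * (2 / (1 - ρ) ^ 2 * V)) + β ^ 2 / (1 - ρ) * V
        = β ^ 2 * (2 / (1 - ρ) ^ 2 * V) := by field_simp; ring
    have h6 : β ^ 2 / (1 - ρ) * V = β ^ 2 / (1 - ρ) * (4 * c.Lg1 ^ 2 * C)
      + β ^ 2 / (1 - ρ) * (4 * n * c.δ ^ 2 + 2 * (n * c.σg1 ^ 2)) := by rw [hV]; ring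
    nlinarith
  have inner : ∀ k, D.consY S P α β γ T N k 0 ≤ β ^ 2 * (2 / (1 - ρ) ^ 2 * V) →
      ∀ t, D.consY S P α β γ T N k t ≤ β ^ 2 * (2 / (1 - ρ) ^ 2 * V) := by
    intro k h0 t
    induction t with
    | zero => exact h0
    | succ t ih => exact step k t ih
  suffices h0 : ∀ k, D.consY S P α β γ T N k 0 ≤ β ^ 2 * (2 / (1 - ρ) ^ 2 * V) from
    inner k (h0 k) t
  intro k
  induction k with
  | zero =>
    simp only [consY, runInner_zero, run_zero]
    simp [sqNorm, dev, agentAvg]; positivity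
  | succ k ih => exact inner k ih T

end DSBOProblem

lemma integrable_fun_sub {Ω : Type*} [MeasurableSpace Ω] {P : Measure Ω} {f g : Ω → ℝ}
    (hf : Integrable f P) (hg : Integrable g P) : Integrable (fun ω => f ω - g ω) P :=
  hf.sub hg

namespace DSBOProblem

variable {n p q : ℕ} {Ξ Ψ Ω : Type*} [MeasurableSpace Ξ] [MeasurableSpace Ψ] [MeasurableSpace Ω]
  {D : DSBOProblem n p q Ξ Ψ} {S : DSBOSamples n Ξ Ψ Ω} {P : Measure Ω}
  [IsProbabilityMeasure P] {α β γ : ℝ} {T N : ℕ} {c : DSBOConstants} {U b ρ : ℝ}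

/-! #### Tracking of the lower level solution -/

lemma memLp_lowerDist (hn : 0 < n) (h : D.IsSmooth c) (hO : D.HasOracles c)
    (hS : S.IsIndependentSampling D P) (hE : D.IsGoodEstimator S P γ N U b) (k t : ℕ) :
    MemLp (fun ω => agentAvg (D.runInner S α β γ T N k t ω)
      - D.yStar (D.avgX S α β γ T N k ω)) 2 P :=
  (memLp_agentAvg (memLp_inner h hO hS hE k t)).sub
    (h.memLp_yStar hn (memLp_avgX h hO hS hE k))

lemma lowerErr_nonneg (k t : ℕ) : 0 ≤ D.lowerErr S P α β γ T N k t :=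
  integral_nonneg fun _ => by positivity

lemma integral_norm_avg_sq_le (hn : 0 < n) {E : Type*} [NormedAddCommGroup E]
    [InnerProductSpace ℝ E] {v : Ω → Fin n → E} (hv : ∀ i, MemLp (fun ω => v ω i) 2 P) {s : ℝ}
    (hs : ∀ i, ∫ ω, ‖v ω i‖ ^ 2 ∂P ≤ s) : ∫ ω, ‖agentAvg (v ω)‖ ^ 2 ∂P ≤ s := by
  have hn' : (0 : ℝ) < n := by exact_mod_cast hn
  have h1 := integral_mono (((memLp_agentAvg hv).integrable_norm_pow two_ne_zero).const_mul (n : ℝ))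
    (integrable_sqNorm hv) fun ω => norm_agentAvg_sq_le hn (v ω)
  rw [integral_const_mul, integral_sqNorm hv] at h1
  have h2 : ∑ i, ∫ ω, ‖v ω i‖ ^ 2 ∂P ≤ n * s :=
    (Finset.sum_le_sum fun i _ => hs i).trans_eq (by simp)
  exact le_of_mul_le_mul_left (h1.trans h2) hn'

lemma lowerErr_succ_le (hn : 0 < n) (h : D.IsSmooth c) (hW : IsGossip D.W ρ)
    (hO : D.HasOracles c) (hS : S.IsIndependentSampling D P)
    (hE : D.IsGoodEstimator S P γ N U b) (hβ : 0 < β) (hβL : β * c.Lg1 ^ 2 ≤ c.μg) (k t : ℕ) :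
    D.lowerErr S P α β γ T N k (t + 1)
      ≤ (1 - β * c.μg / 2) * D.lowerErr S P α β γ T N k t
        + (β ^ 2 + 2 * β / c.μg) * (c.Lg1 ^ 2 *
          (D.consX S P α β γ T N k + D.consY S P α β γ T N k t)) + β ^ 2 * c.σg1 ^ 2 := by
  have hx := (memLp_run (α := α) (β := β) (T := T) h hO hS hE k).1
  have hy := memLp_inner (α := α) (β := β) (T := T) h hO hS hE k t
  have hd := memLp_lowerDist (α := α) (β := β) (T := T) hn h hO hS hE k t
  set a : (Fin n → EuclideanSpace ℝ (Fin p)) × (Fin n → EuclideanSpace ℝ (Fin q)) →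
    EuclideanSpace ℝ (Fin q) := fun X => agentAvg X.2 - D.yStar (agentAvg X.1)
      - β • agentAvg (D.lowerGrad (points X.1 X.2)) with ha
  set G : (Fin n → EuclideanSpace ℝ (Fin p)) × (Fin n → EuclideanSpace ℝ (Fin q)) →
    (Fin n → Ξ) → EuclideanSpace ℝ (Fin q) :=
      fun X ξ => (-β) • agentAvg (D.lowerNoise X ξ) with hG
  have hm1 : Measurable fun X : (Fin n → EuclideanSpace ℝ (Fin p)) ×
      (Fin n → EuclideanSpace ℝ (Fin q)) => D.lowerGrad (points X.1 X.2) :=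
    measurable_pi_lambda _ fun i => (sndJoint p q).continuous.measurable.comp
      ((h.continuous_gradient_g i).measurable.comp ((measurable_pi_apply i).comp
        (measurable_points measurable_fst measurable_snd)))
  have ham : Measurable a :=
    ((measurable_agentAvg measurable_snd).sub ((h.continuous_yStar hn).measurable.comp
      (measurable_agentAvg measurable_fst))).sub ((measurable_agentAvg hm1).const_smul β)
  have hGm : Measurable (Function.uncurry G) :=
    (measurable_agentAvg (measurable_lowerNoise h hO)).const_smul (-β)
  have hai : MemLp (fun ω => a ((D.run S α β γ T N k ω).x, D.runInner S α β γ T N k t ω)) 2 P :=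
    hd.sub ((memLp_agentAvg (memLp_lowerGrad h hx hy)).const_smul β)
  have key := integral_norm_add_fresh_sq_le
    ((measurable_run' hO hS k).1.prodMk (measurable_runInner' hO hS k t))
    (measurable_lowerSample hS k t)
    (indepFun_lower (α := α) (β := β) (γ := γ) (T := T) (N := N) hO hS k t) hGm ham hai
    (v := fun _ => β ^ 2 * c.σg1 ^ 2)
    (fun X => (memLp_agentAvg (memLp_lowerNoise hO hS k t X)).const_smul (-β))
    (fun X => by
      simp only [hG]
      rw [integral_smul, integral_agentAvg fun i =>
        (memLp_lowerNoise hO hS k t X i).integrable one_le_two]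
      simp only [integral_lowerNoise hO hS k t X, agentAvg_const hn, smul_zero])
    (fun X => by
      simp only [hG, norm_smul, mul_pow, norm_neg, Real.norm_eq_abs, sq_abs]
      rw [integral_const_mul]
      exact mul_le_mul_of_nonneg_left (integral_norm_avg_sq_le hn (memLp_lowerNoise hO hS k t X)
        (integral_norm_lowerNoise_sq_le hO hS k t X)) (sq_nonneg β))
    (integrable_const _)
  have e : D.lowerErr S P α β γ T N k (t + 1)
      = ∫ ω, ‖a ((D.run S α β γ T N k ω).x, D.runInner S α β γ T N k t ω)
        + G ((D.run S α β γ T N k ω).x, D.runInner S α β γ T N k t ω)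
          (fun i => S.lower k t i ω)‖ ^ 2 ∂P := by
    refine integral_congr_ae (ae_of_all _ fun ω => ?_)
    simp only [ha, hG]
    rw [runInner_succ_eq, agentAvg_sub, agentAvg_smul, agentAvg_add, hW.agentAvg_mix, avgX,
      smul_add, neg_smul]
    congr 2
    abel
  rw [e]
  refine key.trans ?_
  simp only [integral_const, probReal_univ, one_smul]
  refine add_le_add ?_ le_rfl
  have hi1 := integrable_sqNorm (memLp_dev hx)
  have hi2 := integrable_sqNorm (memLp_dev hy)
  have hi3 := hd.integrable_norm_pow two_ne_zero
  have h2 := integral_mono (hai.integrable_norm_pow two_ne_zero)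
    ((hi3.const_mul (1 - β * c.μg / 2)).fun_add (((hi1.fun_add hi2).const_mul
      ((c.Lg1 : ℝ) ^ 2)).const_mul (β ^ 2 + 2 * β / c.μg)))
    fun ω => norm_lowerStep_sub_sq_le hn h hβ hβL (D.run S α β γ T N k ω).x
      (D.runInner S α β γ T N k t ω)
  refine h2.trans_eq ?_
  rw [integral_add (hi3.const_mul _) (((hi1.fun_add hi2).const_mul _).const_mul _),
    integral_const_mul, integral_const_mul, integral_const_mul, integral_add hi1 hi2]
  rfl

lemma lowerErr_inner_le (hn : 0 < n) (h : D.IsSmooth c) (hW : IsGossip D.W ρ)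
    (hO : D.HasOracles c) (hS : S.IsIndependentSampling D P)
    (hE : D.IsGoodEstimator S P γ N U b) (hβ : 0 < β) (hβL : β * c.Lg1 ^ 2 ≤ c.μg)
    (hβμ : β * c.μg ≤ 1) {Q : ℝ} (hQ : 0 ≤ Q)
    (hcons : ∀ k t, (β ^ 2 + 2 * β / c.μg) * (c.Lg1 ^ 2 *
      (D.consX S P α β γ T N k + D.consY S P α β γ T N k t)) + β ^ 2 * c.σg1 ^ 2 ≤ Q) (k t : ℕ) :
    D.lowerErr S P α β γ T N k (t + 1)
      ≤ (1 - β * c.μg / 2) * D.lowerErr S P α β γ T N k 0 + (t + 1) * Q := by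
  have hμ := c.μg_pos
  have hc0 : 0 < β * c.μg := by positivity
  have h1 : ∀ t, D.lowerErr S P α β γ T N k (t + 1)
      ≤ (1 - β * c.μg / 2) * D.lowerErr S P α β γ T N k t + Q := fun t => by
    linarith [lowerErr_succ_le (α := α) (T := T) hn h hW hO hS hE hβ hβL k t, hcons k t]
  induction t with
  | zero => simpa using h1 0
  | succ t ih =>
    have h2 := h1 (t + 1)
    have h3 := lowerErr_nonneg (D := D) (S := S) (P := P) (α := α) (β := β) (γ := γ) (T := T)
      (N := N) k (t + 1)
    push_cast
    nlinarith

/-- The drift of `y*(x̄_k)` between outer iterations is controlled by `α² E‖r̄_k‖²`. -/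
lemma lowerErr_start_succ_le (hn : 0 < n) (h : D.IsSmooth c) (hW : IsGossip D.W ρ)
    (hO : D.HasOracles c) (hS : S.IsIndependentSampling D P)
    (hE : D.IsGoodEstimator S P γ N U b) {s : ℝ} (hs : 0 < s) (k : ℕ) :
    D.lowerErr S P α β γ T N (k + 1) 0 ≤ (1 + s) * D.lowerErr S P α β γ T N k T
      + (1 + 1 / s) * (c.yLip ^ 2 * α ^ 2 * D.momAvgR S P α β γ T N k) := by
  have hi1 := (memLp_lowerDist (α := α) (β := β) (T := T) hn h hO hS hE k T).integrable_norm_pow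
    two_ne_zero
  have hi2 := (memLp_avgR (α := α) (β := β) (T := T) h hO hS hE k).integrable_norm_pow two_ne_zero
  have h2 := integral_mono
    ((memLp_lowerDist (α := α) (β := β) (T := T) hn h hO hS hE (k + 1) 0).integrable_norm_pow
      two_ne_zero)
    ((hi1.const_mul (1 + s)).fun_add ((hi2.const_mul (c.yLip ^ 2 * α ^ 2)).const_mul (1 + 1 / s)))
    fun ω => by
      have e : D.avgX S α β γ T N (k + 1) ω
        = D.avgX S α β γ T N k ω - α • D.avgR S α β γ T N k ω := avgX_succ hW k ω
      rw [e, runInner_zero, run_y_succ]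
      exact norm_sub_yStar_drift_sq_le hn h hs α _ _ _
  refine h2.trans_eq ?_
  rw [integral_add (hi1.const_mul _) ((hi2.const_mul _).const_mul _), integral_const_mul,
    integral_const_mul, integral_const_mul]
  rfl

lemma meanErr_le (hn : 0 < n) (h : D.IsSmooth c) (hO : D.HasOracles c)
    (hS : S.IsIndependentSampling D P) (hE : D.IsGoodEstimator S P γ N U b) (k : ℕ) :
    D.meanErr S P α β γ T N k ≤ 2 * b + 2 * (c.hypLip ^ 2 * (D.consX S P α β γ T N k
      + D.consY S P α β γ T N k T + n * D.lowerErr S P α β γ T N k T)) := by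
  have hi1 := integrable_sqNorm (memLp_dev (memLp_run (α := α) (β := β) (T := T) h hO hS hE k).1)
  have hi2 := integrable_sqNorm (memLp_dev (memLp_inner (α := α) (β := β) (T := T) h hO hS hE k T))
  have hi3 := (memLp_lowerDist (α := α) (β := β) (T := T) hn h hO hS hE k T).integrable_norm_pow
    two_ne_zero
  have hi := (hi1.fun_add hi2).fun_add (hi3.const_mul (n : ℝ))
  have h2 := integral_mono
    (((memLp_avgMean (α := α) (β := β) (T := T) hn h hO hS hE k).sub
      (h.memLp_gradient_Phi hn (memLp_avgX (α := α) (β := β) (T := T) h hO hS hE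
        k).aestronglyMeasurable)).integrable_norm_pow two_ne_zero)
    ((integrable_const (2 * b)).fun_add ((hi.const_mul (c.hypLip ^ 2)).const_mul 2))
    fun ω => by
      have h3 := norm_add_sq_le_two
        (D.avgMean S α β γ T N k ω - D.hyp (points (D.run S α β γ T N k ω).x
          (D.runInner S α β γ T N k T ω)))
        (D.hyp (points (D.run S α β γ T N k ω).x (D.runInner S α β γ T N k T ω))
          - gradient D.Phi (D.avgX S α β γ T N k ω))
      rw [sub_add_sub_cancel] at h3
      refine h3.trans (add_le_add ?_ ?_)
      · exact mul_le_mul_of_nonneg_left (hE.bias _) zero_le_two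
      · exact mul_le_mul_of_nonneg_left (norm_hyp_points_sub_sq_le hn h _ _) zero_le_two
  refine h2.trans_eq ?_
  rw [integral_add (integrable_const _) ((hi.const_mul _).const_mul _), integral_const_mul,
    integral_const_mul 2, integral_const_mul (c.hypLip ^ 2),
    integral_add (hi1.fun_add hi2) (hi3.const_mul _), integral_add hi1 hi2, integral_const_mul]
  simp only [integral_const, probReal_univ, one_smul]
  rfl

/-! #### Descent of the objective and error of the moving average -/

lemma momAvgR_nonneg (k : ℕ) : 0 ≤ D.momAvgR S P α β γ T N k :=
  integral_nonneg fun _ => by positivity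

lemma gradErr_nonneg (k : ℕ) : 0 ≤ D.gradErr S P α β γ T N k :=
  integral_nonneg fun _ => by positivity

lemma momAvgR_le_momR (hn : 0 < n) (h : D.IsSmooth c) (hO : D.HasOracles c)
    (hS : S.IsIndependentSampling D P) (hE : D.IsGoodEstimator S P γ N U b) (k : ℕ) :
    D.momAvgR S P α β γ T N k ≤ D.momR S P α β γ T N k :=
  integral_mono ((memLp_avgR h hO hS hE k).integrable_norm_pow two_ne_zero)
    (integrable_sqNorm (memLp_run h hO hS hE k).2.1) fun _ => norm_agentAvg_sq_le' hn _

/-- The hypergradient estimates minus their conditional mean, averaged over the agents. -/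
def estimateNoise (D : DSBOProblem n p q Ξ Ψ) (γ : ℝ) (N : ℕ)
    (X : (Fin n → EuclideanSpace ℝ (Fin p)) × (Fin n → EuclideanSpace ℝ (Fin p)) ×
      (Fin n → EuclideanSpace ℝ (Fin q))) (B : (ℕ → Fin n → Ξ) × (ℕ → Fin n → Ψ)) :
    EuclideanSpace ℝ (Fin p) :=
  agentAvg (D.estimate γ N (points X.1 X.2.2) B) - agentAvg (D.meanEstimate γ N (points X.1 X.2.2))

lemma measurable_estimateNoise (h : D.IsSmooth c) (hO : D.HasOracles c) :
    Measurable (Function.uncurry (D.estimateNoise γ N)) := by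
  have h1 : Measurable fun z : ((Fin n → EuclideanSpace ℝ (Fin p)) ×
      (Fin n → EuclideanSpace ℝ (Fin p)) × (Fin n → EuclideanSpace ℝ (Fin q))) ×
      ((ℕ → Fin n → Ξ) × (ℕ → Fin n → Ψ)) => points z.1.1 z.1.2.2 :=
    measurable_points (measurable_fst.comp measurable_fst)
      (measurable_snd.comp (measurable_snd.comp measurable_fst))
  have h2 := measurable_estimate (α := ((Fin n → EuclideanSpace ℝ (Fin p)) ×
      (Fin n → EuclideanSpace ℝ (Fin p)) × (Fin n → EuclideanSpace ℝ (Fin q))) ×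
      ((ℕ → Fin n → Ξ) × (ℕ → Fin n → Ψ))) (B := fun z => z.2) hO γ N h1
    (fun t j => (measurable_pi_apply j).comp ((measurable_pi_apply t).comp
      (measurable_fst.comp measurable_snd)))
    (fun t j => (measurable_pi_apply j).comp ((measurable_pi_apply t).comp
      (measurable_snd.comp measurable_snd)))
  exact (measurable_agentAvg h2).sub
    (measurable_agentAvg ((h.measurable_meanEstimate γ N).comp h1))

lemma memLp_estimateNoise (hE : D.IsGoodEstimator S P γ N U b) (k : ℕ)
    (X : (Fin n → EuclideanSpace ℝ (Fin p)) × (Fin n → EuclideanSpace ℝ (Fin p)) ×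
      (Fin n → EuclideanSpace ℝ (Fin q))) :
    MemLp (fun ω => D.estimateNoise γ N X (S.block k ω)) 2 P :=
  (memLp_agentAvg (hE.memLp k _)).sub (memLp_const _)

lemma integral_estimateNoise (hE : D.IsGoodEstimator S P γ N U b) (k : ℕ)
    (X : (Fin n → EuclideanSpace ℝ (Fin p)) × (Fin n → EuclideanSpace ℝ (Fin p)) ×
      (Fin n → EuclideanSpace ℝ (Fin q))) :
    ∫ ω, D.estimateNoise γ N X (S.block k ω) ∂P = 0 := by
  have h1 := (memLp_agentAvg (hE.memLp k (points X.1 X.2.2))).integrable one_le_two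
  refine (integral_sub h1 (integrable_const _)).trans ?_
  rw [integral_agentAvg fun i => (hE.memLp k _ i).integrable one_le_two]
  simp only [integral_const, probReal_univ, one_smul, hE.mean k]
  exact sub_self _

lemma integral_norm_estimateNoise_sq_le (hn : 0 < n) (h : D.IsSmooth c)
    (hE : D.IsGoodEstimator S P γ N U b) (k : ℕ)
    (X : (Fin n → EuclideanSpace ℝ (Fin p)) × (Fin n → EuclideanSpace ℝ (Fin p)) ×
      (Fin n → EuclideanSpace ℝ (Fin q))) :
    ∫ ω, ‖D.estimateNoise γ N X (S.block k ω)‖ ^ 2 ∂P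
      ≤ 2 * U + 4 * (b + c.hypBound ^ 2) := by
  have hi := (memLp_agentAvg (hE.memLp k (points X.1 X.2.2))).integrable_norm_pow two_ne_zero
  have h1 := integral_mono ((memLp_estimateNoise hE k X).integrable_norm_pow two_ne_zero)
    ((hi.const_mul 2).fun_add (integrable_const (4 * (b + c.hypBound ^ 2)))) fun ω => by
      refine (norm_sub_sq_le_two _ _).trans (add_le_add le_rfl ?_)
      linarith [norm_avg_meanEstimate_sq_le hn h hE (points X.1 X.2.2)]
  refine h1.trans ?_
  rw [integral_add (hi.const_mul 2) (integrable_const _), integral_const_mul]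
  simp only [integral_const, probReal_univ, one_smul]
  linarith [integral_norm_avg_sq_le hn (hE.memLp k (points X.1 X.2.2))
    (hE.second_moment k (points X.1 X.2.2))]

/-- The noise of the hypergradient estimates is orthogonal to `r̄_k`. -/
lemma integral_inner_avgR_avgEstimate (hn : 0 < n) (h : D.IsSmooth c) (hO : D.HasOracles c)
    (hS : S.IsIndependentSampling D P) (hE : D.IsGoodEstimator S P γ N U b) (k : ℕ) :
    ∫ ω, inner ℝ (D.avgR S α β γ T N k ω) (agentAvg (D.estimate γ N
      (points (D.run S α β γ T N k ω).x (D.runInner S α β γ T N k T ω)) (S.block k ω))) ∂P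
      = ∫ ω, inner ℝ (D.avgR S α β γ T N k ω) (D.avgMean S α β γ T N k ω) ∂P := by
  have hr := memLp_avgR (α := α) (β := β) (T := T) h hO hS hE k
  have hm := memLp_avgMean (α := α) (β := β) (T := T) hn h hO hS hE k
  have hu := memLp_avgEstimate (α := α) (β := β) (T := T) hO hS hE k
  have key := integral_inner_fresh_eq_zero
    ((measurable_run' hO hS k).1.prodMk
      ((measurable_run' hO hS k).2.1.prodMk (measurable_runInner' hO hS k T)))
    (measurable_block hS k)
    (indepFun_block (α := α) (β := β) (γ := γ) (T := T) (N := N) hO hS k)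
    (measurable_estimateNoise (γ := γ) (N := N) h hO) (a := fun X => agentAvg X.2.1)
    (measurable_agentAvg (measurable_fst.comp measurable_snd)) hr (hu.sub hm)
    (fun X => (memLp_estimateNoise hE k X).integrable one_le_two)
    (fun X => integral_estimateNoise hE k X)
  have hi1 := hr.integrable_inner_two hu
  have hi2 := hr.integrable_inner_two hm
  rw [← sub_eq_zero, ← integral_sub hi1 hi2, ← key]
  refine integral_congr_ae (ae_of_all _ fun ω => ?_)
  exact (inner_sub_right _ _ _).symm

/-- Expected decrease of `Φ(x̄_k) + ‖r̄_k‖²/2`. -/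
lemma expPhi_succ_add_le (hn : 0 < n) (h : D.IsSmooth c) (hW : IsGossip D.W ρ)
    (hO : D.HasOracles c) (hS : S.IsIndependentSampling D P)
    (hE : D.IsGoodEstimator S P γ N U b) (hα : 0 < α) (k : ℕ) :
    D.expPhi S P α β γ T N (k + 1) + D.momAvgR S P α β γ T N (k + 1) / 2
      ≤ D.expPhi S P α β γ T N k + D.momAvgR S P α β γ T N k / 2
        - α / 2 * D.momAvgR S P α β γ T N k + α / 2 * D.meanErr S P α β γ T N k
        + α ^ 2 * (U + (1 + c.phiLip) * D.momAvgR S P α β γ T N k) := by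
  have hx := memLp_avgX (α := α) (β := β) (T := T) h hO hS hE k
  have hr := memLp_avgR (α := α) (β := β) (T := T) h hO hS hE k
  have hm := memLp_avgMean (α := α) (β := β) (T := T) hn h hO hS hE k
  have hu := memLp_avgEstimate (α := α) (β := β) (T := T) hO hS hE k
  have hd : Integrable (fun ω => ‖D.avgMean S α β γ T N k ω
      - gradient D.Phi (D.avgX S α β γ T N k ω)‖ ^ 2) P :=
    (hm.sub (h.memLp_gradient_Phi hn hx.aestronglyMeasurable)).integrable_norm_pow two_ne_zero
  have hΦ := h.integrable_Phi hn hx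
  have hrr := hr.integrable_norm_pow two_ne_zero
  have huu := hu.integrable_norm_pow two_ne_zero
  have hi1 := hr.integrable_inner_two hu
  have hi2 := hr.integrable_inner_two hm
  have j1 := integrable_fun_sub hΦ (hi2.const_mul α)
  have j2 := j1.fun_add (hd.const_mul (α / 2))
  have j3 := j2.fun_add (hrr.const_mul (α / 2))
  have h1 := integral_mono
    (h.integrable_Phi hn (memLp_avgX (α := α) (β := β) (T := T) h hO hS hE (k + 1)))
    (j3.fun_add (hrr.const_mul (α ^ 2 * c.phiLip))) fun ω =>
      (congrArg D.Phi (avgX_succ hW k ω)).trans_le (Phi_sub_smul_le hn h hα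
        (D.avgX S α β γ T N k ω) (D.avgR S α β γ T N k ω) (D.avgMean S α β γ T N k ω))
  rw [integral_add j3 (hrr.const_mul _), integral_add j2 (hrr.const_mul _),
    integral_add j1 (hd.const_mul _), integral_sub hΦ (hi2.const_mul α)] at h1
  simp only [integral_const_mul] at h1
  have j4 := hrr.fun_add (hi1.const_mul (2 * α))
  have j5 := integrable_fun_sub j4 (hrr.const_mul (2 * α))
  have j6 := ((huu.const_mul 2).fun_add (hrr.const_mul 2))
  have h2 := integral_mono
    ((memLp_avgR (α := α) (β := β) (T := T) h hO hS hE (k + 1)).integrable_norm_pow two_ne_zero)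
    (j5.fun_add (j6.const_mul (α ^ 2))) fun ω =>
      (congrArg (fun v => ‖v‖ ^ 2) (avgR_succ k ω)).trans_le (norm_sq_moving_avg_le α _ _)
  rw [integral_add j5 (j6.const_mul _), integral_sub j4 (hrr.const_mul _),
    integral_add hrr (hi1.const_mul _), integral_const_mul (α ^ 2),
    integral_add (huu.const_mul 2) (hrr.const_mul 2)] at h2
  simp only [integral_const_mul] at h2
  rw [integral_inner_avgR_avgEstimate hn h hO hS hE k] at h2
  have h3 : ∫ ω, ‖agentAvg (D.estimate γ N (points (D.run S α β γ T N k ω).x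
      (D.runInner S α β γ T N k T ω)) (S.block k ω))‖ ^ 2 ∂P ≤ U :=
    integral_norm_avg_sq_le hn (fun i => (memLp_runEstimate hO hS hE k i).1)
      fun i => (memLp_runEstimate hO hS hE k i).2
  have h4 := mul_le_mul_of_nonneg_left h3 (sq_nonneg α)
  unfold expPhi momAvgR meanErr
  linarith

/-- Error recursion of the moving average. -/
lemma gradErr_succ_le (hn : 0 < n) (h : D.IsSmooth c) (hW : IsGossip D.W ρ)
    (hO : D.HasOracles c) (hS : S.IsIndependentSampling D P)
    (hE : D.IsGoodEstimator S P γ N U b) (hα : 0 < α) (hα1 : α ≤ 1) (k : ℕ) :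
    D.gradErr S P α β γ T N (k + 1) ≤ (1 - α) * D.gradErr S P α β γ T N k
      + 2 * α * D.meanErr S P α β γ T N k + 2 * α * c.phiLip ^ 2 * D.momAvgR S P α β γ T N k
      + α ^ 2 * (2 * U + 4 * (b + c.hypBound ^ 2)) := by
  have hx := memLp_avgX (α := α) (β := β) (T := T) h hO hS hE k
  have hr := memLp_avgR (α := α) (β := β) (T := T) h hO hS hE k
  have hm := memLp_avgMean (α := α) (β := β) (T := T) hn h hO hS hE k
  have hg := h.memLp_gradient_Phi hn hx.aestronglyMeasurable
  set a : (Fin n → EuclideanSpace ℝ (Fin p)) × (Fin n → EuclideanSpace ℝ (Fin p)) ×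
      (Fin n → EuclideanSpace ℝ (Fin q)) → EuclideanSpace ℝ (Fin p) := fun X =>
    (1 - α) • agentAvg X.2.1 + α • agentAvg (D.meanEstimate γ N (points X.1 X.2.2))
      - gradient D.Phi (agentAvg X.1 - α • agentAvg X.2.1) with ha
  have hX : Measurable fun ω => ((D.run S α β γ T N k ω).x, (D.run S α β γ T N k ω).r,
      D.runInner S α β γ T N k T ω) := (measurable_run' hO hS k).1.prodMk
      ((measurable_run' hO hS k).2.1.prodMk (measurable_runInner' hO hS k T))
  have hm2 : Measurable fun X : (Fin n → EuclideanSpace ℝ (Fin p)) ×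
      (Fin n → EuclideanSpace ℝ (Fin p)) × (Fin n → EuclideanSpace ℝ (Fin q)) => agentAvg X.2.1 :=
    measurable_agentAvg (measurable_fst.comp measurable_snd)
  have ham : Measurable a :=
    ((hm2.const_smul (1 - α)).add ((measurable_agentAvg ((h.measurable_meanEstimate γ N).comp
      (measurable_points measurable_fst (measurable_snd.comp measurable_snd)))).const_smul α)).sub
      ((h.continuous_gradient_Phi hn).measurable.comp
        ((measurable_agentAvg measurable_fst).sub (hm2.const_smul α)))
  have hai : MemLp (fun ω => a ((D.run S α β γ T N k ω).x, (D.run S α β γ T N k ω).r,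
      D.runInner S α β γ T N k T ω)) 2 P :=
    ((hr.const_smul (1 - α)).add (hm.const_smul α)).sub
      (h.memLp_gradient_Phi hn (hx.sub (hr.const_smul α)).aestronglyMeasurable)
  have key := integral_norm_add_fresh_sq_le hX (measurable_block hS k)
    (indepFun_block (α := α) (β := β) (γ := γ) (T := T) (N := N) hO hS k)
    (G := fun X B => α • D.estimateNoise γ N X B)
    ((measurable_estimateNoise (γ := γ) (N := N) h hO).const_smul α) ham hai
    (v := fun _ => α ^ 2 * (2 * U + 4 * (b + c.hypBound ^ 2)))
    (fun X => (memLp_estimateNoise hE k X).const_smul α)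
    (fun X => by rw [integral_smul, integral_estimateNoise hE k X, smul_zero])
    (fun X => by
      simp only [norm_smul, mul_pow, Real.norm_eq_abs, sq_abs]
      rw [integral_const_mul]
      exact mul_le_mul_of_nonneg_left (integral_norm_estimateNoise_sq_le hn h hE k X)
        (sq_nonneg α))
    (integrable_const _)
  have e : D.gradErr S P α β γ T N (k + 1)
      = ∫ ω, ‖a ((D.run S α β γ T N k ω).x, (D.run S α β γ T N k ω).r,
          D.runInner S α β γ T N k T ω) + α • D.estimateNoise γ N
          ((D.run S α β γ T N k ω).x, (D.run S α β γ T N k ω).r,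
          D.runInner S α β γ T N k T ω) (S.block k ω)‖ ^ 2 ∂P := by
    refine integral_congr_ae (ae_of_all _ fun ω => ?_)
    simp only [ha, estimateNoise]
    rw [avgX_succ hW, avgR_succ, smul_sub]
    simp only [avgX, avgR]
    congr 2
    abel
  rw [e]
  refine key.trans ?_
  simp only [integral_const, probReal_univ, one_smul]
  refine add_le_add ?_ le_rfl
  have hi1 := (hr.sub hg).integrable_norm_pow two_ne_zero
  have hi2 := (hm.sub hg).integrable_norm_pow two_ne_zero
  have hi3 := hr.integrable_norm_pow two_ne_zero
  have j1 := (hi1.const_mul (1 - α)).fun_add (hi2.const_mul (2 * α))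
  have h2 := integral_mono (hai.integrable_norm_pow two_ne_zero)
    (j1.fun_add (hi3.const_mul (2 * α * c.phiLip ^ 2))) fun ω =>
      norm_gradErr_step_sq_le hn h hα hα1 (D.avgX S α β γ T N k ω) (D.avgR S α β γ T N k ω)
        (D.avgMean S α β γ T N k ω)
  refine h2.trans_eq ?_
  rw [integral_add j1 (hi3.const_mul _), integral_add (hi1.const_mul _) (hi2.const_mul _)]
  simp only [integral_const_mul]
  rfl

end DSBOProblem

/-! ### Summing the recursions -/

/-- A contracting recursion bounds the sum of its terms. -/
lemma mul_sum_le_of_contraction {a s : ℕ → ℝ} {τ : ℝ} (ha : ∀ k, 0 ≤ a k)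
    (h : ∀ k, a (k + 1) ≤ (1 - τ) * a k + s k) (m : ℕ) :
    τ * ∑ k ∈ Finset.range m, a k ≤ a 0 + ∑ k ∈ Finset.range m, s k := by
  suffices H : τ * ∑ k ∈ Finset.range m, a k ≤ a 0 - a m + ∑ k ∈ Finset.range m, s k by
    linarith [ha m]
  induction m with
  | zero => simp
  | succ m ih =>
    rw [Finset.sum_range_succ, Finset.sum_range_succ]
    linarith [h m]

/-- The Lyapunov argument. `R` is the second moment of the search direction, `G` its error as an
estimator of the gradient, `M` the bias of the hypergradient estimates, `e` the tracking error of
the lower level, and `F` the expected objective. The condition `C₁ * s ≤ τ / 4` makes the feedback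
of the search direction through the tracking error small compared with the decrease of `F`. -/
lemma sum_le_of_recursions {α τ s q m C₁ v l w Fmin : ℝ} {R e M F G : ℕ → ℝ} (hα : 0 < α)
    (hτ : 0 < τ) (hC₁ : 0 ≤ C₁) (hs : C₁ * s ≤ τ / 4) (hR : ∀ k, 0 ≤ R k)
    (he : ∀ k, 0 ≤ e k) (hG : ∀ k, 0 ≤ G k) (hF : ∀ k, Fmin ≤ F k)
    (h1 : ∀ k, e (k + 1) ≤ (1 - τ) * e k + (s * R k + q))
    (h2 : ∀ k, M k ≤ m + C₁ * e k)
    (h3 : ∀ k, F (k + 1) + R (k + 1) / 2 ≤ F k + R k / 2 - α / 2 * R k + α / 2 * M k + v)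
    (h4 : ∀ k, G (k + 1) ≤ (1 - α) * G k + (2 * α * M k + l * α * R k + w)) (Z : ℕ) :
    α * ∑ k ∈ Finset.range Z, R k ≤ 4 / 3 * (2 * (F 0 + R 0 / 2 - Fmin)
      + (α * (Z * m) + α / τ * (C₁ * (e 0 + Z * q))) + 2 * (Z * v)) ∧
    α * ∑ k ∈ Finset.range Z, G k ≤ G 0 + 2 * (α * (Z * m) + α / τ * (C₁ * (e 0 + Z * q)))
      + (1 / 2 + l) * (α * ∑ k ∈ Finset.range Z, R k) + Z * w := by
  set sR := ∑ k ∈ Finset.range Z, R k with hsR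
  set sM := ∑ k ∈ Finset.range Z, M k with hsM
  set se := ∑ k ∈ Finset.range Z, e k with hse
  have hR0 : 0 ≤ sR := Finset.sum_nonneg fun k _ => hR k
  have s1 : τ * se ≤ e 0 + (s * sR + Z * q) := by
    have := mul_sum_le_of_contraction he h1 Z
    rwa [Finset.sum_add_distrib, ← Finset.mul_sum, Finset.sum_const, Finset.card_range,
      nsmul_eq_mul] at this
  have s2 : sM ≤ Z * m + C₁ * se := by
    refine (Finset.sum_le_sum fun k _ => h2 k).trans_eq ?_
    rw [Finset.sum_add_distrib, ← Finset.mul_sum, Finset.sum_const, Finset.card_range,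
      nsmul_eq_mul]
  have s3 : C₁ * se ≤ C₁ * (e 0 + Z * q) / τ + sR / 4 := by
    have e1 := mul_le_mul_of_nonneg_left s1 hC₁
    have e2 := mul_le_mul_of_nonneg_right hs hR0
    rw [← mul_le_mul_iff_right₀ hτ]
    have e3 : τ * (C₁ * (e 0 + Z * q) / τ + sR / 4) = C₁ * (e 0 + Z * q) + τ / 4 * sR := by
      field_simp
    rw [e3]
    linarith
  have s4 : α * sM ≤ (α * (Z * m) + α / τ * (C₁ * (e 0 + Z * q))) + α * sR / 4 := by
    have e1 := mul_le_mul_of_nonneg_left (s2.trans (add_le_add le_rfl s3)) hα.le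
    have e2 : α / τ * (C₁ * (e 0 + Z * q)) = α * (C₁ * (e 0 + Z * q) / τ) := by ring
    rw [e2]
    linarith
  have s5 : α / 2 * sR ≤ F 0 + R 0 / 2 - Fmin + α / 2 * sM + Z * v := by
    have H : ∀ Z : ℕ, α / 2 * ∑ k ∈ Finset.range Z, R k ≤ F 0 + R 0 / 2 - (F Z + R Z / 2)
        + α / 2 * ∑ k ∈ Finset.range Z, M k + Z * v := fun Z => by
      induction Z with
      | zero => simp
      | succ Z ih =>
        rw [Finset.sum_range_succ, Finset.sum_range_succ]
        push_cast
        linarith [h3 Z]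
    linarith [H Z, hF Z, hR Z]
  have s6 : α * ∑ k ∈ Finset.range Z, G k ≤ G 0 + (2 * α * sM + l * α * sR + Z * w) := by
    have := mul_sum_le_of_contraction hG h4 Z
    rwa [Finset.sum_add_distrib, Finset.sum_add_distrib, ← Finset.mul_sum, ← Finset.mul_sum,
      Finset.sum_const, Finset.card_range, nsmul_eq_mul] at this
  constructor <;> linarith

/-- The bounds of `sum_le_of_recursions` for step sizes with `α ≤ κ * β`, `β ^ 2 ≤ A * α ^ 2`, a
contraction factor `1 - β * μ / 4`, and perturbations of second order. -/
lemma exists_sum_bound_of_recursions (κ A E₀ G₀ Δ q m V W : ℝ) {μ C₁ l : ℝ} (hκ : 0 ≤ κ)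
    (hμ : 0 < μ) (hC₁ : 0 ≤ C₁) (hl : 0 ≤ l) (hq : 0 ≤ q) (hE₀ : 0 ≤ E₀) (hA : 0 ≤ A) :
    ∃ C : ℝ, ∀ {α β s Fmin : ℝ} {R e M F G : ℕ → ℝ}, 0 < α → α ≤ 1 → 0 < β → α ≤ κ * β →
      β ^ 2 ≤ A * α ^ 2 → C₁ * s ≤ β * μ / 4 / 4 → (∀ k, 0 ≤ R k) → (∀ k, 0 ≤ e k) →
      (∀ k, 0 ≤ G k) → (∀ k, Fmin ≤ F k) →
      (∀ k, e (k + 1) ≤ (1 - β * μ / 4) * e k + (s * R k + β ^ 2 * q)) →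
      (∀ k, M k ≤ α ^ 2 * m + C₁ * e k) →
      (∀ k, F (k + 1) + R (k + 1) / 2 ≤ F k + R k / 2 - α / 2 * R k + α / 2 * M k + α ^ 2 * V) →
      (∀ k, G (k + 1) ≤ (1 - α) * G k + (2 * α * M k + l * α * R k + α ^ 2 * W)) →
      e 0 ≤ E₀ → G 0 ≤ G₀ → F 0 + R 0 / 2 - Fmin ≤ Δ → ∀ Z : ℕ,
      α * ∑ k ∈ Finset.range Z, R k + α * ∑ k ∈ Finset.range Z, G k ≤ C * (1 + Z * α ^ 2) := by
  set X := |m| + 4 * κ / μ * (C₁ * (E₀ + q * A)) with hX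
  set CR := 4 / 3 * (2 * |Δ| + X + 2 * |V|) with hCR
  refine ⟨CR + (|G₀| + 2 * X + (1 / 2 + l) * CR + |W|), ?_⟩
  intro α β s Fmin R e M F G hα hα1 hβ hακ hβA hs hR he hG hF h1 h2 h3 h4 he0 hG0 hF0 Z
  obtain ⟨k1, k2⟩ := sum_le_of_recursions hα (show 0 < β * μ / 4 by positivity) hC₁ hs hR he hG hF
    h1 h2 h3 h4 Z
  have hZα : (0 : ℝ) ≤ Z * α ^ 2 := by positivity
  set Y := 1 + Z * α ^ 2 with hY
  have hY1 : 1 ≤ Y := by linarith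
  have hYZ : Z * α ^ 2 ≤ Y := by linarith
  have scale : ∀ a : ℝ, Z * (α ^ 2 * a) ≤ |a| * Y := fun a => by
    have f1 := mul_le_mul_of_nonneg_left (le_abs_self a) hZα
    have f2 := mul_le_mul_of_nonneg_right hYZ (abs_nonneg a)
    linarith
  have x1 : α * (Z * (α ^ 2 * m)) ≤ |m| * Y :=
    (mul_le_mul_of_nonneg_left (scale m) hα.le).trans
      (mul_le_of_le_one_left (by positivity) hα1)
  have x2 : α / (β * μ / 4) * (C₁ * (e 0 + Z * (β ^ 2 * q)))
      ≤ 4 * κ / μ * (C₁ * (E₀ + q * A)) * Y := by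
    have f1 : α / (β * μ / 4) ≤ 4 * κ / μ := by
      rw [div_le_div_iff₀ (by positivity) hμ]
      linarith [mul_le_mul_of_nonneg_right hακ hμ.le]
    have f2 : Z * (β ^ 2 * q) ≤ q * A * Y := by
      have g1 : (Z * q) * β ^ 2 ≤ (Z * q) * (A * α ^ 2) :=
        mul_le_mul_of_nonneg_left hβA (by positivity)
      have g2 : q * A * (Z * α ^ 2) ≤ q * A * Y := mul_le_mul_of_nonneg_left hYZ (by positivity)
      linarith
    have f3 : E₀ ≤ E₀ * Y := le_mul_of_one_le_right hE₀ hY1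
    have f4 : e 0 + Z * (β ^ 2 * q) ≤ (E₀ + q * A) * Y := by linarith
    refine (mul_le_mul f1 (mul_le_mul_of_nonneg_left f4 hC₁) (mul_nonneg hC₁ (add_nonneg (he 0)
      (by positivity))) (by positivity)).trans_eq ?_
    ring
  have x3 := scale V
  have x4 := scale W
  have x5 : F 0 + R 0 / 2 - Fmin ≤ |Δ| * Y :=
    (hF0.trans (le_abs_self _)).trans (le_mul_of_one_le_right (abs_nonneg _) hY1)
  have x6 : G 0 ≤ |G₀| * Y :=
    (hG0.trans (le_abs_self _)).trans (le_mul_of_one_le_right (abs_nonneg _) hY1)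
  have x7 : α * (Z * (α ^ 2 * m)) + α / (β * μ / 4) * (C₁ * (e 0 + Z * (β ^ 2 * q))) ≤ X * Y := by
    rw [hX]; linarith
  have r1 : α * ∑ k ∈ Finset.range Z, R k ≤ CR * Y := by rw [hCR]; linarith
  have r2 := mul_le_mul_of_nonneg_left r1 (show 0 ≤ 1 / 2 + l by positivity)
  linarith

namespace DSBOConstants

variable (c : DSBOConstants)

/-- Bound on the ratio `α / β`: the upper level has to move slowly enough for the lower level to
track its solution. -/
def stepRatio (n : ℕ) : ℝ := c.μg / (1 + 80 * (2 * c.hypLip ^ 2 * n) * c.yLip ^ 2)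

lemma stepRatio_pos (n : ℕ) : 0 < c.stepRatio n := by
  have := c.μg_pos
  unfold stepRatio
  positivity

lemma stepRatio_sq_le (n : ℕ) :
    80 * (2 * c.hypLip ^ 2 * n) * c.yLip ^ 2 * c.stepRatio n ^ 2 ≤ c.μg ^ 2 := by
  have hμ := c.μg_pos
  rw [stepRatio]
  set a := 80 * (2 * c.hypLip ^ 2 * n) * c.yLip ^ 2 with ha
  have ha0 : 0 ≤ a := by positivity
  rw [div_pow, ← mul_div_assoc, div_le_iff₀ (by positivity), mul_comm]
  refine mul_le_mul_of_nonneg_left ?_ (by positivity)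
  nlinarith

end DSBOConstants

namespace DSBOProblem

variable {n p q : ℕ} {Ξ Ψ Ω : Type*} [MeasurableSpace Ξ] [MeasurableSpace Ψ] [MeasurableSpace Ω]
  {D : DSBOProblem n p q Ξ Ψ} {S : DSBOSamples n Ξ Ψ Ω} {P : Measure Ω}
  [IsProbabilityMeasure P] {α β γ : ℝ} {T N : ℕ} {c : DSBOConstants} {U b ρ : ℝ}

/-- The tracking error at the end of the inner loops: it contracts at rate `β μ / 4`, is fed by the
movement of the upper level iterate, and accumulates noise of order `β ^ 2` in each inner step. -/
lemma lowerErr_outer_le (hn : 0 < n) (h : D.IsSmooth c) (hW : IsGossip D.W ρ)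
    (hO : D.HasOracles c) (hS : S.IsIndependentSampling D P)
    (hE : D.IsGoodEstimator S P γ N U b) (hβ : 0 < β) (hβL : β * c.Lg1 ^ 2 ≤ c.μg)
    (hβμ : β * c.μg ≤ 1) (hT : 1 ≤ T) {Q : ℝ} (hQ : 0 ≤ Q)
    (hcons : ∀ k t, (β ^ 2 + 2 * β / c.μg) * (c.Lg1 ^ 2 *
      (D.consX S P α β γ T N k + D.consY S P α β γ T N k t)) + β ^ 2 * c.σg1 ^ 2 ≤ Q) (k : ℕ) :
    D.lowerErr S P α β γ T N (k + 1) T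
      ≤ (1 - β * c.μg / 4) * D.lowerErr S P α β γ T N k T
        + (5 * c.yLip ^ 2 * α ^ 2 / (β * c.μg) * D.momAvgR S P α β γ T N k + T * Q) := by
  have hμ := c.μg_pos
  obtain ⟨t, rfl⟩ : ∃ t, T = t + 1 := ⟨T - 1, by lia⟩
  set τ := β * c.μg with hτ
  have hτ0 : 0 < τ := by positivity
  have h1 := lowerErr_inner_le (α := α) (T := t + 1) hn h hW hO hS hE hβ hβL hβμ hQ hcons (k + 1) t
  have h2 := lowerErr_start_succ_le (α := α) (β := β) (T := t + 1) hn h hW hO hS hE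
    (show 0 < τ / 4 by positivity) k
  set E := D.lowerErr S P α β γ (t + 1) N k (t + 1) with hEdef
  set R := D.momAvgR S P α β γ (t + 1) N k with hR
  have hE0 : 0 ≤ E := lowerErr_nonneg k (t + 1)
  have hR0 : 0 ≤ R := momAvgR_nonneg k
  have h3 := mul_le_mul_of_nonneg_left h2 (show 0 ≤ 1 - τ / 2 by linarith)
  have h4 : (1 - τ / 2) * ((1 + τ / 4) * E) ≤ (1 - τ / 4) * E := by
    rw [← mul_assoc]
    exact mul_le_mul_of_nonneg_right (by nlinarith) hE0
  have h5 : (1 - τ / 2) * ((1 + 1 / (τ / 4)) * (c.yLip ^ 2 * α ^ 2 * R))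
      ≤ 5 * c.yLip ^ 2 * α ^ 2 / τ * R := by
    have e1 : 5 * c.yLip ^ 2 * α ^ 2 / τ * R = 5 / τ * (c.yLip ^ 2 * α ^ 2 * R) := by ring
    rw [e1, ← mul_assoc]
    refine mul_le_mul_of_nonneg_right ?_ (by positivity)
    have e2 : (1 - τ / 2) * (1 + 1 / (τ / 4)) = (4 - τ - τ ^ 2 / 2) / τ := by field_simp; ring
    rw [e2]
    exact div_le_div_of_nonneg_right (by nlinarith) hτ0.le
  push_cast
  linarith

lemma avgX_zero (ω : Ω) : D.avgX S α β γ T N 0 ω = 0 := by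
  simp [avgX, run_zero, agentAvg]

lemma avgR_zero (ω : Ω) : D.avgR S α β γ T N 0 ω = 0 := by
  simp [avgR, run_zero, agentAvg]

lemma lowerErr_zero_zero : D.lowerErr S P α β γ T N 0 0 = ‖D.yStar 0‖ ^ 2 := by
  simp [lowerErr, avgX_zero, runInner_zero, run_zero, agentAvg]

lemma integral_stationarity_le (hn : 0 < n) (h : D.IsSmooth c)
    (hO : D.HasOracles c) (hS : S.IsIndependentSampling D P)
    (hE : D.IsGoodEstimator S P γ N U b) (k : ℕ) :
    ∫ ω, D.stationarity S (fun _ => α) (fun _ => β) γ T N k ω ∂P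
      ≤ 2 * D.momAvgR S P α β γ T N k + 2 * D.gradErr S P α β γ T N k := by
  have hx := memLp_avgX (α := α) (β := β) (T := T) h hO hS hE k
  have hr := memLp_avgR (α := α) (β := β) (T := T) h hO hS hE k
  have hg := h.memLp_gradient_Phi hn hx.aestronglyMeasurable
  have i1 := hr.integrable_norm_pow two_ne_zero
  have i2 := (hr.sub hg).integrable_norm_pow two_ne_zero
  have h1 := integral_mono (hg.integrable_norm_pow two_ne_zero)
    ((i1.const_mul 2).fun_add (i2.const_mul 2)) fun ω => by
      have := norm_sub_sq_le_two (D.avgR S α β γ T N k ω)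
        (D.avgR S α β γ T N k ω - gradient D.Phi (D.avgX S α β γ T N k ω))
      rw [sub_sub_cancel] at this
      exact this
  rw [integral_add (i1.const_mul 2) (i2.const_mul 2), integral_const_mul, integral_const_mul] at h1
  exact h1

/-- The sum of the expected squared gradients, for step sizes of order `α` and bias of order
`α ^ 2`. -/
lemma exists_stationarity_sum_bound (hn : 0 < n) (h : D.IsSmooth c)
    (het : D.HasBoundedHeterogeneity c) (hW : IsGossip D.W ρ)
    (hO : D.HasOracles c) (hS : S.IsIndependentSampling D P) (hbdd : BddBelow (Set.range D.Phi))
    (hT : 1 ≤ T) (γ : ℝ) (hU : 0 ≤ U) (A B : ℝ) :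
    ∃ C : ℝ, ∀ (N Z : ℕ) (α β b : ℝ), D.IsGoodEstimator S P γ N U b → 0 < α → α ≤ 1 → 0 < β →
      β ≤ 1 → β * c.Lg1 ^ 2 ≤ c.μg → β * c.μg ≤ 1 → β ^ 2 * (8 * c.Lg1 ^ 2) ≤ (1 - ρ) ^ 2 →
      α ≤ c.stepRatio n * β → β ≤ A * α → 0 ≤ b → b ≤ B * α ^ 2 →
      α * ∑ k ∈ Finset.range Z, ∫ ω, D.stationarity S (fun _ => α) (fun _ => β) γ T N k ω ∂P
        ≤ C * (1 + Z * α ^ 2) := by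
  obtain ⟨Fmin, hFmin⟩ := hbdd
  have hμ := c.μg_pos
  have hρ : 0 < 1 - ρ := by linarith [hW.lt_one]
  set κ := c.stepRatio n with hκ
  have hκ0 : 0 < κ := c.stepRatio_pos n
  set Cx := n * U / (1 - ρ) ^ 2 with hCx
  have hCx0 : 0 ≤ Cx := by positivity
  set Cy := 2 / (1 - ρ) ^ 2 * (4 * c.Lg1 ^ 2 * Cx + (4 * n * c.δ ^ 2 + 2 * (n * c.σg1 ^ 2)))
    with hCy
  have hCy0 : 0 ≤ Cy := by positivity
  set Cq := (1 + 2 / c.μg) * (c.Lg1 ^ 2 * (κ ^ 2 * Cx + Cy)) + c.σg1 ^ 2 with hCq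
  have hCq0 : 0 ≤ Cq := by positivity
  set C₁ := 2 * c.hypLip ^ 2 * n with hC₁
  have hC₁0 : 0 ≤ C₁ := by positivity
  set Cm := 2 * B + 2 * (c.hypLip ^ 2 * (Cx + A ^ 2 * Cy)) with hCm
  set V := U + (1 + c.phiLip) * (n * U) with hV
  set W := 2 * U + 4 * (B + c.hypBound ^ 2) with hWdef
  obtain ⟨C, hC⟩ := exists_sum_bound_of_recursions κ (A ^ 2) (‖D.yStar 0‖ ^ 2 + T * Cq)
    (c.hypBound ^ 2) (D.Phi 0 - Fmin) (T * Cq) Cm V W hκ0.le hμ hC₁0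
    (show 0 ≤ 2 * c.phiLip ^ 2 by positivity) (by positivity) (by positivity) (sq_nonneg A)
  refine ⟨2 * C, ?_⟩
  intro N Z α β b hE hα hα1 hβ hβ1 hβL hβμ hβρ hακ hβA hb0 hb
  have hαβ2 : α ^ 2 ≤ κ ^ 2 * β ^ 2 := by
    rw [← mul_pow]; exact pow_le_pow_left₀ hα.le hακ 2
  have hβ2 : β ^ 2 ≤ A ^ 2 * α ^ 2 := by
    rw [← mul_pow]; exact pow_le_pow_left₀ hβ.le hβA 2
  have hα2 : α ^ 2 ≤ 1 := pow_le_one₀ hα.le hα1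
  have hβ21 : β ^ 2 ≤ 1 := pow_le_one₀ hβ.le hβ1
  have hcx : ∀ k, D.consX S P α β γ T N k ≤ α ^ 2 * Cx := fun k =>
    consX_le hn h hW hO hS hE hU hα.le hα1 k
  have hcy : ∀ k t, D.consY S P α β γ T N k t ≤ β ^ 2 * Cy := fun k t =>
    consY_le hn h het hW hO hS hE
      (fun k => (hcx k).trans (mul_le_of_le_one_left hCx0 hα2)) hβρ k t
  have hcons : ∀ k t, (β ^ 2 + 2 * β / c.μg) * (c.Lg1 ^ 2 *
      (D.consX S P α β γ T N k + D.consY S P α β γ T N k t)) + β ^ 2 * c.σg1 ^ 2 ≤ β ^ 2 * Cq := by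
    intro k t
    have e1 : D.consX S P α β γ T N k + D.consY S P α β γ T N k t
        ≤ β ^ 2 * (κ ^ 2 * Cx + Cy) := by
      have := mul_le_mul_of_nonneg_right hαβ2 hCx0
      linarith [hcx k, hcy k t]
    have e2 : β ^ 2 + 2 * β / c.μg ≤ 1 + 2 / c.μg := by
      have : 2 * β / c.μg ≤ 2 / c.μg := div_le_div_of_nonneg_right (by linarith) hμ.le
      linarith
    have e3 : (β ^ 2 + 2 * β / c.μg) * (c.Lg1 ^ 2 *
        (D.consX S P α β γ T N k + D.consY S P α β γ T N k t))
        ≤ (1 + 2 / c.μg) * (c.Lg1 ^ 2 * (β ^ 2 * (κ ^ 2 * Cx + Cy))) := by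
      refine mul_le_mul e2 (mul_le_mul_of_nonneg_left e1 (by positivity)) ?_ (by positivity)
      have := consX_nonneg (D := D) (S := S) (P := P) (α := α) (β := β) (γ := γ) (T := T) (N := N) k
      have := consY_nonneg (D := D) (S := S) (P := P) (α := α) (β := β) (γ := γ) (T := T) (N := N)
        k t
      positivity
    refine (add_le_add e3 le_rfl).trans_eq ?_
    rw [hCq]; ring
  have hq0 : 0 ≤ β ^ 2 * Cq := by positivity
  have hR : ∀ k, D.momAvgR S P α β γ T N k ≤ n * U := fun k =>
    (momAvgR_le_momR hn h hO hS hE k).trans (momR_le h hO hS hE hU hα.le hα1 k)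
  have key := hC (α := α) (β := β) (s := 5 * c.yLip ^ 2 * α ^ 2 / (β * c.μg)) (Fmin := Fmin)
    (R := D.momAvgR S P α β γ T N) (e := fun k => D.lowerErr S P α β γ T N k T)
    (M := D.meanErr S P α β γ T N) (F := D.expPhi S P α β γ T N) (G := D.gradErr S P α β γ T N)
    hα hα1 hβ hακ hβ2 ?_ momAvgR_nonneg (fun k => lowerErr_nonneg k T) gradErr_nonneg ?_
    (fun k => (lowerErr_outer_le hn h hW hO hS hE hβ hβL hβμ hT hq0 hcons k).trans_eq (by ring))
    ?_ ?_ ?_ ?_ ?_ ?_ Z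
  · have r3 := mul_le_mul_of_nonneg_left (Finset.sum_le_sum fun k (_ : k ∈ Finset.range Z) =>
      integral_stationarity_le (α := α) (β := β) (T := T) hn h hO hS hE k) hα.le
    rw [Finset.sum_add_distrib, ← Finset.mul_sum, ← Finset.mul_sum] at r3
    linarith
  · have e1 : C₁ * (5 * c.yLip ^ 2 * α ^ 2 / (β * c.μg))
        = (80 * C₁ * c.yLip ^ 2 * α ^ 2) / (16 * (β * c.μg)) := by field_simp; ring
    rw [e1, div_le_iff₀ (by positivity)]
    have e2 := mul_le_mul_of_nonneg_left hαβ2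
      (show 0 ≤ 80 * C₁ * c.yLip ^ 2 by positivity)
    have e3 := mul_le_mul_of_nonneg_right (c.stepRatio_sq_le n) (sq_nonneg β)
    linarith
  · intro k
    have := integral_mono (integrable_const Fmin) (h.integrable_Phi hn
      (memLp_avgX (α := α) (β := β) (T := T) h hO hS hE k)) fun ω =>
        hFmin (Set.mem_range_self (D.avgX S α β γ T N k ω))
    rw [integral_const, probReal_univ, one_smul] at this
    exact this
  · intro k
    refine (meanErr_le hn h hO hS hE k).trans ?_
    have e1 : D.consX S P α β γ T N k + D.consY S P α β γ T N k T
        ≤ α ^ 2 * (Cx + A ^ 2 * Cy) := by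
      have := mul_le_mul_of_nonneg_right hβ2 hCy0
      linarith [hcx k, hcy k T]
    have e2 := mul_le_mul_of_nonneg_left e1 (sq_nonneg c.hypLip)
    rw [hCm, hC₁]
    linarith
  · intro k
    have e1 := expPhi_succ_add_le (β := β) (T := T) hn h hW hO hS hE hα k
    have e2 := mul_le_mul_of_nonneg_left (hR k)
      (show 0 ≤ 1 + c.phiLip by linarith [c.phiLip_nonneg])
    have e3 := mul_le_mul_of_nonneg_left (add_le_add (le_refl U) e2) (sq_nonneg α)
    rw [hV]
    linarith
  · intro k
    have e1 := gradErr_succ_le (β := β) (T := T) hn h hW hO hS hE hα hα1 k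
    have e2 : b ≤ B := by
      have hB : 0 ≤ B := nonneg_of_mul_nonneg_left (hb0.trans hb) (by positivity)
      exact hb.trans (mul_le_of_le_one_right hB hα2)
    have e3 : α ^ 2 * (2 * U + 4 * (b + c.hypBound ^ 2)) ≤ α ^ 2 * W :=
      mul_le_mul_of_nonneg_left (by rw [hWdef]; linarith) (sq_nonneg α)
    linarith
  · obtain ⟨t, rfl⟩ : ∃ t, T = t + 1 := ⟨T - 1, by lia⟩
    have e1 := lowerErr_inner_le (α := α) (T := t + 1) hn h hW hO hS hE hβ hβL hβμ hq0 hcons 0 t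
    rw [lowerErr_zero_zero] at e1
    push_cast
    have e2 : ((t : ℝ) + 1) * (β ^ 2 * Cq) ≤ (t + 1) * Cq :=
      mul_le_mul_of_nonneg_left (mul_le_of_le_one_left hCq0 hβ21) (by positivity)
    have e3 : (1 - β * c.μg / 2) * ‖D.yStar 0‖ ^ 2 ≤ ‖D.yStar 0‖ ^ 2 :=
      mul_le_of_le_one_left (by positivity) (by linarith [mul_pos hβ hμ])
    linarith
  · simp only [gradErr, avgX_zero, avgR_zero, zero_sub, norm_neg, integral_const, probReal_univ,
      one_smul]
    exact pow_le_pow_left₀ (norm_nonneg _) (h.norm_gradient_Phi_le hn 0) 2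
  · simp [expPhi, momAvgR, avgX_zero, avgR_zero]

end DSBOProblem

/-! ### Rates -/

lemma minUpTo_le_avgUpTo (a : ℕ → ℝ) (K : ℕ) : minUpTo a K ≤ avgUpTo a K := by
  rw [avgUpTo, le_div_iff₀ (by positivity)]
  have h := Finset.card_nsmul_le_sum (Finset.range (K + 1)) a (minUpTo a K)
    fun k hk => Finset.inf'_le a hk
  rw [Finset.card_range, nsmul_eq_mul] at h
  push_cast at h
  linarith

lemma minUpTo_nonneg {a : ℕ → ℝ} (ha : ∀ k, 0 ≤ a k) (K : ℕ) : 0 ≤ minUpTo a K :=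
  Finset.le_inf' _ _ fun k _ => ha k

lemma avgUpTo_le {a : ℕ → ℝ} {C : ℝ} (h : ∀ k, a k ≤ C) (K : ℕ) : avgUpTo a K ≤ C := by
  rw [avgUpTo, div_le_iff₀ (by positivity)]
  refine (Finset.sum_le_sum fun k _ => h k).trans_eq ?_
  rw [Finset.sum_const, Finset.card_range, nsmul_eq_mul]
  push_cast
  ring

/-- A bound on the averages of nonnegative sequences also bounds their minima. -/
lemma isBigO_minUpTo_and_avgUpTo {a : ℕ → ℕ → ℝ} {f : ℕ → ℝ} {C : ℝ} (ha : ∀ K k, 0 ≤ a K k)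
    (h : ∀ᶠ K in atTop, avgUpTo (a K) K ≤ C * f K) :
    (fun K => minUpTo (a K) K) =O[atTop] f ∧ (fun K => avgUpTo (a K) K) =O[atTop] f := by
  have key : ∀ u : ℕ → ℝ, (∀ K, 0 ≤ u K) → (∀ K, u K ≤ avgUpTo (a K) K) → u =O[atTop] f := by
    intro u hu hua
    refine IsBigO.of_bound |C| ?_
    filter_upwards [h] with K hK
    rw [Real.norm_of_nonneg (hu K), Real.norm_eq_abs, ← abs_mul]
    exact ((hua K).trans hK).trans (le_abs_self _)
  exact ⟨key _ (fun K => minUpTo_nonneg (ha K) K) fun K => minUpTo_le_avgUpTo _ K,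
    key _ (fun K => (minUpTo_nonneg (ha K) K).trans (minUpTo_le_avgUpTo _ K)) fun K => le_rfl⟩

/-- Logarithmically many steps of a geometric decay reach precision `1 / K`. -/
lemma pow_le_inv_of_log_le {θ : ℝ} (hθ0 : 0 < θ) (hθ1 : θ < 1) {K N : ℕ} (hK : 0 < K)
    (hN : (-Real.log θ)⁻¹ * Real.log K ≤ N) : θ ^ N ≤ (K : ℝ)⁻¹ := by
  have hl : 0 < -Real.log θ := neg_pos.2 (Real.log_neg hθ0 hθ1)
  have hK' : (0 : ℝ) < K := by exact_mod_cast hK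
  rw [inv_mul_le_iff₀ hl] at hN
  rw [← Real.log_le_log_iff (by positivity) (by positivity), Real.log_pow, Real.log_inv]
  linarith

namespace DSBOProblem

variable {n p q : ℕ} {Ξ Ψ Ω : Type*} [MeasurableSpace Ξ] [MeasurableSpace Ψ] [MeasurableSpace Ω]
  {D : DSBOProblem n p q Ξ Ψ} {S : DSBOSamples n Ξ Ψ Ω} {P : Measure Ω}
  [IsProbabilityMeasure P] {α β γ : ℝ} {T N : ℕ} {c : DSBOConstants} {U b ρ : ℝ}

lemma integrable_stationarity (hn : 0 < n) (h : D.IsSmooth c) (hO : D.HasOracles c)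
    (hS : S.IsIndependentSampling D P) (hE : D.IsGoodEstimator S P γ N U b) (k : ℕ) :
    Integrable (D.stationarity S (fun _ => α) (fun _ => β) γ T N k) P :=
  (h.memLp_gradient_Phi hn (memLp_avgX (α := α) (β := β) (T := T) h hO hS hE
    k).aestronglyMeasurable).integrable_norm_pow two_ne_zero

lemma integrable_consensusError (h : D.IsSmooth c) (hO : D.HasOracles c)
    (hS : S.IsIndependentSampling D P) (hE : D.IsGoodEstimator S P γ N U b) (k : ℕ) :
    Integrable (D.consensusError S (fun _ => α) (fun _ => β) γ T N k) P :=
  (integrable_sqNorm (memLp_dev (memLp_run (α := α) (β := β) (T := T) h hO hS hE k).1)).div_const _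

lemma integral_consensusError (k : ℕ) :
    ∫ ω, D.consensusError S (fun _ => α) (fun _ => β) γ T N k ω ∂P
      = D.consX S P α β γ T N k / n :=
  integral_div _ _

end DSBOProblem

end

theorem theorem1 (n : ℕ) (hn : 0 < n) (c : DSBOConstants) :
    ∃ c₁ c₂ : ℝ, 0 < c₁ ∧ c₁ < c₂ ∧ ∀ γ ∈ Set.Ioo c₁ c₂,
    ∃ κ ν : ℝ, 0 < κ ∧ 0 < ν ∧
    ∀ (p q : ℕ) {Ξ Ψ Ω : Type*} [MeasurableSpace Ξ] [MeasurableSpace Ψ] [MeasurableSpace Ω]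
      (P : Measure Ω) [IsProbabilityMeasure P]
      (D : DSBOProblem n p q Ξ Ψ) (S : DSBOSamples n Ξ Ψ Ω),
      D.IsSmooth c → D.IsMixing c → D.HasBoundedHeterogeneity c → D.HasOracles c →
      S.IsIndependentSampling D P → BddBelow (Set.range D.Phi) →
      ∀ T : ℕ, 1 ≤ T →
      ∀ (α β : ℕ → ℝ) (N : ℕ → ℕ),
        (α =Θ[atTop] fun K : ℕ => 1 / Real.sqrt K) →
        (β =Θ[atTop] fun K : ℕ => 1 / Real.sqrt K) →
        ((fun K : ℕ => (N K : ℝ)) =Θ[atTop] fun K : ℕ => Real.log K) →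
        (∀ᶠ K : ℕ in atTop, 0 < α K ∧ 0 < β K ∧ α K ≤ κ * β K ∧ ν * Real.log K ≤ N K) →
        Differentiable ℝ D.Phi ∧
        (∀ K k : ℕ,
          Integrable (D.stationarity S (fun _ => α K) (fun _ => β K) γ T (N K) k) P ∧
          Integrable (D.consensusError S (fun _ => α K) (fun _ => β K) γ T (N K) k) P) ∧
        ((fun K : ℕ => minUpTo (fun k =>
            ∫ ω, D.stationarity S (fun _ => α K) (fun _ => β K) γ T (N K) k ω ∂P) K)
          =O[atTop] fun K : ℕ => 1 / Real.sqrt K) ∧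
        ((fun K : ℕ => minUpTo (fun k =>
            ∫ ω, D.consensusError S (fun _ => α K) (fun _ => β K) γ T (N K) k ω ∂P) K)
          =O[atTop] fun K : ℕ => 1 / (K : ℝ)) ∧
        ((fun K : ℕ => avgUpTo (fun k =>
            ∫ ω, D.stationarity S (fun _ => α K) (fun _ => β K) γ T (N K) k ω ∂P) K)
          =O[atTop] fun K : ℕ => 1 / Real.sqrt K) ∧
        ((fun K : ℕ => avgUpTo (fun k =>
            ∫ ω, D.consensusError S (fun _ => α K) (fun _ => β K) γ T (N K) k ω ∂P) K)
          =O[atTop] fun K : ℕ => 1 / (K : ℝ)) := by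
  obtain ⟨c₁, c₂, hc₁, hc₂, est⟩ := DSBOProblem.exists_estimator_bound hn c
  refine ⟨c₁, c₂, hc₁, hc₂, fun γ hγ => ?_⟩
  obtain ⟨θ, U, B, hθ0, hθ1, hU, hB, est⟩ := est γ hγ
  refine ⟨c.stepRatio n, (-Real.log θ)⁻¹, c.stepRatio_pos n,
    inv_pos.2 (neg_pos.2 (Real.log_neg hθ0 hθ1)), ?_⟩
  intro p q Ξ Ψ Ω _ _ _ P _ D S h hmix het hO hS hbdd T hT α β N hα hβ _ hstep
  have hW := hmix.isGossip hn
  set ρ := max c.ρ (1 / 2) with hρ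
  have hρ1 : 0 < 1 - ρ := by linarith [hW.lt_one]
  have hE : ∀ N, D.IsGoodEstimator S P γ N U (B * θ ^ N) := fun N =>
    ⟨fun k w => (est h hmix hO hS N k w).1, fun k w => (est h hmix hO hS N k w).2.1,
      fun k w => (est h hmix hO hS N k w).2.2.1, fun w => (est h hmix hO hS N 0 w).2.2.2⟩
  obtain ⟨A, hA0, hA⟩ := hα.1.exists_pos
  obtain ⟨a, ha0, ha⟩ := hα.2.exists_pos
  obtain ⟨A', hA'0, hA'⟩ := hβ.1.exists_pos
  have hinv : Tendsto (fun K : ℕ => 1 / Real.sqrt K) atTop (𝓝 0) := by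
    simp only [one_div]
    exact (Real.tendsto_sqrt_atTop.comp tendsto_natCast_atTop_atTop).inv_tendsto_atTop
  have hαlim : Tendsto α atTop (𝓝 0) := hα.1.trans_tendsto hinv
  have hβlim : Tendsto β atTop (𝓝 0) := hβ.1.trans_tendsto hinv
  obtain ⟨C, hC⟩ := DSBOProblem.exists_stationarity_sum_bound (T := T) hn h het hW hO hS hbdd hT γ
    hU.le (A' * a) (B * a ^ 2)
  -- the step sizes are eventually small enough for the recursions, and comparable to `1 / √K`
  have hβ2 : Tendsto (fun K => β K ^ 2 * (8 * (c.Lg1 : ℝ) ^ 2)) atTop (𝓝 0) := by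
    simpa using (hβlim.pow 2).mul_const (8 * (c.Lg1 : ℝ) ^ 2)
  have hβL : Tendsto (fun K => β K * (c.Lg1 : ℝ) ^ 2) atTop (𝓝 0) := by
    simpa using hβlim.mul_const ((c.Lg1 : ℝ) ^ 2)
  have hβμ : Tendsto (fun K => β K * c.μg) atTop (𝓝 0) := by
    simpa using hβlim.mul_const c.μg
  have hlarge : ∀ᶠ K : ℕ in atTop, 0 < K ∧ 0 < α K ∧ α K ≤ 1 ∧ α K ≤ A * (1 / Real.sqrt K) ∧
      1 / Real.sqrt K ≤ a * α K ∧
      α K * ∑ k ∈ Finset.range (K + 1), ∫ ω, D.stationarity S (fun _ => α K) (fun _ => β K) γ T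
        (N K) k ω ∂P ≤ C * (1 + (K + 1 : ℕ) * α K ^ 2) := by
    filter_upwards [hstep, hA.bound, ha.bound, hA'.bound, eventually_gt_atTop 0,
      hαlim.eventually_le_const zero_lt_one, hβlim.eventually_le_const zero_lt_one,
      hβ2.eventually_le_const (show 0 < (1 - ρ) ^ 2 by positivity),
      hβL.eventually_le_const c.μg_pos, hβμ.eventually_le_const zero_lt_one]
      with K ⟨s1, s2, s3, s4⟩ b1 b2 b3 hK l1 l2 l3 l4 l5
    have hK' : (0 : ℝ) < K := by exact_mod_cast hK
    have hs : 0 ≤ 1 / Real.sqrt K := by positivity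
    rw [Real.norm_of_nonneg s1.le, Real.norm_of_nonneg hs] at b1 b2
    rw [Real.norm_of_nonneg s2.le, Real.norm_of_nonneg hs] at b3
    refine ⟨hK, s1, l1, b1, b2, hC (N K) (K + 1) (α K) (β K) _ (hE (N K)) s1 l1 s2 l2 l4 l5 l3 s3
      ?_ (by positivity) ?_⟩
    · rw [mul_assoc]
      exact b3.trans (mul_le_mul_of_nonneg_left b2 hA'0.le)
    · rw [mul_assoc]
      refine mul_le_mul_of_nonneg_left ((pow_le_inv_of_log_le hθ0 hθ1 hK s4).trans ?_) hB.le
      have := pow_le_pow_left₀ hs b2 2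
      rwa [div_pow, one_pow, Real.sq_sqrt hK'.le, mul_pow, one_div] at this
  have hstat := isBigO_minUpTo_and_avgUpTo (a := fun K k =>
      ∫ ω, D.stationarity S (fun _ => α K) (fun _ => β K) γ T (N K) k ω ∂P)
    (f := fun K : ℕ => 1 / Real.sqrt K) (C := |C| * (a + A))
    (fun K k => integral_nonneg fun _ => sq_nonneg _) (by
      filter_upwards [hlarge] with K ⟨hK, a1, _, a3, a4, a5⟩
      have hK' : (0 : ℝ) < K := by exact_mod_cast hK
      rw [avgUpTo, div_le_iff₀ (by positivity), ← mul_le_mul_iff_right₀ a1]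
      refine a5.trans ((mul_le_mul_of_nonneg_right (le_abs_self C) (by positivity)).trans ?_)
      have e1 : 1 ≤ α K * (a * (1 / Real.sqrt K)) * (K + 1) := by
        have f1 : (1 / Real.sqrt K) * (1 / Real.sqrt K) * K = 1 := by
          rw [div_mul_div_comm, Real.mul_self_sqrt hK'.le]; field_simp
        have f2 : (1 / Real.sqrt K) * (1 / Real.sqrt K) ≤ a * α K * (1 / Real.sqrt K) :=
          mul_le_mul_of_nonneg_right a4 (by positivity)
        have f3 := mul_le_mul_of_nonneg_right f2 hK'.le
        have f4 : 0 ≤ α K * (a * (1 / Real.sqrt K)) := by positivity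
        linarith
      have e2 : α K ^ 2 * (K + 1) ≤ α K * (A * (1 / Real.sqrt K)) * (K + 1) := by
        rw [sq]
        exact mul_le_mul_of_nonneg_right (mul_le_mul_of_nonneg_left a3 a1.le) (by positivity)
      have e3 := mul_le_mul_of_nonneg_left (add_le_add e1 e2) (abs_nonneg C)
      push_cast
      linarith)
  have hcons := isBigO_minUpTo_and_avgUpTo (a := fun K k =>
      ∫ ω, D.consensusError S (fun _ => α K) (fun _ => β K) γ T (N K) k ω ∂P)
    (f := fun K : ℕ => 1 / (K : ℝ)) (C := A ^ 2 * (n * U / (1 - ρ) ^ 2 / n))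
    (fun K k => integral_nonneg fun _ => div_nonneg (Finset.sum_nonneg fun _ _ => sq_nonneg _)
      (Nat.cast_nonneg n)) (by
      filter_upwards [hlarge] with K ⟨hK, a1, a2, a3, _⟩
      have hK' : (0 : ℝ) < K := by exact_mod_cast hK
      refine avgUpTo_le (fun k => ?_) K
      rw [DSBOProblem.integral_consensusError]
      have e1 := DSBOProblem.consX_le (β := β K) (T := T) hn h hW hO hS (hE (N K)) hU.le a1.le a2 k
      have e2 : α K ^ 2 ≤ A ^ 2 * (1 / K) := by
        have := pow_le_pow_left₀ a1.le a3 2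
        rwa [mul_pow, div_pow, one_pow, Real.sq_sqrt hK'.le] at this
      have e3 := e1.trans (mul_le_mul_of_nonneg_right e2
        (show 0 ≤ n * U / (1 - ρ) ^ 2 by positivity))
      refine (div_le_div_of_nonneg_right e3 (Nat.cast_nonneg n)).trans_eq ?_
      ring)
  exact ⟨h.differentiable_Phi hn, fun K k =>
    ⟨DSBOProblem.integrable_stationarity hn h hO hS (hE (N K)) k,
      DSBOProblem.integrable_consensusError h hO hS (hE (N K)) k⟩,
    hstat.1, hcons.1, hstat.2, hcons.2⟩
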